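/- Let $p$ be an odd prime, $\mathbb F_q$ a finite field of characteristic $p$, and $\mathcal S_d$ the space of homogeneous polynomials of degree $d$ in $\mathbb F_q[X,Z]$ (together with $0$). For coprime $g,h\in\mathcal S_d$ put $f=g/h$, let $C_f$ be the Artin–Schreier cover $y^p-y=f$ of $\mathbb P^1$, and let its genus be given by $2\mathfrak g=(p-1)(d-2+\rho)$, where $\rho$ is the number of distinct geometric zeros of $h$ (the formula valid for pole orders prime to $p$). Consider the following families, each with the uniform probability measure. - $\mathcal F_d^{\mathrm{ord}}$: pairs $(g,h)\in\mathcal S_d^2$ with $(g,h)=1$ and $h$ square-free; here $\mathfrak g=(p-1)(d-1)$. - $\mathcal F_d^{\mathrm{full}}$: all pairs $(g,h)\in\mathcal S_d^2$ with $(g,h)=1$. Here the genus depends on the cover, and $\mathfrak g$ may be read either as the genus of the individual cover given by the formula above, or as one common number $\mathfrak g=\mathfrak g_d$, depending on the family only, with $\frac{p-1}{2}(d-1)\le\mathfrak g\le(p-1)(d-1)$ (the range of that formula). The result holds in both readings. - $\mathcal F_d^{v}$: pairs $(g,h)\in\mathcal S_d^2$ with $(g,h)=1$ and, up to a nonzero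 constant, $h=\prod_{i=1}^m P_i^{e_i}$ with $P_i$ pairwise non-proportional irreducible forms of degree $r_i$ and $e_i\ge1$, where $d=\sum_i r_ie_i$; here $2\mathfrak g=(p-1)(d-2+\sum_i r_i)$. The number $m$ and the degrees $r_1,\dots,r_m$ are fixed, the exponents $e_i$ vary with $d$, and the families are assumed non-empty. Let $0<\beta<1$ and $\mathcal I=[-\beta/2,\beta/2]$, so $|\mathcal I|=\beta$. For $K\ge 0$ let $I_K^{\pm}(x)=\sum_{|k|\le K}\widehat I_K^{\pm}(k)e^{2\pi ikx}$ be the Beurling–Selberg majorant ($+$) and minorant ($-$) of $\chi_{\mathcal I}$ of degree at most $K$. Explicitly, $\widehat I_K^{\pm}(0)=\beta\pm\frac1{K+1}$ and, for $0<|k|\le K$, $$\widehat I_K^{\pm}(k)=w\Big(\frac{|k|}{K+1}\Big)\frac{\sin(\pi k\beta)}{\pi k}\pm\frac1{K+1}\Big(1-\frac{|k|}{K+1}\Big)\cos(\pi k\beta),\qquad w(u)=\pi u(1-u)\cot(\pi u)+u .$$ For an additive character $\psi$ of $\mathbb F_p$ let $$S_k(f,\psi)=\sum_{x\in\mathbb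 P^1(\mathbb F_{q^k}),\ f(x)\ne\infty}\psi\big(\mathrm{tr}_{\mathbb F_{q^k}/\mathbb F_p}f(x)\big),\qquad S^{\pm}(K,f,\psi)=\sum_{k=1}^{K}\frac{\widehat I_K^{\pm}(k)S_k(f,\psi)+\widehat I_K^{\pm}(-k)S_k(f,\bar\psi)}{q^{k/2}},$$ and, with $\psi(a)=e^{2\pi ia/p}$, let $S^{\pm}(K,C_f)=\sum_{j=1}^{p-1}S^{\pm}(K,f,\psi^j)$, which is a real number. **Theorem.** Let $d$ and $|\mathcal I|$ vary along a sequence such that $\mathfrak g\to\infty$ (for $\mathcal F_d^{\mathrm{full}}$ with the individual genera: $d\to\infty$, so that all genera tend to infinity), and either $|\mathcal I|\in(0,1)$ is fixed, or $|\mathcal I|\to0$ while $\mathfrak g|\mathcal I|\to\infty$ (for the individual genera, equivalently $d|\mathcal I|\to\infty$). Take $K=\lfloor\mathfrak g/\log\log(\mathfrak g|\mathcal I|)\rfloor$. Then, for either choice of sign and over any of the three kinds of families, $$\frac{S^{\pm}(K,C_f)}{\sqrt{\frac{2(p-1)}{\pi^2}\log(\mathfrak g|\mathcal I|)}}$$ has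 a standard Gaussian limiting distribution: for every real $t$, the proportion of members of the family for which this quantity is at most $t$ tends to $\frac1{\sqrt{2\pi}}\int_{-\infty}^te^{-x^2/2}\,dx$. -/

import Mathlib

open Filter Topology
open scoped LinearAlgebra.Projectivization

namespace ArtinSchreier

/-! ### Beurling–Selberg polynomials of the interval `[-β/2, β/2]` -/

/-- The weight `π u (1 - u) cot (π u) + u` for `0 < u < 1`, whose values at `u = k / (K + 1)`
are the damping factors of Vaaler's approximation to the sawtooth function. -/
noncomputable def vaalerWeight (u : ℝ) : ℝ :=
  Real.pi * u * (1 - u) * (Real.cos (Real.pi * u) / Real.sin (Real.pi * u)) + u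

/-- The coefficient of `e(kx)` in the Selberg majorant (`s = 1`) or minorant (`s = -1`) of degree
at most `K` of the characteristic function of `[-β/2, β/2]` modulo `1`. The majorant is
`β + B_K(x - β/2) + B_K(-β/2 - x)` and the minorant is `β - B_K(β/2 - x) - B_K(x + β/2)`, where
`B_K(x) = - ∑_{0 < k ≤ K} w(k/(K+1)) sin(2πkx)/(πk)`
`          + (1/(2(K+1))) ∑_{|k| ≤ K} (1 - |k|/(K+1)) e(kx)`
is Beurling's polynomial (Vaaler's polynomial plus a multiple of the Fejér kernel), with
`w = vaalerWeight`. -/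
noncomputable def selbergCoeff (s : ℤˣ) (β : ℝ) (K : ℕ) (k : ℤ) : ℝ :=
  if k = 0 then β + ((s : ℤ) : ℝ) / (K + 1)
  else
    vaalerWeight (|(k : ℝ)| / (K + 1)) * (Real.sin (Real.pi * k * β) / (Real.pi * k)) +
      ((s : ℤ) : ℝ) / (K + 1) * (1 - |(k : ℝ)| / (K + 1)) * Real.cos (Real.pi * k * β)

/-- The Beurling–Selberg polynomials `I_K^+` (`s = 1`) and `I_K^-` (`s = -1`) of the interval
`[-β/2, β/2]`. -/
noncomputable def selbergPoly (s : ℤˣ) (β : ℝ) (K : ℕ) (x : ℝ) : ℂ :=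
  ∑ k ∈ Finset.Icc (-(K : ℤ)) K,
    (selbergCoeff s β K k : ℂ) * Complex.exp (2 * Real.pi * Complex.I * k * x)

/-- The Fourier coefficient `∫_{-1/2}^{1/2} h(θ) e(-kθ) dθ`. -/
noncomputable def fourierHat (h : ℝ → ℂ) (k : ℤ) : ℂ :=
  ∫ θ in (-(1 / 2 : ℝ))..(1 / 2 : ℝ), h θ * Complex.exp (-(2 * Real.pi * Complex.I * k * θ))

lemma integral_exp_int (m : ℤ) :
    ∫ θ in (-(1 / 2 : ℝ))..(1 / 2 : ℝ), Complex.exp (2 * Real.pi * Complex.I * m * θ) =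
      if m = 0 then 1 else 0 := by
  split_ifs with h
  · subst h
    simp
    norm_num
  · have hc : (2 * Real.pi * Complex.I * m : ℂ) ≠ 0 := by
      have : (m : ℂ) ≠ 0 := by exact_mod_cast h
      have h2 : (Real.pi : ℂ) ≠ 0 := by exact_mod_cast Real.pi_ne_zero
      simp [this, h2, Complex.I_ne_zero]
    rw [integral_exp_mul_complex hc]
    have : Complex.exp (2 * Real.pi * Complex.I * m * ((1 / 2 : ℝ) : ℂ)) =
        Complex.exp (2 * Real.pi * Complex.I * m * ((-(1 / 2) : ℝ) : ℂ)) := by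
      rw [Complex.exp_eq_exp_iff_exists_int]
      refine ⟨m, ?_⟩
      push_cast
      ring
    rw [this, sub_self, zero_div]

/-- The Fourier coefficients of `I_K^±` are the explicit coefficients. -/
lemma fourierHat_selbergPoly (s : ℤˣ) (β : ℝ) (K : ℕ) (k : ℤ) (hk : |k| ≤ K) :
    fourierHat (selbergPoly s β K) k = selbergCoeff s β K k := by
  have key : ∀ θ : ℝ, selbergPoly s β K θ *
      Complex.exp (-(2 * Real.pi * Complex.I * k * θ)) =
      ∑ j ∈ Finset.Icc (-(K : ℤ)) K, (selbergCoeff s β K j : ℂ) *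
        Complex.exp (2 * Real.pi * Complex.I * ((j - k : ℤ) : ℂ) * θ) := by
    intro θ
    rw [selbergPoly, Finset.sum_mul]
    refine Finset.sum_congr rfl fun j _ => ?_
    rw [mul_assoc, ← Complex.exp_add]
    congr 2
    push_cast
    ring
  rw [fourierHat]
  simp_rw [key]
  rw [intervalIntegral.integral_finsetSum]
  · simp_rw [intervalIntegral.integral_const_mul, integral_exp_int, sub_eq_zero]
    rw [abs_le] at hk
    simp [hk.1, hk.2]
  · intro j _
    apply Continuous.intervalIntegrable
    fun_prop

lemma selbergCoeff_neg (s : ℤˣ) (β : ℝ) (K : ℕ) (k : ℤ) :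
    selbergCoeff s β K (-k) = selbergCoeff s β K k := by
  unfold selbergCoeff
  by_cases h : k = 0
  · simp [h]
  · simp [h, neg_div_neg_eq]

/-! ### The families of covers

A cover `y ^ p - y = g / h` is given by a pair `(g, h)` of binary forms of the same degree. -/

section Families

variable (F : Type*) [Field F]

/-- Binary forms live in `F[X, Z]`, the variable `0` being `X` and the variable `1` being `Z`. -/
abbrev Pairs : Type _ := MvPolynomial (Fin 2) F × MvPolynomial (Fin 2) F

/-- Pairs of forms of degree `d` without a common factor. -/
def fullFamily (d : ℕ) : Set (Pairs F) :=
  {f | f.1.IsHomogeneous d ∧ f.2.IsHomogeneous d ∧ IsRelPrime f.1 f.2}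

/-- Those with square-free denominator. -/
def ordFamily (d : ℕ) : Set (Pairs F) :=
  {f | f ∈ fullFamily F d ∧ Squarefree f.2}

variable {F}

/-- `h` is, up to a nonzero constant, `∏ i, P i ^ e i` with `P i` pairwise non-associated
irreducible forms of degree `r i`. -/
def HasFactorizationType {m : ℕ} (r e : Fin m → ℕ) (h : MvPolynomial (Fin 2) F) : Prop :=
  ∃ P : Fin m → MvPolynomial (Fin 2) F,
    (∀ i, Irreducible (P i) ∧ (P i).IsHomogeneous (r i)) ∧
    (∀ i j, i ≠ j → ¬ Associated (P i) (P j)) ∧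
    Associated h (∏ i, P i ^ e i)

variable (F)

/-- Coprime pairs of forms of degree `d = ∑ i, r i * e i` whose denominator has the factorization
type with degrees `r` and exponents `e`. -/
def typeFamily {m : ℕ} (r e : Fin m → ℕ) : Set (Pairs F) :=
  {f | f ∈ fullFamily F (∑ i, r i * e i) ∧ HasFactorizationType r e f.2}

variable {F}

/-- The number of distinct geometric zeros of `h` on `ℙ¹`, that is, the number of poles of `g / h`
when `g` and `h` are coprime. -/
noncomputable def poleCount (h : MvPolynomial (Fin 2) F) : ℕ :=
  {P : ℙ (AlgebraicClosure F) (Fin 2 → AlgebraicClosure F) |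
    MvPolynomial.aeval P.rep h = 0}.ncard

end Families

/-- The genus `(p - 1)(d - 2 + ρ) / 2` of an Artin–Schreier cover whose polar divisor has degree
`d` and is supported at `ρ` geometric points (orders prime to `p`). -/
noncomputable def genus (p d ρ : ℕ) : ℝ := ((p : ℝ) - 1) / 2 * ((d : ℝ) - 2 + ρ)

/-! ### Character sums -/

section Sums

variable (p : ℕ) [Fact p.Prime] {F : Type*} [Field F] [Finite F] [CharP F p]

/-- `S_k(f, ψ)`: the sum of `ψ (tr f(x))` over `x ∈ ℙ¹(𝔽_{q^k})` with `f(x) ≠ ∞`, where `f = g / h`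
and `tr` is the absolute trace. As `g` and `h` are forms of the same degree, `g(x) / h(x)` does not
depend on the homogeneous coordinates chosen for `x`. -/
noncomputable def pointSum (k : ℕ) [NeZero k] (ψ : AddChar (ZMod p) ℂ) (f : Pairs F) : ℂ :=
  ∑ᶠ (x : ℙ (FiniteField.Extension F p k) (Fin 2 → FiniteField.Extension F p k))
    (_ : MvPolynomial.aeval x.rep f.2 ≠ 0),
    ψ (Algebra.trace (ZMod p) (FiniteField.Extension F p k)
      (MvPolynomial.aeval x.rep f.1 / MvPolynomial.aeval x.rep f.2))

/-- `S^±(K, f, ψ)`, for the interval `[-β/2, β/2]`; the summation index is `k + 1`. -/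
noncomputable def weightedSum (s : ℤˣ) (β : ℝ) (K : ℕ) (f : Pairs F)
    (ψ : AddChar (ZMod p) ℂ) : ℂ :=
  ∑ k ∈ Finset.range K,
    (fourierHat (selbergPoly s β K) ((k : ℤ) + 1) * pointSum p (k + 1) ψ f +
      fourierHat (selbergPoly s β K) (-((k : ℤ) + 1)) * pointSum p (k + 1) ψ⁻¹ f) /
    (((Nat.card F : ℝ) ^ (((k : ℝ) + 1) / 2) : ℝ) : ℂ)

/-- `S^±(K, C_f) = ∑_{j=1}^{p-1} S^±(K, f, ψ^j)` with `ψ(a) = e^{2πia/p}`. -/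
noncomputable def curveSum (s : ℤˣ) (β : ℝ) (K : ℕ) (f : Pairs F) : ℂ :=
  ∑ j ∈ Finset.Icc 1 (p - 1), weightedSum p s β K f (ZMod.stdAddChar ^ j)

lemma conj_pointSum (k : ℕ) [NeZero k] (ψ : AddChar (ZMod p) ℂ) (f : Pairs F) :
    (starRingEnd ℂ) (pointSum p k ψ f) = pointSum p k ψ⁻¹ f := by
  have hc : ∀ a, (starRingEnd ℂ) (ψ a) = ψ⁻¹ a := fun a => by
    rw [AddChar.inv_apply]
    exact (AddChar.map_neg_eq_conj ψ a).symm
  have hfin : ∀ (φ : ℙ (FiniteField.Extension F p k) (Fin 2 → FiniteField.Extension F p k) → ℂ),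
      (starRingEnd ℂ) (∑ᶠ x, φ x) = ∑ᶠ x, (starRingEnd ℂ) (φ x) := fun φ =>
    map_finsum (starRingEnd ℂ) (Set.toFinite _)
  unfold pointSum
  rw [hfin]
  refine finsum_congr fun x => ?_
  by_cases h : MvPolynomial.aeval x.rep f.2 = 0
  · simp [h]
  · simp [h, hc]

/-- `S^±(K, C_f)` is a real number. -/
lemma curveSum_im (s : ℤˣ) (β : ℝ) (K : ℕ) (f : Pairs F) : (curveSum p s β K f).im = 0 := by
  rw [← Complex.conj_eq_iff_im]
  unfold curveSum
  rw [map_sum]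
  refine Finset.sum_congr rfl fun j _ => ?_
  unfold weightedSum
  rw [map_sum]
  refine Finset.sum_congr rfl fun k hk => ?_
  have hk' : |((k : ℤ) + 1)| ≤ (K : ℤ) := by
    rw [Finset.mem_range] at hk
    rw [abs_of_nonneg (by positivity)]
    omega
  rw [map_div₀, map_add, map_mul, map_mul, fourierHat_selbergPoly _ _ _ _ hk',
    fourierHat_selbergPoly _ _ _ _ (by rwa [abs_neg]), selbergCoeff_neg,
    conj_pointSum, conj_pointSum, inv_inv, Complex.conj_ofReal, Complex.conj_ofReal, add_comm]

/-- `S^±(K, C_f) / √((2(p-1)/π²) log(γ |I|))` with `K = γ / log log(γ |I|)` rounded down,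
`I = [-β/2, β/2]` and genus parameter `γ`. -/
noncomputable def normalizedSum (s : ℤˣ) (β γ : ℝ) (f : Pairs F) : ℝ :=
  (curveSum p s β ⌊γ / Real.log (Real.log (γ * β))⌋₊ f).re /
    Real.sqrt (2 * ((p : ℝ) - 1) / Real.pi ^ 2 * Real.log (γ * β))

end Sums

/-! ### Limiting distributions -/

/-- The random variables `X n`, on the finite probability spaces `A n` with uniform measure,
converge in distribution to a standard Gaussian. -/
def HasStandardGaussianLimit {Ω : Type*} (A : ℕ → Set Ω) (X : ℕ → Ω → ℝ) : Prop :=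
  ∀ t : ℝ, Tendsto (fun n => ({ω ∈ A n | X n ω ≤ t}.ncard : ℝ) / ((A n).ncard : ℝ)) atTop
    (𝓝 ((ProbabilityTheory.gaussianReal 0 1).real (Set.Iic t)))

/-- `γ n → ∞`, and the interval lengths `β n ∈ (0, 1)` are either constant or tend to `0` in such a
way that `γ n * β n → ∞`. -/
def AdmissibleLengths (γ β : ℕ → ℝ) : Prop :=
  Tendsto γ atTop atTop ∧ (∀ n, 0 < β n ∧ β n < 1) ∧
    ((∃ b, ∀ n, β n = b) ∨
      (Tendsto β atTop (𝓝 0) ∧ Tendsto (fun n => γ n * β n) atTop atTop))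

end ArtinSchreier

/-! Fix a nonzero denominator `h` of degree `d` and let the numerator vary. Summing over the
nontrivial characters turns the contribution of a point `x` into `p - 1` or `-1`, according to
whether the trace of `f(x)` vanishes. Grouping geometric points into closed points, `S^±(K, C_f)`
becomes, up to a bounded error, a sum over the closed points `P` of degree at most `K` off the zeros
of `h` of a deterministic weight, `curveWeight`, times the centred indicator of the vanishing of the
trace of `f(P)` (`exists_abs_curveSum_sub_le`). Only closed points of degree `k` and `k / 2` matter
in the sum over `𝔽_{q^k}`; the smaller degrees and the point at infinity are summable after division
by `q^{k/2}`.

By the Chinese remainder theorem the traces at few closed points are jointly uniform when the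
numerator runs through all polynomials of degree at most `d`. Sieving out common factors with `h` by
inclusion-exclusion over the `w` irreducible factors gives joint probabilities for `r` points with
an error of order `4^w q^{rK-d}` (`abs_jointProb_coprimePolys_sub_le`). There are at most `2 q^K`
points and `w` is small compared to `d`, so since `K = o(d)`, which is what the division by `log
log` provides, any fixed number of moments agrees up to `o(1)` with those of independent variables.
`tendsto_card_filter_of_almost_indep` turns this into a central limit theorem: characteristic
functions are expanded to a fixed order, the remainder is controlled by exponential moments of the
independent model, and Lévy's theorem concludes.

The variance is `p - 1` times the sum of the squared weights. There are about `q^m / m` closed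
points of degree `m`, each of squared weight about `4 (m Î(m))^2 / q^m` with `m Î(m)` close to
`sin(πmβ) / π`; so the sum is close to `(4/π²) ∑ sin²(πmβ) / m`, hence to `(2/π²) log(Kβ)` and to
`(2/π²) log(γβ)` (`tendsto_sum_curveWeight_sq_div`). The zeros of `h` might exhaust the closed
points of degree up to about `log d`, but the weights there are small enough for the loss to be
`O(√log(γβ))`.

These estimates hold along every sequence of denominators, hence uniformly in `h`. As all the
families are cut out by conditions on `h` alone, the limit passes from the fibres to the families
(`hasStandardGaussianLimit_of_denominators`). -/

open MeasureTheory ProbabilityTheory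
open scoped ENNReal BigOperators

namespace ArtinSchreier

/-! ### Weak convergence of empirical laws from characteristic functions. -/

section Levy

variable {Ω : Type*}

/-- The law of `X` under the uniform distribution on the finite set `A`. -/
noncomputable def empiricalMeasure (A : Finset Ω) (X : Ω → ℝ) : Measure ℝ :=
  ((A.card : ℝ≥0∞)⁻¹) • ∑ ω ∈ A, Measure.dirac (X ω)

lemma isProbabilityMeasure_empiricalMeasure {A : Finset Ω} (hA : A.Nonempty) (X : Ω → ℝ) :
    IsProbabilityMeasure (empiricalMeasure A X) := by
  constructor
  have h0 : (A.card : ℝ≥0∞) ≠ 0 := by simpa using hA.ne_empty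
  simp [empiricalMeasure, ENNReal.inv_mul_cancel h0 (ENNReal.natCast_ne_top _)]

lemma charFun_empiricalMeasure (A : Finset Ω) (X : Ω → ℝ) (t : ℝ) :
    charFun (empiricalMeasure A X) t = 𝔼 ω ∈ A, Complex.exp (t * X ω * Complex.I) := by
  rw [charFun_apply_real, empiricalMeasure, integral_smul_measure, integral_finsetSum_measure]
  · simp [Finset.expect_eq_sum_div_card, div_eq_inv_mul]
  · intro i _
    exact integrable_dirac (by simp [enorm_lt_top])

lemma empiricalMeasure_real_Iic (A : Finset Ω) (X : Ω → ℝ) (t : ℝ) :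
    (empiricalMeasure A X).real (Set.Iic t) =
      ((A.filter (X · ≤ t)).card : ℝ) / A.card := by
  rw [empiricalMeasure, measureReal_def, Measure.smul_apply, Measure.finsetSum_apply]
  simp [Set.indicator_apply, Finset.sum_boole, div_eq_inv_mul]

/-- Lévy's continuity theorem for uniform distributions on finite sets. -/
theorem tendsto_card_filter_of_tendsto_charFun (A : ℕ → Finset Ω) (X : ℕ → Ω → ℝ)
    (hA : ∀ᶠ n in atTop, (A n).Nonempty)
    (h : ∀ t : ℝ, Tendsto (fun n => 𝔼 ω ∈ A n, Complex.exp (t * X n ω * Complex.I)) atTop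
      (𝓝 (Complex.exp (-t ^ 2 / 2)))) (t : ℝ) :
    Tendsto (fun n => (((A n).filter (X n · ≤ t)).card : ℝ) / (A n).card) atTop
      (𝓝 ((gaussianReal 0 1).real (Set.Iic t))) := by
  classical
  let μ : ℕ → ProbabilityMeasure ℝ := fun n =>
    if hn : (A n).Nonempty then
      ⟨empiricalMeasure (A n) (X n), isProbabilityMeasure_empiricalMeasure hn _⟩
    else ⟨Measure.dirac 0, inferInstance⟩
  let ν : ProbabilityMeasure ℝ := ⟨gaussianReal 0 1, inferInstance⟩
  have hμ : ∀ᶠ n in atTop, (μ n : Measure ℝ) = empiricalMeasure (A n) (X n) := by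
    filter_upwards [hA] with n hn
    simp [μ, hn]
  have hlim : Tendsto μ atTop (𝓝 ν) := by
    refine ProbabilityMeasure.tendsto_iff_tendsto_charFun.2 fun t => ?_
    have h1 : charFun (ν : Measure ℝ) t = Complex.exp (-t ^ 2 / 2) := by
      simp [ν, charFun_gaussianReal, neg_div]
    rw [h1]
    refine (h t).congr' ?_
    filter_upwards [hμ] with n hn
    rw [hn, charFun_empiricalMeasure]
  have hnull : ν (frontier (Set.Iic t)) = 0 := by
    have := nullSingletonClass_gaussianReal (μ := 0) (v := 1) (by simp)
    have h0 : (gaussianReal 0 1) {t} = 0 := measure_singleton t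
    rw [frontier_Iic]
    change ((gaussianReal 0 1) {t}).toNNReal = 0
    rw [h0, ENNReal.toNNReal_zero]
  have h2 := ProbabilityMeasure.tendsto_measure_of_null_frontier_of_tendsto hlim hnull
  have h3 := (NNReal.continuous_coe.tendsto _).comp h2
  refine h3.congr' ?_
  filter_upwards [hμ] with n hn
  rw [← empiricalMeasure_real_Iic, ← hn]
  rfl

end Levy

/-! ### Taylor remainder of the exponential on the imaginary axis. -/

section Taylor

/-- Taylor's formula for `e^{ix}` with Lagrange's bound for the remainder. -/
lemma norm_exp_mul_I_sub_sum_le (r : ℕ) (x : ℝ) :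
    ‖Complex.exp (x * Complex.I) - ∑ m ∈ Finset.range r, (x * Complex.I) ^ m / m.factorial‖ ≤
      |x| ^ r / r.factorial := by
  -- Working with both directions `I` and `-I` reduces negative `x` to positive `x`. The derivative
  -- of each remainder is `c` times the previous one, so the bound integrates.
  have key : ∀ r : ℕ, ∀ c : ℂ, c = Complex.I ∨ c = -Complex.I → ∀ x : ℝ, 0 ≤ x →
      ‖Complex.exp (x * c) - ∑ m ∈ Finset.range r, (x * c) ^ m / m.factorial‖ ≤
      x ^ r / r.factorial := by
    intro r c hc
    have hcn : ‖c‖ = 1 := by rcases hc with rfl | rfl <;> simp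
    induction r with
    | zero =>
      intro x _
      rcases hc with rfl | rfl
      · simp [Complex.norm_exp]
      · simp [Complex.norm_exp]
    | succ r ih =>
      intro x hx
      have hder : ∀ y : ℝ, HasDerivAt (fun y : ℝ => Complex.exp (y * c) -
          ∑ m ∈ Finset.range (r + 1), (y * c) ^ m / m.factorial)
          (c * (Complex.exp (y * c) - ∑ m ∈ Finset.range r, (y * c) ^ m / m.factorial)) y := by
        intro y
        have hlin : HasDerivAt (fun y : ℝ => (y : ℂ) * c) c y := by
          simpa using (Complex.ofRealCLM.hasDerivAt (x := y)).mul_const c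
        have h1 := hlin.cexp
        have h2 : HasDerivAt (fun y : ℝ => ∑ m ∈ Finset.range (r + 1), ((y : ℂ) * c) ^ m /
            m.factorial) (∑ m ∈ Finset.range r, c * (((y : ℂ) * c) ^ m / m.factorial)) y := by
          have h3 : HasDerivAt (fun y : ℝ => ∑ m ∈ Finset.range (r + 1), ((y : ℂ) * c) ^ m /
              m.factorial) (∑ m ∈ Finset.range (r + 1),
                (m * ((y : ℂ) * c) ^ (m - 1) * c / m.factorial)) y := by
            refine HasDerivAt.fun_sum fun m _ => ?_
            exact (hlin.pow m).div_const _
          convert h3 using 1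
          rw [Finset.sum_range_succ']
          simp only [CharP.cast_eq_zero, zero_mul, zero_div, add_zero]
          refine Finset.sum_congr rfl fun m _ => ?_
          rw [Nat.factorial_succ, Nat.add_sub_cancel]
          have : ((m : ℂ) + 1) ≠ 0 := by exact_mod_cast Nat.succ_ne_zero m
          have h4 : (m.factorial : ℂ) ≠ 0 := by exact_mod_cast Nat.factorial_ne_zero m
          push_cast
          field_simp
        refine (h1.sub h2).congr_deriv ?_
        rw [← Finset.mul_sum]
        ring
      have hB : ∀ y : ℝ, HasDerivAt (fun y : ℝ => y ^ (r + 1) / (r + 1).factorial)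
          (y ^ r / r.factorial) y := by
        intro y
        refine ((hasDerivAt_pow (r + 1) y).div_const ((r + 1).factorial : ℝ)).congr_deriv ?_
        rw [Nat.factorial_succ]
        have h4 : (r.factorial : ℝ) ≠ 0 := by exact_mod_cast Nat.factorial_ne_zero r
        push_cast
        field_simp
      refine image_norm_le_of_norm_deriv_right_le_deriv_boundary
        (a := 0) (b := x) (f := fun y : ℝ => Complex.exp (y * c) -
          ∑ m ∈ Finset.range (r + 1), (y * c) ^ m / m.factorial)
        (B := fun y : ℝ => y ^ (r + 1) / (r + 1).factorial)
        (fun y _ => (hder y).continuousAt.continuousWithinAt)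
        (fun y _ => (hder y).hasDerivWithinAt) ?_ hB ?_ ⟨hx, le_rfl⟩
      · simp [Finset.sum_range_succ']
      · intro y hy
        rw [norm_mul, hcn, one_mul]
        exact ih y hy.1
  rcases le_total 0 x with hx | hx
  · rw [abs_of_nonneg hx]
    exact key r _ (Or.inl rfl) x hx
  · rw [abs_of_nonpos hx]
    have := key r _ (Or.inr rfl) (-x) (by linarith)
    simpa using this

end Taylor

/-! ### Moments and characteristic functions in terms of joint probabilities. -/

section Moments

variable {Ω Ω' ι : Type*} [Fintype ι]

open Classical in
/-- `p - 1` if `P` holds and `-1` otherwise: a centred variable when `P` has probability `1 / p`. -/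
noncomputable def centered (p : ℕ) (P : Prop) : ℝ := (if P then (p : ℝ) else 0) - 1

open Classical in
/-- The probability, for the uniform distribution on `G`, that all events `Z i`, `i ∈ A`, occur. -/
noncomputable def jointProb (G : Finset Ω) (Z : ι → Ω → Prop) (A : Finset ι) : ℝ :=
  𝔼 ω ∈ G, if ∀ i ∈ A, Z i ω then (1 : ℝ) else 0

open Classical in
-- The power is expanded over tuples of indices, and each factor `p · 1_Z - 1` over the set `B` of
-- places where its first term is chosen. Repeated indices give the same event, whence the image
-- `B.image t`.
lemma expect_sum_centered_pow (p : ℕ) (G : Finset Ω) (Z : ι → Ω → Prop) (a : ι → ℝ) (n : ℕ) :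
    𝔼 ω ∈ G, (∑ i, a i * centered p (Z i ω)) ^ n =
      ∑ t : Fin n → ι, (∏ j, a (t j)) *
        ∑ B : Finset (Fin n), (p : ℝ) ^ B.card * (-1) ^ Bᶜ.card * jointProb G Z (B.image t) := by
  have key : ∀ ω, (∑ i, a i * centered p (Z i ω)) ^ n =
      ∑ t : Fin n → ι, (∏ j, a (t j)) * ∑ B : Finset (Fin n),
        (p : ℝ) ^ B.card * (-1) ^ Bᶜ.card * if ∀ i ∈ B.image t, Z i ω then 1 else 0 := by
    intro ω
    rw [Fintype.sum_pow]
    refine Finset.sum_congr rfl fun t _ => ?_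
    rw [Finset.prod_mul_distrib]
    congr 1
    simp only [centered, sub_eq_add_neg]
    rw [Fintype.prod_add]
    refine Finset.sum_congr rfl fun B _ => ?_
    rw [Finset.prod_const]
    by_cases h : ∀ j ∈ B, Z (t j) ω
    · rw [Finset.prod_congr rfl (fun j hj => if_pos (h j hj)), Finset.prod_const,
        if_pos (by simpa using h), mul_one]
    · push Not at h
      obtain ⟨j, hj, hz⟩ := h
      rw [Finset.prod_eq_zero hj (if_neg hz), if_neg (by
        intro h'
        exact hz (h' _ (Finset.mem_image_of_mem _ hj))), mul_zero, zero_mul]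
  simp_rw [key]
  rw [Finset.expect_sum_comm]
  refine Finset.sum_congr rfl fun t _ => ?_
  rw [← Finset.mul_expect, Finset.expect_sum_comm]
  congr 1
  refine Finset.sum_congr rfl fun B _ => ?_
  rw [← Finset.mul_expect, jointProb]

/-- The moments are linear in the joint probabilities, and the absolute values of the coefficients
add up to `((p + 1) ∑ |a i|)^n`; the `p + 1` comes from the two terms of `p · 1_Z - 1`. -/
lemma abs_moment_sub_moment_le (p : ℕ) (G : Finset Ω) (Z : ι → Ω → Prop)
    (G' : Finset Ω') (Z' : ι → Ω' → Prop) (a : ι → ℝ) (n : ℕ) {ε : ℝ}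
    (h : ∀ A : Finset ι, A.card ≤ n → |jointProb G Z A - jointProb G' Z' A| ≤ ε) :
    |(𝔼 ω ∈ G, (∑ i, a i * centered p (Z i ω)) ^ n) -
      𝔼 ω ∈ G', (∑ i, a i * centered p (Z' i ω)) ^ n| ≤
      ε * (((p : ℝ) + 1) * ∑ i, |a i|) ^ n := by
  classical
  rw [expect_sum_centered_pow, expect_sum_centered_pow, ← Finset.sum_sub_distrib]
  simp_rw [← mul_sub, ← Finset.sum_sub_distrib, ← mul_sub]
  calc _ ≤ ∑ t : Fin n → ι, (∏ j, |a (t j)|) * (ε * ((p : ℝ) + 1) ^ n) := by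
        refine (Finset.abs_sum_le_sum_abs _ _).trans (Finset.sum_le_sum fun t _ => ?_)
        rw [abs_mul, Finset.abs_prod]
        refine mul_le_mul_of_nonneg_left ?_ (Finset.prod_nonneg fun _ _ => abs_nonneg _)
        calc _ ≤ ∑ B : Finset (Fin n), ε * ((p : ℝ) ^ B.card * 1 ^ (Fintype.card (Fin n) - B.card)) := by
              refine (Finset.abs_sum_le_sum_abs _ _).trans (Finset.sum_le_sum fun B _ => ?_)
              rw [abs_mul, abs_mul, abs_pow, abs_pow, abs_neg, abs_one, one_pow, one_pow,
                Nat.abs_cast, mul_one, mul_comm]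
              refine mul_le_mul_of_nonneg_right (h _ ?_) (by positivity)
              exact Finset.card_image_le.trans (by simpa using B.card_le_univ)
          _ = _ := by
              rw [← Finset.mul_sum, Fintype.sum_pow_mul_eq_add_pow, Fintype.card_fin]
    _ = _ := by
        rw [← Finset.sum_mul, mul_pow, Fintype.sum_pow]
        ring

/-- For even `r` the Lagrange remainder averages to a genuine moment rather than an absolute one, so
it can be compared between two spaces. -/
lemma norm_expect_exp_sub_sum_moments_le (G : Finset Ω) (X : Ω → ℝ) {r : ℕ} (hr : Even r)
    (t : ℝ) :
    ‖(𝔼 ω ∈ G, Complex.exp (t * (X ω : ℝ) * Complex.I)) -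
        ∑ m ∈ Finset.range r, (t * Complex.I) ^ m / m.factorial * ((𝔼 ω ∈ G, X ω ^ m : ℝ) : ℂ)‖ ≤
      |t| ^ r * ((𝔼 ω ∈ G, X ω ^ r) / r.factorial) := by
  have e1 : ∑ m ∈ Finset.range r, (t * Complex.I) ^ m / m.factorial *
      ((𝔼 ω ∈ G, X ω ^ m : ℝ) : ℂ) =
      𝔼 ω ∈ G, ∑ m ∈ Finset.range r, ((t * X ω : ℝ) * Complex.I) ^ m / m.factorial := by
    rw [Finset.expect_sum_comm]
    refine Finset.sum_congr rfl fun m _ => ?_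
    rw [Complex.ofReal_expect, Finset.mul_expect]
    refine Finset.expect_congr rfl fun ω _ => ?_
    push_cast
    ring
  rw [e1, ← Finset.expect_sub_distrib, Finset.expect_div, Finset.mul_expect]
  refine (RCLike.norm_expect_le (K := ℂ)).trans (Finset.expect_le_expect fun ω _ => ?_)
  have := norm_exp_mul_I_sub_sum_le r (t * X ω)
  rw [abs_mul, mul_pow, hr.pow_abs (X ω), mul_div_assoc] at this
  simpa using this

/-- Both characteristic functions are replaced by their Taylor polynomials. The `r`-th moment over
`G` in the remainder is exchanged for the one over `G'` at the price of the summand `m = r`, so that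
only the model space `G'` needs a moment bound. -/
lemma norm_expect_exp_sub_expect_exp_le (p : ℕ) (G : Finset Ω) (Z : ι → Ω → Prop)
    (G' : Finset Ω') (Z' : ι → Ω' → Prop) (a : ι → ℝ) {r : ℕ} (hr : Even r) {ε : ℝ}
    (h : ∀ A : Finset ι, A.card ≤ r → |jointProb G Z A - jointProb G' Z' A| ≤ ε) (t : ℝ) :
    ‖(𝔼 ω ∈ G, Complex.exp (t * (∑ i, a i * centered p (Z i ω) : ℝ) * Complex.I)) -
      𝔼 ω ∈ G', Complex.exp (t * (∑ i, a i * centered p (Z' i ω) : ℝ) * Complex.I)‖ ≤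
      ε * ∑ m ∈ Finset.range (r + 1), (|t| * (((p : ℝ) + 1) * ∑ i, |a i|)) ^ m +
      2 * |t| ^ r * ((𝔼 ω ∈ G', (∑ i, a i * centered p (Z' i ω)) ^ r) / r.factorial) := by
  set X : Ω → ℝ := fun ω => ∑ i, a i * centered p (Z i ω) with hX
  set Y : Ω' → ℝ := fun ω => ∑ i, a i * centered p (Z' i ω) with hY
  set M : ℝ := ((p : ℝ) + 1) * ∑ i, |a i| with hM
  have hM0 : 0 ≤ M := by positivity
  have hε : 0 ≤ ε := (abs_nonneg _).trans (h ∅ (by simp))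
  have hmom : ∀ m ≤ r, |(𝔼 ω ∈ G, X ω ^ m) - 𝔼 ω ∈ G', Y ω ^ m| ≤ ε * M ^ m := fun m hm =>
    abs_moment_sub_moment_le p G Z G' Z' a m fun A hA => h A (hA.trans hm)
  have h1 := norm_expect_exp_sub_sum_moments_le G X hr t
  have h2 := norm_expect_exp_sub_sum_moments_le G' Y hr t
  have h3 : ‖(∑ m ∈ Finset.range r, (t * Complex.I) ^ m / m.factorial *
      ((𝔼 ω ∈ G, X ω ^ m : ℝ) : ℂ)) - ∑ m ∈ Finset.range r, (t * Complex.I) ^ m / m.factorial *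
      ((𝔼 ω ∈ G', Y ω ^ m : ℝ) : ℂ)‖ ≤ ε * ∑ m ∈ Finset.range r, (|t| * M) ^ m := by
    rw [← Finset.sum_sub_distrib, Finset.mul_sum]
    refine (norm_sum_le _ _).trans (Finset.sum_le_sum fun m hm => ?_)
    rw [← mul_sub, norm_mul, norm_div, norm_pow, norm_mul, Complex.norm_I, mul_one,
      Complex.norm_real, Complex.norm_natCast, ← Complex.ofReal_sub, Complex.norm_real,
      Real.norm_eq_abs, Real.norm_eq_abs]
    have hf : (1 : ℝ) ≤ m.factorial := by exact_mod_cast Nat.one_le_iff_ne_zero.2 (Nat.factorial_ne_zero m)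
    calc |t| ^ m / m.factorial * |(𝔼 ω ∈ G, X ω ^ m) - 𝔼 ω ∈ G', Y ω ^ m| ≤
        |t| ^ m * (ε * M ^ m) := by
          refine mul_le_mul (div_le_self (by positivity) hf)
            (hmom m (Finset.mem_range.1 hm).le) (abs_nonneg _) (by positivity)
      _ = ε * (|t| * M) ^ m := by ring_nf
  have h4 : |t| ^ r * ((𝔼 ω ∈ G, X ω ^ r) / r.factorial) ≤
      |t| ^ r * ((𝔼 ω ∈ G', Y ω ^ r) / r.factorial) + ε * (|t| * M) ^ r := by
    have hf : (1 : ℝ) ≤ r.factorial := by exact_mod_cast Nat.one_le_iff_ne_zero.2 (Nat.factorial_ne_zero r)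
    have h5 := (abs_le.1 (hmom r le_rfl)).2
    have h6 : (𝔼 ω ∈ G, X ω ^ r) / r.factorial ≤ (𝔼 ω ∈ G', Y ω ^ r) / r.factorial + ε * M ^ r := by
      rw [div_add' _ _ _ (by positivity)]
      gcongr
      have : ε * M ^ r ≤ ε * M ^ r * r.factorial := le_mul_of_one_le_right (by positivity) hf
      linarith
    calc _ ≤ |t| ^ r * ((𝔼 ω ∈ G', Y ω ^ r) / r.factorial + ε * M ^ r) := by gcongr
      _ = _ := by ring_nf
  rw [Finset.sum_range_succ, mul_add]
  set c1 := ∑ m ∈ Finset.range r, (t * Complex.I) ^ m / m.factorial *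
      ((𝔼 ω ∈ G, X ω ^ m : ℝ) : ℂ)
  set c2 := ∑ m ∈ Finset.range r, (t * Complex.I) ^ m / m.factorial *
      ((𝔼 ω ∈ G', Y ω ^ m : ℝ) : ℂ)
  set b1 := 𝔼 ω ∈ G, Complex.exp (t * (X ω : ℝ) * Complex.I)
  set b2 := 𝔼 ω ∈ G', Complex.exp (t * (Y ω : ℝ) * Complex.I)
  have : b1 - b2 = (b1 - c1) + (c1 - c2) - (b2 - c2) := by ring
  rw [this]
  have h7 := norm_sub_le ((b1 - c1) + (c1 - c2)) (b2 - c2)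
  have h8 := norm_add_le (b1 - c1) (c1 - c2)
  linarith

end Moments

/-! ### The independent model: uniform coordinates in `ZMod p`. -/

section Model

variable {ι : Type*} [Fintype ι] {p : ℕ} [NeZero p]

lemma expect_pi_prod {K : Type*} [Field K] [CharZero K] {κ : Type*} [Fintype κ] [Nonempty κ]
    [DecidableEq ι] (f : ι → κ → K) :
    𝔼 ω : ι → κ, ∏ i, f i (ω i) = ∏ i, 𝔼 b, f i b := by
  simp only [Finset.expect_eq_sum_div_card]
  rw [Finset.prod_div_distrib, Finset.prod_univ_sum, Fintype.piFinset_univ]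
  simp

lemma expect_centered {K : Type*} [Field K] [CharZero K] (g : ℝ → K) :
    𝔼 b : ZMod p, g (centered p (b = 0)) = (g (p - 1) + ((p : K) - 1) * g (-1)) / p := by
  classical
  rw [Finset.expect_eq_sum_div_card]
  have : ∀ b : ZMod p, g (centered p (b = 0)) = g (-1) + if b = 0 then g (p - 1) - g (-1) else 0 := by
    intro b
    by_cases h : b = 0 <;> simp [centered, h]
  have hp : (p : K) ≠ 0 := by exact_mod_cast NeZero.ne p
  rw [Finset.sum_congr rfl fun b _ => this b, Finset.sum_add_distrib]
  simp only [Finset.sum_const, Finset.card_univ, ZMod.card, nsmul_eq_mul, Finset.sum_ite_eq',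
    Finset.mem_univ, if_true]
  ring

lemma jointProb_model [DecidableEq ι] (A : Finset ι) :
    jointProb (Finset.univ : Finset (ι → ZMod p)) (fun i ω => ω i = 0) A =
      ((p : ℝ) ^ A.card)⁻¹ := by
  classical
  have key : jointProb (Finset.univ : Finset (ι → ZMod p)) (fun i ω => ω i = 0) A =
      𝔼 ω : ι → ZMod p, ∏ i, if i ∈ A → ω i = 0 then (1 : ℝ) else 0 := by
    refine Finset.expect_congr rfl fun ω _ => ?_
    by_cases h : ∀ i ∈ A, ω i = 0
    · rw [if_pos h]
      exact (Finset.prod_eq_one fun i _ => if_pos (h i)).symm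
    · rw [if_neg h]
      push Not at h
      obtain ⟨i, hi, h⟩ := h
      rw [Finset.prod_eq_zero (Finset.mem_univ i) (by simp [hi, h])]
  rw [key, expect_pi_prod (fun (i : ι) (b : ZMod p) => if i ∈ A → b = 0 then (1 : ℝ) else 0)]
  rw [← inv_pow, ← Finset.prod_const, ← Finset.prod_subset (Finset.subset_univ A)]
  · refine Finset.prod_congr rfl fun i hi => ?_
    simp [hi, Finset.expect_eq_sum_div_card, ZMod.card]
  · intro i _ hi
    simp [hi]

lemma expect_model_exp (a : ι → ℝ) [DecidableEq ι] (z : ℂ) :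
    𝔼 ω : ι → ZMod p, Complex.exp (z * (∑ i, a i * centered p (ω i = 0) : ℝ)) =
      ∏ i, 𝔼 b : ZMod p, Complex.exp (z * a i * centered p (b = 0)) := by
  rw [← expect_pi_prod (fun i (b : ZMod p) => Complex.exp (z * a i * centered p (b = 0)))]
  refine Finset.expect_congr rfl fun ω _ => ?_
  rw [← Complex.exp_sum]
  push_cast
  rw [Finset.mul_sum]
  simp [mul_assoc]

end Model

lemma norm_prod_sub_prod_le {ι : Type*} (s : Finset ι) (f g : ι → ℂ)
    (hf : ∀ i ∈ s, ‖f i‖ ≤ 1) (hg : ∀ i ∈ s, ‖g i‖ ≤ 1) :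
    ‖∏ i ∈ s, f i - ∏ i ∈ s, g i‖ ≤ ∑ i ∈ s, ‖f i - g i‖ := by
  classical
  induction s using Finset.induction_on with
  | empty => simp
  | insert i s hi ih =>
    rw [Finset.prod_insert hi, Finset.prod_insert hi, Finset.sum_insert hi]
    have h1 : ‖∏ j ∈ s, f j‖ ≤ 1 := by
      rw [norm_prod]
      exact Finset.prod_le_one (fun _ _ => norm_nonneg _)
        fun j hj => hf j (Finset.mem_insert_of_mem hj)
    have h2 := ih (fun j hj => hf j (Finset.mem_insert_of_mem hj))
      (fun j hj => hg j (Finset.mem_insert_of_mem hj))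
    have h3 := hg i (Finset.mem_insert_self i s)
    calc ‖f i * ∏ j ∈ s, f j - g i * ∏ j ∈ s, g j‖
        = ‖(f i - g i) * ∏ j ∈ s, f j + g i * (∏ j ∈ s, f j - ∏ j ∈ s, g j)‖ := by
          congr 1; ring
      _ ≤ ‖f i - g i‖ * ‖∏ j ∈ s, f j‖ + ‖g i‖ * ‖∏ j ∈ s, f j - ∏ j ∈ s, g j‖ := by
          refine (norm_add_le _ _).trans ?_
          rw [norm_mul, norm_mul]
      _ ≤ ‖f i - g i‖ * 1 + 1 * ∑ j ∈ s, ‖f j - g j‖ := by gcongr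
      _ = _ := by ring

/-! ### Exponential moments and Gaussian approximation in the model. -/

section Model

variable {ι : Type*} [Fintype ι] {p : ℕ} [NeZero p]

lemma abs_centered_le (P : Prop) : |centered p P| ≤ p := by
  have : (1 : ℝ) ≤ p := by exact_mod_cast NeZero.one_le
  unfold centered
  split_ifs
  · rw [abs_of_nonneg] <;> linarith
  · simpa

lemma expect_model_rexp [DecidableEq ι] (a : ι → ℝ) (z : ℝ) :
    𝔼 ω : ι → ZMod p, Real.exp (z * ∑ i, a i * centered p (ω i = 0)) =
      ∏ i, 𝔼 b : ZMod p, Real.exp (z * a i * centered p (b = 0)) := by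
  rw [← expect_pi_prod (fun i (b : ZMod p) => Real.exp (z * a i * centered p (b = 0)))]
  refine Finset.expect_congr rfl fun ω _ => ?_
  rw [← Real.exp_sum, Finset.mul_sum]
  simp [mul_assoc]

/-- Each factor is estimated by `e^x ≤ 1 + x + x^2` for `|x| ≤ 1`, where the linear term has mean
zero and a centred indicator has variance `p - 1`; then `1 + u ≤ e^u`. -/
lemma expect_rexp_le_exp [DecidableEq ι] (a : ι → ℝ) (z : ℝ) (h : ∀ i, |z * a i| * p ≤ 1) :
    𝔼 ω : ι → ZMod p, Real.exp (z * ∑ i, a i * centered p (ω i = 0)) ≤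
      Real.exp (z ^ 2 * (((p : ℝ) - 1) * ∑ i, a i ^ 2)) := by
  rw [expect_model_rexp]
  have e1 : z ^ 2 * (((p : ℝ) - 1) * ∑ i, a i ^ 2) = ∑ i, (z * a i) ^ 2 * ((p : ℝ) - 1) := by
    rw [Finset.mul_sum, Finset.mul_sum]
    exact Finset.sum_congr rfl fun i _ => by ring
  rw [e1, Real.exp_sum]
  refine Finset.prod_le_prod (fun i _ => Finset.expect_nonneg fun b _ => (Real.exp_pos _).le)
    fun i _ => ?_
  have h1 : ∀ b : ZMod p, Real.exp (z * a i * centered p (b = 0)) ≤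
      1 + z * a i * centered p (b = 0) + (z * a i * centered p (b = 0)) ^ 2 := by
    intro b
    have h2 : ‖z * a i * centered p (b = 0)‖ ≤ 1 := by
      rw [Real.norm_eq_abs, abs_mul]
      exact (mul_le_mul_of_nonneg_left (abs_centered_le _) (abs_nonneg _)).trans (h i)
    have h3 := Real.norm_exp_sub_one_sub_id_le h2
    rw [Real.norm_eq_abs, Real.norm_eq_abs, sq_abs] at h3
    linarith [(abs_le.1 h3).2]
  have hp : (p : ℝ) ≠ 0 := by exact_mod_cast NeZero.ne p
  calc _ ≤ 𝔼 b : ZMod p, (1 + z * a i * centered p (b = 0) + (z * a i * centered p (b = 0)) ^ 2) :=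
        Finset.expect_le_expect fun b _ => h1 b
    _ = (z * a i) ^ 2 * ((p : ℝ) - 1) + 1 := by
        rw [expect_centered (fun x => 1 + z * a i * x + (z * a i * x) ^ 2)]
        field_simp
        ring
    _ ≤ _ := Real.add_one_le_exp _

/-- Pointwise `(zy)^r / r! ≤ e^{zy} + e^{-zy}`. The free parameter `z` is there to make `z^{-r}`
beat the factor `|t|^r` of the Taylor remainder. -/
lemma expect_even_pow_le [DecidableEq ι] (a : ι → ℝ) {z : ℝ} (hz : 0 < z)
    (h : ∀ i, |z * a i| * p ≤ 1) {r : ℕ} (hr : Even r) :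
    (𝔼 ω : ι → ZMod p, (∑ i, a i * centered p (ω i = 0)) ^ r) / r.factorial ≤
      (z ^ r)⁻¹ * (2 * Real.exp (z ^ 2 * (((p : ℝ) - 1) * ∑ i, a i ^ 2))) := by
  have h1 := expect_rexp_le_exp a z h
  have h2 := expect_rexp_le_exp a (-z) (by simpa using h)
  rw [neg_sq] at h2
  rw [Finset.expect_div, le_inv_mul_iff₀ (by positivity), Finset.mul_expect, two_mul]
  refine le_trans ?_ (add_le_add h1 h2)
  rw [← Finset.expect_add_distrib]
  refine Finset.expect_le_expect fun ω _ => ?_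
  set y := ∑ i, a i * centered p (ω i = 0)
  have h3 := Real.pow_div_factorial_le_exp (|z * y|) (abs_nonneg _) r
  rw [hr.pow_abs, mul_pow, mul_div_assoc] at h3
  refine h3.trans ?_
  rcases abs_choice (z * y) with h4 | h4 <;> rw [h4]
  · linarith [Real.exp_pos (-z * y)]
  · rw [← neg_mul]
    linarith [Real.exp_pos (z * y)]

/-- Both quantities are within a cubic error of `1 - x`, where `x` is half of `t^2` times the
variance: one by Taylor's formula of order two and the vanishing mean, the other by expanding
`e^{-x}`. -/
lemma norm_charFun_factor_sub_le (a t : ℝ) (h : |t * a| * p ≤ 1) :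
    ‖(𝔼 b : ZMod p, Complex.exp (t * Complex.I * a * centered p (b = 0))) -
      Complex.exp (-(t ^ 2 * (((p : ℝ) - 1) * a ^ 2) / 2 : ℝ))‖ ≤ 2 * (|t * a| * p) ^ 3 := by
  have hp : (p : ℝ) ≠ 0 := by exact_mod_cast NeZero.ne p
  have hpc : (p : ℂ) ≠ 0 := by exact_mod_cast NeZero.ne p
  have hp1 : (1 : ℝ) ≤ p := by exact_mod_cast NeZero.one_le
  set x : ℝ := t ^ 2 * (((p : ℝ) - 1) * a ^ 2) / 2 with hx
  set u : ℝ := |t * a| * p with hu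
  have hu0 : 0 ≤ u := by positivity
  have hx0 : 0 ≤ x := by
    have : 0 ≤ (p : ℝ) - 1 := by linarith
    positivity
  have hxu : x ≤ u ^ 2 := by
    rw [hu, mul_pow, sq_abs, hx]
    have : (p : ℝ) - 1 ≤ p ^ 2 := by nlinarith
    nlinarith [mul_le_mul_of_nonneg_left this (sq_nonneg (t * a)), mul_nonneg (sq_nonneg (t * a)) (sq_nonneg (p : ℝ))]
  have hu2 : u ^ 2 ≤ 1 := pow_le_one₀ hu0 h
  have h1 : ‖(𝔼 b : ZMod p, Complex.exp (t * Complex.I * a * centered p (b = 0))) -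
      ((1 - x : ℝ) : ℂ)‖ ≤ u ^ 3 := by
    have e1 : ((1 - x : ℝ) : ℂ) = 𝔼 b : ZMod p, ∑ m ∈ Finset.range 3,
        ((t * a * centered p (b = 0) : ℝ) * Complex.I) ^ m / m.factorial := by
      rw [expect_centered (fun y => ∑ m ∈ Finset.range 3,
        ((t * a * y : ℝ) * Complex.I) ^ m / (m.factorial : ℂ))]
      simp only [Finset.sum_range_succ, Finset.sum_range_zero, Nat.factorial]
      rw [hx]
      push_cast
      field_simp
      ring_nf
      simp only [Complex.I_sq]
      ring
    rw [e1, ← Finset.expect_sub_distrib]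
    refine (RCLike.norm_expect_le (K := ℂ)).trans (Finset.expect_le Finset.univ_nonempty fun b _ => ?_)
    have h2 := norm_exp_mul_I_sub_sum_le 3 (t * a * centered p (b = 0))
    have e2 : (t * Complex.I * a * centered p (b = 0) : ℂ) =
      ((t * a * centered p (b = 0) : ℝ) : ℂ) * Complex.I := by push_cast; ring
    rw [e2]
    refine h2.trans ((div_le_self (by positivity) (by norm_num [Nat.factorial])).trans ?_)
    rw [abs_mul]
    exact pow_le_pow_left₀ (by positivity)
      (mul_le_mul_of_nonneg_left (abs_centered_le _) (abs_nonneg _)) 3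
  have h2 : ‖((1 - x : ℝ) : ℂ) - Complex.exp (-x : ℝ)‖ ≤ u ^ 3 := by
    rw [← Complex.ofReal_exp, ← Complex.ofReal_sub, Complex.norm_real, norm_sub_rev]
    have h3 := Real.norm_exp_sub_one_sub_id_le (x := -x)
      (by rw [norm_neg, Real.norm_of_nonneg hx0]; linarith)
    rw [norm_neg, Real.norm_of_nonneg hx0] at h3
    have e3 : Real.exp (-x) - (1 - x) = Real.exp (-x) - 1 - -x := by ring
    rw [e3]
    refine h3.trans ?_
    calc x ^ 2 ≤ (u ^ 2) ^ 2 := by gcongr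
      _ = u ^ 3 * u := by ring
      _ ≤ u ^ 3 * 1 := by gcongr
      _ = _ := mul_one _
  have := norm_sub_le_norm_sub_add_norm_sub
    (𝔼 b : ZMod p, Complex.exp (t * Complex.I * a * centered p (b = 0)))
    ((1 - x : ℝ) : ℂ) (Complex.exp (-x : ℝ))
  push_cast at *
  linarith

/-- Factors of norm at most one are exchanged one at a time, so the cubic errors add up; one power
of `|a i|` is sacrificed to `M`, which leaves the variance. -/
lemma norm_charFun_model_sub_le [DecidableEq ι] (a : ι → ℝ) (t M : ℝ) (hM : ∀ i, |a i| ≤ M)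
    (h : |t| * M * p ≤ 1) :
    ‖(𝔼 ω : ι → ZMod p, Complex.exp (t * (∑ i, a i * centered p (ω i = 0) : ℝ) * Complex.I)) -
      Complex.exp (-(t ^ 2 * (((p : ℝ) - 1) * ∑ i, a i ^ 2) / 2 : ℝ))‖ ≤
      2 * (|t| * p) ^ 3 * M * ∑ i, a i ^ 2 := by
  have e1 : ∀ ω : ι → ZMod p, (t * (∑ i, a i * centered p (ω i = 0) : ℝ) * Complex.I : ℂ) =
      (t * Complex.I) * (∑ i, a i * centered p (ω i = 0) : ℝ) := fun ω => by ring
  simp_rw [e1]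
  rw [expect_model_exp]
  have e2 : Complex.exp (-(t ^ 2 * (((p : ℝ) - 1) * ∑ i, a i ^ 2) / 2 : ℝ)) =
      ∏ i, Complex.exp (-(t ^ 2 * (((p : ℝ) - 1) * a i ^ 2) / 2 : ℝ)) := by
    rw [← Complex.exp_sum]
    congr 1
    push_cast
    rw [Finset.mul_sum, Finset.mul_sum, Finset.sum_div, Finset.sum_neg_distrib]
  have hp1 : (1 : ℝ) ≤ p := by exact_mod_cast NeZero.one_le
  rw [e2, Finset.mul_sum]
  refine (norm_prod_sub_prod_le _ _ _ ?_ ?_).trans (Finset.sum_le_sum fun i _ => ?_)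
  · intro i _
    refine (RCLike.norm_expect_le (K := ℂ)).trans (Finset.expect_le Finset.univ_nonempty fun b _ => ?_)
    have e3 : (t * Complex.I * a i * centered p (b = 0) : ℂ) =
      ((t * a i * centered p (b = 0) : ℝ) : ℂ) * Complex.I := by push_cast; ring
    rw [e3, Complex.norm_exp_ofReal_mul_I]
  · intro i _
    rw [← Complex.ofReal_neg, ← Complex.ofReal_exp, Complex.norm_real,
      Real.norm_of_nonneg (Real.exp_pos _).le, Real.exp_le_one_iff, neg_nonpos]
    have : 0 ≤ (p : ℝ) - 1 := by linarith
    positivity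
  · have h1 : |t * a i| * p ≤ 1 := by
      rw [abs_mul]
      refine le_trans ?_ h
      gcongr
      exact hM i
    refine (norm_charFun_factor_sub_le (a i) t h1).trans ?_
    calc 2 * (|t * a i| * p) ^ 3 = 2 * (|t| * p) ^ 3 * |a i| * |a i| ^ 2 := by rw [abs_mul]; ring
      _ ≤ 2 * (|t| * p) ^ 3 * M * |a i| ^ 2 := by gcongr; exact hM i
      _ = _ := by rw [sq_abs]

end Model

/-! ### Central limit theorem under approximate independence. -/

/-- A central limit theorem for sums of centred indicator variables of which any bounded number
is almost independent. -/
theorem tendsto_card_filter_of_almost_indep (p : ℕ) [NeZero p] (hp : 2 ≤ p) {Ω : Type*}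
    (G : ℕ → Finset Ω) {ι : ℕ → Type*} [∀ n, Fintype (ι n)] (Z : ∀ n, ι n → Ω → Prop)
    (a : ∀ n, ι n → ℝ) (X : ℕ → Ω → ℝ) (e M : ℕ → ℝ)
    (hG : ∀ᶠ n in atTop, (G n).Nonempty)
    (hV : Tendsto (fun n => ((p : ℝ) - 1) * ∑ i, a n i ^ 2) atTop (𝓝 1))
    (hM : Tendsto M atTop (𝓝 0)) (haM : ∀ᶠ n in atTop, ∀ i, |a n i| ≤ M n)
    (he : Tendsto e atTop (𝓝 0))
    (hX : ∀ᶠ n in atTop, ∀ ω ∈ G n, |X n ω - ∑ i, a n i * centered p (Z n i ω)| ≤ e n)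
    (hind : ∀ r : ℕ, ∃ ε : ℕ → ℝ,
      (∀ᶠ n in atTop, ∀ A : Finset (ι n), A.card ≤ r →
        |jointProb (G n) (Z n) A - ((p : ℝ) ^ A.card)⁻¹| ≤ ε n) ∧
      Tendsto (fun n => ε n * (max 1 (Fintype.card (ι n) : ℝ)) ^ r) atTop (𝓝 0)) (t : ℝ) :
    Tendsto (fun n => (((G n).filter (X n · ≤ t)).card : ℝ) / (G n).card) atTop
      (𝓝 ((gaussianReal 0 1).real (Set.Iic t))) := by
  classical
  refine tendsto_card_filter_of_tendsto_charFun G X hG (fun t => ?_) t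
  have hp0 : (0 : ℝ) < (p : ℝ) - 1 := by
    have : (2 : ℝ) ≤ p := by exact_mod_cast hp
    linarith
  set Y : ∀ n, Ω → ℝ := fun n ω => ∑ i, a n i * centered p (Z n i ω) with hY
  set W : ∀ n, (ι n → ZMod p) → ℝ := fun n ω => ∑ i, a n i * centered p (ω i = 0) with hW
  -- replace `X` by the sum
  have s1 : Tendsto (fun n => (𝔼 ω ∈ G n, Complex.exp (t * X n ω * Complex.I)) -
      𝔼 ω ∈ G n, Complex.exp (t * Y n ω * Complex.I)) atTop (𝓝 0) := by
    rw [tendsto_zero_iff_norm_tendsto_zero]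
    refine tendsto_of_tendsto_of_tendsto_of_le_of_le' tendsto_const_nhds
      (by simpa using he.const_mul |t|) (Eventually.of_forall fun n => norm_nonneg _) ?_
    filter_upwards [hX, hG] with n hn hGn
    rw [← Finset.expect_sub_distrib]
    refine (RCLike.norm_expect_le (K := ℂ)).trans (Finset.expect_le hGn fun ω hω => ?_)
    have e1 : Complex.exp (t * X n ω * Complex.I) - Complex.exp (t * Y n ω * Complex.I) =
        Complex.exp ((t * Y n ω : ℝ) * Complex.I) *
          (Complex.exp (Complex.I * (t * (X n ω - Y n ω) : ℝ)) - 1) := by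
      rw [mul_sub, ← Complex.exp_add]
      push_cast
      ring_nf
    rw [e1, norm_mul, Complex.norm_exp_ofReal_mul_I, one_mul]
    refine Real.norm_exp_I_mul_ofReal_sub_one_le.trans ?_
    rw [Real.norm_eq_abs, abs_mul]
    exact mul_le_mul_of_nonneg_left (hn ω hω) (abs_nonneg _)
  -- the independent model
  have s3 : Tendsto (fun n => 𝔼 ω : ι n → ZMod p, Complex.exp (t * W n ω * Complex.I)) atTop
      (𝓝 (Complex.exp (-t ^ 2 / 2))) := by
    have h1 : Tendsto (fun n => Complex.exp (-(t ^ 2 * (((p : ℝ) - 1) * ∑ i, a n i ^ 2) / 2 : ℝ)))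
        atTop (𝓝 (Complex.exp (-t ^ 2 / 2))) := by
      have h2 : Tendsto (fun n => -(t ^ 2 * (((p : ℝ) - 1) * ∑ i, a n i ^ 2) / 2)) atTop
          (𝓝 (-(t ^ 2 * 1 / 2))) := ((hV.const_mul _).div_const _).neg
      have h3 := (Complex.continuous_exp.tendsto _).comp
        ((Complex.continuous_ofReal.tendsto _).comp h2)
      have e2 : ((-(t ^ 2 * 1 / 2) : ℝ) : ℂ) = -t ^ 2 / 2 := by push_cast; ring
      rw [e2] at h3
      refine h3.congr fun n => ?_
      simp
    have h4 : Tendsto (fun n => (𝔼 ω : ι n → ZMod p, Complex.exp (t * W n ω * Complex.I)) -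
        Complex.exp (-(t ^ 2 * (((p : ℝ) - 1) * ∑ i, a n i ^ 2) / 2 : ℝ))) atTop (𝓝 0) := by
      rw [tendsto_zero_iff_norm_tendsto_zero]
      have h5 : Tendsto (fun n => 2 * (|t| * p) ^ 3 * M n * ∑ i, a n i ^ 2) atTop (𝓝 0) := by
        have := ((hM.const_mul (2 * (|t| * p) ^ 3)).mul hV).mul_const ((p : ℝ) - 1)⁻¹
        simp only [mul_zero, zero_mul] at this
        refine this.congr fun n => ?_
        field_simp
      refine tendsto_of_tendsto_of_tendsto_of_le_of_le' tendsto_const_nhds h5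
        (Eventually.of_forall fun n => norm_nonneg _) ?_
      have h6 : ∀ᶠ n in atTop, |t| * M n * p < 1 := by
        have := (hM.const_mul |t|).mul_const (p : ℝ)
        simp only [mul_zero, zero_mul] at this
        exact this.eventually_lt_const zero_lt_one
      filter_upwards [haM, h6] with n hn hn6
      exact norm_charFun_model_sub_le (a n) t (M n) hn hn6.le
    simpa using h4.add h1
  -- comparison
  have s2 : Tendsto (fun n => (𝔼 ω ∈ G n, Complex.exp (t * Y n ω * Complex.I)) -
      𝔼 ω : ι n → ZMod p, Complex.exp (t * W n ω * Complex.I)) atTop (𝓝 0) := by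
    rw [Metric.tendsto_nhds]
    intro δ hδ
    -- This `z` makes `(|t| / z)^r ≤ 2^{-r}`, while the variance is eventually below `2`, so `B`
    -- bounds the rest of the remainder independently of `r`. The order `r` is thus fixed before `n`
    -- grows.
    set z : ℝ := 2 * (|t| + 1) with hz
    have hz0 : 0 < z := by positivity
    set B : ℝ := 2 * (2 * Real.exp (z ^ 2 * 2)) with hB
    have hB0 : 0 < B := by positivity
    obtain ⟨k, hk⟩ := exists_pow_lt_of_lt_one (show 0 < δ / 2 / B by positivity)
      (show (1 / 2 : ℝ) < 1 by norm_num)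
    obtain ⟨r, hr, hkr⟩ : ∃ r, Even r ∧ k ≤ r := ⟨2 * k, even_two_mul k, by omega⟩
    obtain ⟨ε, hε, hε0⟩ := hind r
    set c : ℝ := (r + 1) * ((|t| + 1) * ((p : ℝ) + 1)) ^ r with hc
    have h1 : ∀ᶠ n in atTop, c * (ε n * (max 1 (Fintype.card (ι n) : ℝ)) ^ r) < δ / 2 := by
      have := hε0.const_mul c
      rw [mul_zero] at this
      exact this.eventually_lt_const (by positivity)
    have h2 : ∀ᶠ n in atTop, M n < 1 := hM.eventually_lt_const zero_lt_one
    have h3 : ∀ᶠ n in atTop, z * M n * p < 1 := by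
      have := (hM.const_mul z).mul_const (p : ℝ)
      simp only [mul_zero, zero_mul] at this
      exact this.eventually_lt_const zero_lt_one
    have h4 : ∀ᶠ n in atTop, ((p : ℝ) - 1) * ∑ i, a n i ^ 2 < 2 :=
      hV.eventually_lt_const (by norm_num)
    filter_upwards [hε, h1, h2, h3, h4, haM] with n hε h1 h2 h3 h4 haM
    rw [dist_zero_right]
    have hεn : 0 ≤ ε n := (abs_nonneg _).trans (hε ∅ (by simp))
    have hcmp := norm_expect_exp_sub_expect_exp_le p (G n) (Z n)
      (Finset.univ : Finset (ι n → ZMod p)) (fun i ω => ω i = 0) (a n) hr (ε := ε n)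
      (fun A hA => by rw [jointProb_model]; exact hε A hA) t
    refine hcmp.trans_lt ?_
    set N : ℝ := max 1 (Fintype.card (ι n) : ℝ) with hN
    have hN1 : 1 ≤ N := le_max_left _ _
    -- The coefficients are eventually at most one, and the trivial bound for their sum suffices
    -- because the hypothesis on `ε` allows for the `r`-th power of the number of indices.
    have hsum : ∑ i, |a n i| ≤ N := by
      calc ∑ i, |a n i| ≤ ∑ _i : ι n, (1 : ℝ) :=
            Finset.sum_le_sum fun i _ => (haM i).trans h2.le
        _ = Fintype.card (ι n) := by simp
        _ ≤ N := le_max_right _ _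
    have b1 : ε n * ∑ m ∈ Finset.range (r + 1), (|t| * (((p : ℝ) + 1) * ∑ i, |a n i|)) ^ m ≤
        c * (ε n * N ^ r) := by
      have : ∀ m ∈ Finset.range (r + 1), (|t| * (((p : ℝ) + 1) * ∑ i, |a n i|)) ^ m ≤
          ((|t| + 1) * ((p : ℝ) + 1)) ^ r * N ^ r := by
        intro m hm
        rw [← mul_pow]
        have hge : 1 ≤ (|t| + 1) * ((p : ℝ) + 1) * N := by
          have h5 : 1 ≤ |t| + 1 := by linarith [abs_nonneg t]
          have h6 : (1 : ℝ) ≤ (p : ℝ) + 1 := by linarith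
          exact one_le_mul_of_one_le_of_one_le (one_le_mul_of_one_le_of_one_le h5 h6) hN1
        calc _ ≤ ((|t| + 1) * ((p : ℝ) + 1) * N) ^ m := by
              rw [mul_assoc (|t| + 1)]
              gcongr
              linarith
          _ ≤ _ := pow_le_pow_right₀ hge (Nat.lt_succ_iff.1 (Finset.mem_range.1 hm))
      have h7 := Finset.sum_le_sum this
      rw [Finset.sum_const, Finset.card_range, nsmul_eq_mul] at h7
      calc _ ≤ ε n * (((r + 1 : ℕ) : ℝ) * (((|t| + 1) * ((p : ℝ) + 1)) ^ r * N ^ r)) := by gcongr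
        _ = _ := by rw [hc]; push_cast; ring
    have b2 : 2 * |t| ^ r * ((𝔼 ω : ι n → ZMod p, W n ω ^ r) / r.factorial) < δ / 2 := by
      have h5 := expect_even_pow_le (a n) hz0 (fun i => by
        rw [abs_mul, abs_of_pos hz0]
        refine le_trans ?_ h3.le
        gcongr
        exact haM i) hr
      calc _ ≤ 2 * |t| ^ r * ((z ^ r)⁻¹ *
            (2 * Real.exp (z ^ 2 * (((p : ℝ) - 1) * ∑ i, a n i ^ 2)))) := by gcongr
        _ ≤ 2 * |t| ^ r * ((z ^ r)⁻¹ * (2 * Real.exp (z ^ 2 * 2))) := by gcongr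
        _ = (|t| / z) ^ r * B := by rw [hB, div_pow]; ring
        _ ≤ (1 / 2) ^ r * B := by
            gcongr ?_ ^ r * B
            rw [div_le_iff₀ hz0, hz]
            linarith
        _ ≤ (1 / 2) ^ k * B := by
            gcongr ?_ * B
            exact pow_le_pow_of_le_one (by norm_num) (by norm_num) hkr
        _ < δ / 2 := (lt_div_iff₀ hB0).1 hk
    calc _ ≤ c * (ε n * N ^ r) + 2 * |t| ^ r * ((𝔼 ω : ι n → ZMod p, W n ω ^ r) / r.factorial) := by
          gcongr
      _ < δ := by linarith
  have := (s1.add s2).add s3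
  simpa using this

end ArtinSchreier

open Polynomial

namespace ArtinSchreier

/-! ### Affine closed points of the projective line. -/

section MonicIrreducible

/-- The monic irreducible polynomials, that is, the affine closed points of the projective line. -/
abbrev MonicIrr (F : Type*) [Field F] : Type _ := {P : F[X] // P.Monic ∧ Irreducible P}

variable {F : Type*} [Field F]

instance (P : MonicIrr F) : Fact (Irreducible P.1) := ⟨P.2.2⟩

lemma MonicIrr.natDegree_pos (P : MonicIrr F) : 0 < P.1.natDegree := P.2.2.natDegree_pos

lemma MonicIrr.eq_of_dvd {P Q : MonicIrr F} (h : P.1 ∣ Q.1) : P = Q :=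
  Subtype.ext (eq_of_monic_of_associated P.2.1 Q.2.1 (P.2.2.associated_of_dvd Q.2.2 h))

lemma MonicIrr.isCoprime_of_ne {P Q : MonicIrr F} (h : P ≠ Q) : IsCoprime P.1 Q.1 :=
  (P.2.2.coprime_iff_not_dvd).2 fun h' => h (MonicIrr.eq_of_dvd h')

lemma MonicIrr.not_dvd_prod {P : MonicIrr F} {B : Finset (MonicIrr F)} (h : P ∉ B) :
    ¬ P.1 ∣ ∏ R ∈ B, R.1 := by
  intro hd
  obtain ⟨R, hR, hd⟩ := (P.2.2.prime.dvd_finsetProd_iff _).1 hd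
  exact h (MonicIrr.eq_of_dvd hd ▸ hR)

lemma monic_prod_monicIrr (B : Finset (MonicIrr F)) : (∏ R ∈ B, R.1).Monic :=
  monic_prod_of_monic _ _ fun P _ => P.2.1

lemma natDegree_prod_monicIrr (B : Finset (MonicIrr F)) :
    (∏ R ∈ B, R.1).natDegree = ∑ R ∈ B, R.1.natDegree :=
  natDegree_prod_of_monic _ _ fun P _ => P.2.1

lemma prod_monicIrr_dvd_iff (B : Finset (MonicIrr F)) (G : F[X]) :
    ∏ R ∈ B, R.1 ∣ G ↔ ∀ R ∈ B, R.1 ∣ G :=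
  ⟨fun h _ hR => (Finset.dvd_prod_of_mem (fun R : MonicIrr F => R.1) hR).trans h,
    fun h => Finset.prod_dvd_of_coprime (fun _ _ _ _ h => MonicIrr.isCoprime_of_ne h) h⟩

lemma natCard_degreeLT (n : ℕ) : Nat.card (degreeLT F n) = Nat.card F ^ n := by
  rw [Nat.card_congr (degreeLTEquiv F n).toEquiv, Nat.card_fun, Nat.card_eq_fintype_card (α := Fin n),
    Fintype.card_fin]

variable [Finite F]

lemma finite_degreeLT (n : ℕ) : (degreeLT F n : Set F[X]).Finite := by
  have : Finite (degreeLT F n) := Finite.of_equiv _ (degreeLTEquiv F n).symm.toEquiv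
  exact Set.toFinite _

/-- The finite set of polynomials of degree less than `n`. -/
noncomputable def polysLT (F : Type*) [Field F] [Finite F] (n : ℕ) : Finset F[X] :=
  (finite_degreeLT n).toFinset

@[simp] lemma mem_polysLT {n : ℕ} {G : F[X]} : G ∈ polysLT F n ↔ G.degree < n := by
  simp [polysLT, mem_degreeLT]

lemma card_polysLT (n : ℕ) : (polysLT F n).card = Nat.card F ^ n := by
  rw [polysLT, ← Set.ncard_eq_toFinset_card _ (finite_degreeLT n), ← natCard_degreeLT]
  rfl

lemma finite_monicIrr_natDegree_le (n : ℕ) : {P : MonicIrr F | P.1.natDegree ≤ n}.Finite := by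
  refine Set.Finite.of_finite_image (f := Subtype.val) ((finite_degreeLT (F := F) (n + 1)).subset ?_)
    Subtype.val_injective.injOn
  rintro _ ⟨P, hP, rfl⟩
  rw [SetLike.mem_coe, mem_degreeLT]
  refine (degree_le_natDegree).trans_lt ?_
  exact_mod_cast Nat.lt_succ_of_le hP

open Classical in
/-- The monic irreducible polynomials of degree `n`. -/
noncomputable def monicIrrOfDegree (F : Type*) [Field F] [Finite F] (n : ℕ) : Finset (MonicIrr F) :=
  (finite_monicIrr_natDegree_le n).toFinset.filter fun P => P.1.natDegree = n

@[simp] lemma mem_monicIrrOfDegree {n : ℕ} {P : MonicIrr F} :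
    P ∈ monicIrrOfDegree F n ↔ P.1.natDegree = n := by
  simp only [monicIrrOfDegree, Finset.mem_filter, Set.Finite.mem_toFinset, Set.mem_ofPred_eq,
    and_iff_right_iff_imp]
  exact fun h => h.le

open Classical in
/-- The monic irreducible divisors of a nonzero polynomial `H`. -/
noncomputable def monicIrrDivisors (H : F[X]) : Finset (MonicIrr F) :=
  (finite_monicIrr_natDegree_le H.natDegree).toFinset.filter fun P => P.1 ∣ H

lemma mem_monicIrrDivisors {H : F[X]} (hH : H ≠ 0) {P : MonicIrr F} :
    P ∈ monicIrrDivisors H ↔ P.1 ∣ H := by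
  simp only [monicIrrDivisors, Finset.mem_filter, Set.Finite.mem_toFinset, Set.mem_ofPred_eq,
    and_iff_right_iff_imp]
  exact fun h => natDegree_le_of_dvd h hH

lemma sum_natDegree_monicIrrDivisors_le {H : F[X]} (hH : H ≠ 0) :
    ∑ P ∈ monicIrrDivisors H, P.1.natDegree ≤ H.natDegree := by
  rw [← natDegree_prod_monicIrr]
  refine natDegree_le_of_dvd ?_ hH
  rw [prod_monicIrr_dvd_iff]
  exact fun _ => (mem_monicIrrDivisors hH).1

lemma card_monicIrrDivisors_le_natDegree {H : F[X]} (hH : H ≠ 0) :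
    (monicIrrDivisors H).card ≤ H.natDegree := by
  refine le_trans ?_ (sum_natDegree_monicIrrDivisors_le hH)
  rw [Finset.card_eq_sum_ones]
  exact Finset.sum_le_sum fun P _ => P.natDegree_pos

/-- The number of irreducible divisors of a polynomial is small compared to its degree. -/
lemma mul_card_monicIrrDivisors_le {H : F[X]} (hH : H ≠ 0) (L : ℕ) :
    L * (monicIrrDivisors H).card ≤ L * Nat.card F ^ L + H.natDegree := by
  classical
  -- There are at most `q^L` divisors of degree less than `L`, and every other one uses up at least
  -- `L` of the degree of `H`.
  have h1 : ((monicIrrDivisors H).filter fun P => P.1.natDegree < L).card ≤ Nat.card F ^ L := by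
    rw [← card_polysLT, ← Finset.card_image_of_injective _ Subtype.val_injective]
    refine Finset.card_le_card fun G hG => ?_
    obtain ⟨P, hP, rfl⟩ := Finset.mem_image.1 hG
    rw [mem_polysLT]
    exact degree_le_natDegree.trans_lt (by exact_mod_cast (Finset.mem_filter.1 hP).2)
  have h2 : L * ((monicIrrDivisors H).filter fun P => ¬ P.1.natDegree < L).card ≤ H.natDegree := by
    refine le_trans ?_ (sum_natDegree_monicIrrDivisors_le hH)
    calc _ = ∑ P ∈ (monicIrrDivisors H).filter fun P => ¬ P.1.natDegree < L, L := by
          rw [Finset.sum_const, smul_eq_mul, mul_comm]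
      _ ≤ ∑ P ∈ (monicIrrDivisors H).filter fun P => ¬ P.1.natDegree < L, P.1.natDegree :=
          Finset.sum_le_sum fun P hP => not_lt.1 (Finset.mem_filter.1 hP).2
      _ ≤ _ := Finset.sum_le_sum_of_subset (Finset.filter_subset _ _)
  rw [← Finset.card_filter_add_card_filter_not (s := monicIrrDivisors H) fun P => P.1.natDegree < L, mul_add]
  exact add_le_add (Nat.mul_le_mul_left _ h1) h2

end MonicIrreducible

/-! ### Equidistribution of traces at closed points for a fixed denominator. -/

section LocalTrace

variable (p : ℕ) [Fact p.Prime] {F : Type*} [Field F] [Algebra (ZMod p) F]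

/-- The absolute trace of the value of `G / H` at the closed point `P`. -/
noncomputable def localTrace (H : F[X]) (P : MonicIrr F) : F[X] →+ ZMod p :=
  (Algebra.trace (ZMod p) (AdjoinRoot P.1)).toAddMonoidHom.comp
    ((AddMonoidHom.mulRight (AdjoinRoot.mk P.1 H)⁻¹).comp (AdjoinRoot.mk P.1).toAddMonoidHom)

lemma localTrace_apply (H : F[X]) (P : MonicIrr F) (G : F[X]) :
    localTrace p H P G = Algebra.trace (ZMod p) (AdjoinRoot P.1)
      (AdjoinRoot.mk P.1 G / AdjoinRoot.mk P.1 H) := by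
  rw [div_eq_mul_inv]
  rfl

lemma localTrace_congr (H : F[X]) (P : MonicIrr F) {G G' : F[X]} (h : P.1 ∣ G - G') :
    localTrace p H P G = localTrace p H P G' := by
  rw [localTrace_apply, localTrace_apply, AdjoinRoot.mk_eq_mk.2 h]

instance (P : MonicIrr F) : Module.Finite F (AdjoinRoot P.1) :=
  (AdjoinRoot.powerBasis P.2.2.ne_zero).finite

variable [Finite F]

instance (P : MonicIrr F) : Finite (AdjoinRoot P.1) := Module.finite_of_finite F

/-- The trace of a finite field is surjective, and `D / H` is a unit at `P`. The multiplier `D`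
serves to count numerators divisible by `D`. -/
lemma exists_localTrace_mul_eq (H D : F[X]) (P : MonicIrr F) (hH : ¬ P.1 ∣ H) (hD : ¬ P.1 ∣ D)
    (b : ZMod p) : ∃ G : F[X], localTrace p H P (D * G) = b := by
  obtain ⟨y, hy⟩ := Algebra.trace_surjective (ZMod p) (AdjoinRoot P.1) b
  obtain ⟨G, hG⟩ := AdjoinRoot.mk_surjective (g := P.1)
    (y * AdjoinRoot.mk P.1 H / AdjoinRoot.mk P.1 D)
  refine ⟨G, ?_⟩
  have h1 : AdjoinRoot.mk P.1 H ≠ 0 := by rwa [Ne, AdjoinRoot.mk_eq_zero]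
  have h2 : AdjoinRoot.mk P.1 D ≠ 0 := by rwa [Ne, AdjoinRoot.mk_eq_zero]
  rw [localTrace_apply, map_mul, hG, ← hy]
  congr 1
  field_simp

/-- Simultaneous approximation at finitely many closed points. -/
lemma exists_degree_lt_localTrace_mul_eq (H D : F[X]) (A : Finset (MonicIrr F))
    (hH : ∀ P ∈ A, ¬ P.1 ∣ H) (hD : ∀ P ∈ A, ¬ P.1 ∣ D) (b : MonicIrr F → ZMod p) {n : ℕ}
    (hn : ∑ P ∈ A, P.1.natDegree ≤ n) :
    ∃ G : F[X], G.degree < n ∧ ∀ P ∈ A, localTrace p H P (D * G) = b P := by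
  choose! g hg using fun P (hP : P ∈ A) => exists_localTrace_mul_eq p H D P (hH P hP) (hD P hP) (b P)
  have hcop : Pairwise (Function.onFun IsCoprime fun P : A => Ideal.span {P.1.1}) := by
    intro P Q hPQ
    rw [Function.onFun, Ideal.isCoprime_span_singleton_iff]
    exact MonicIrr.isCoprime_of_ne fun h => hPQ (Subtype.ext h)
  obtain ⟨r, hr⟩ := Ideal.exists_forall_sub_mem_ideal hcop fun P => g P.1
  set M : F[X] := ∏ P ∈ A, P.1 with hM
  have hMm : M.Monic := monic_prod_monicIrr A
  refine ⟨r %ₘ M, ?_, fun P hP => ?_⟩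
  · refine (degree_modByMonic_lt _ hMm).trans_le ?_
    rw [degree_eq_natDegree hMm.ne_zero, natDegree_prod_monicIrr]
    exact_mod_cast hn
  · rw [← hg P hP]
    refine localTrace_congr p H P ?_
    rw [← mul_sub]
    refine Dvd.dvd.mul_left ?_ _
    have h1 : P.1 ∣ r - g P := Ideal.mem_span_singleton.1 (hr ⟨P, hP⟩)
    have h2 : P.1 ∣ M := Finset.dvd_prod_of_mem (fun P : MonicIrr F => P.1) hP
    have h3 : r %ₘ M - g P = (r - g P) - M * (r /ₘ M) := by
      rw [modByMonic_eq_sub_mul_div r M]; ring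
    rw [h3]
    exact dvd_sub h1 (h2.mul_right _)

open Classical in
-- The vector of traces is additive in `G`, and surjective by simultaneous approximation as soon as
-- there is room for the degrees; its kernel therefore has index exactly `p ^ A.card`.
lemma card_polysLT_filter_localTrace_mul_pow (H D : F[X]) (A : Finset (MonicIrr F))
    (hH : ∀ P ∈ A, ¬ P.1 ∣ H) (hD : ∀ P ∈ A, ¬ P.1 ∣ D) {n : ℕ}
    (hn : ∑ P ∈ A, P.1.natDegree ≤ n) :
    ((polysLT F n).filter fun G => ∀ P ∈ A, localTrace p H P (D * G) = 0).card * p ^ A.card =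
      Nat.card F ^ n := by
  let φ : degreeLT F n →+ (A → ZMod p) := AddMonoidHom.mk' (fun G P => localTrace p H P.1 (D * G.1))
    (by intro G G'; ext P; simp [mul_add])
  have hφ : Function.Surjective φ := by
    intro b
    obtain ⟨G, hG, h⟩ := exists_degree_lt_localTrace_mul_eq p H D A hH hD
      (fun P => if h : P ∈ A then b ⟨P, h⟩ else 0) hn
    refine ⟨⟨G, mem_degreeLT.2 hG⟩, ?_⟩
    ext P
    have := h P.1 P.2
    simpa [φ] using this
  have h1 := AddSubgroup.card_mul_index φ.ker
  rw [AddSubgroup.index_ker, AddMonoidHom.range_eq_top.2 hφ] at h1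
  have h2 : Nat.card (⊤ : AddSubgroup (A → ZMod p)) = p ^ A.card := by
    simp
  have h4 : Nat.card φ.ker =
      ((polysLT F n).filter fun G => ∀ P ∈ A, localTrace p H P (D * G) = 0).card := by
    have hmem : ∀ G : degreeLT F n, G ∈ φ.ker ↔ ∀ P ∈ A, localTrace p H P (D * G.1) = 0 := by
      intro G
      rw [AddMonoidHom.mem_ker, funext_iff]
      exact ⟨fun h P hP => h ⟨P, hP⟩, fun h P => h P.1 P.2⟩
    rw [← Nat.card_eq_finsetCard]
    refine Nat.card_congr ⟨fun G => ⟨G.1.1, ?_⟩, fun G => ⟨⟨G.1, ?_⟩, ?_⟩, fun _ => rfl, fun _ => rfl⟩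
    · exact Finset.mem_filter.2 ⟨mem_polysLT.2 (mem_degreeLT.1 G.1.2), (hmem _).1 G.2⟩
    · exact mem_degreeLT.2 (mem_polysLT.1 (Finset.mem_filter.1 G.2).1)
    · exact (hmem _).2 (Finset.mem_filter.1 G.2).2
  rw [← h4, ← h2, h1, natCard_degreeLT]

lemma card_polysLT_filter_dvd {D : F[X]} (hD : D ≠ 0) (n : ℕ) (Q : F[X] → Prop)
    [DecidablePred fun G => D ∣ G ∧ Q G] [DecidablePred fun G => Q (D * G)] :
    ((polysLT F n).filter fun G => D ∣ G ∧ Q G).card =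
      ((polysLT F (n - D.natDegree)).filter fun G => Q (D * G)).card := by
  symm
  refine Finset.card_bij (fun G _ => D * G) ?_ (fun _ _ _ _ h => mul_left_cancel₀ hD h) ?_
  · intro G hG
    rw [Finset.mem_filter, mem_polysLT] at hG
    rw [Finset.mem_filter, mem_polysLT]
    refine ⟨?_, dvd_mul_right _ _, hG.2⟩
    by_cases h0 : G = 0
    · simp [h0]
    · rw [degree_eq_natDegree h0] at hG
      have h1 : G.natDegree < n - D.natDegree := by exact_mod_cast hG.1
      rw [degree_eq_natDegree (mul_ne_zero hD h0), natDegree_mul hD h0]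
      exact_mod_cast (by omega : D.natDegree + G.natDegree < n)
  · intro G hG
    rw [Finset.mem_filter, mem_polysLT] at hG
    obtain ⟨hG, ⟨E, rfl⟩, hQ⟩ := hG
    refine ⟨E, ?_, rfl⟩
    rw [Finset.mem_filter, mem_polysLT]
    refine ⟨?_, hQ⟩
    by_cases h0 : E = 0
    · simp [h0]
    · rw [degree_eq_natDegree (mul_ne_zero hD h0), natDegree_mul hD h0] at hG
      have h1 : D.natDegree + E.natDegree < n := by exact_mod_cast hG
      rw [degree_eq_natDegree h0]
      exact_mod_cast (by omega : E.natDegree < n - D.natDegree)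

open Classical in
/-- The number of multiples of `∏ R ∈ B, R` of degree less than `n` with vanishing traces at the
closed points in `A`. -/
lemma abs_card_filter_dvd_sub_le (H : F[X]) (A B : Finset (MonicIrr F))
    (hH : ∀ P ∈ A, ¬ P.1 ∣ H) (hAB : Disjoint A B) (n : ℕ) :
    |((((polysLT F n).filter fun G => ∏ R ∈ B, R.1 ∣ G ∧
        ∀ P ∈ A, localTrace p H P G = 0).card : ℕ) : ℝ) -
      ((p : ℝ) ^ A.card)⁻¹ * ((Nat.card F : ℝ) ^ n * ∏ R ∈ B, ((Nat.card F : ℝ) ^ R.1.natDegree)⁻¹)| ≤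
      (Nat.card F : ℝ) ^ ∑ P ∈ A, P.1.natDegree := by
  have hq : (1 : ℝ) ≤ Nat.card F := by exact_mod_cast Nat.card_pos
  have hp : (1 : ℝ) ≤ p := by exact_mod_cast (Fact.out : p.Prime).one_lt.le
  have hp1 : (1 : ℝ) ≤ (p : ℝ) ^ A.card := one_le_pow₀ hp
  set D : F[X] := ∏ R ∈ B, R.1 with hD
  have hD0 : D ≠ 0 := (monic_prod_monicIrr B).ne_zero
  have hDdeg : D.natDegree = ∑ R ∈ B, R.1.natDegree := natDegree_prod_monicIrr B
  have hprod : ∏ R ∈ B, ((Nat.card F : ℝ) ^ R.1.natDegree)⁻¹ = ((Nat.card F : ℝ) ^ D.natDegree)⁻¹ := by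
    rw [Finset.prod_inv_distrib, Finset.prod_pow_eq_pow_sum, hDdeg]
  rw [hprod, card_polysLT_filter_dvd hD0 n fun G => ∀ P ∈ A, localTrace p H P G = 0]
  -- If there is room, the count is exact. Otherwise the count and its expected value are both
  -- nonnegative and at most `q` to the total degree of `A`.
  rcases le_or_gt (D.natDegree + ∑ P ∈ A, P.1.natDegree) n with h | h
  · have h1 := card_polysLT_filter_localTrace_mul_pow p H D A hH
      (fun P hP => MonicIrr.not_dvd_prod (Finset.disjoint_left.1 hAB hP))
      (n := n - D.natDegree) (by omega)
    have h2 : (Nat.card F : ℝ) ^ n = (Nat.card F : ℝ) ^ (n - D.natDegree) * (Nat.card F : ℝ) ^ D.natDegree := by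
      rw [← pow_add]; congr 1; omega
    have h3 : ((((polysLT F (n - D.natDegree)).filter fun G =>
        ∀ P ∈ A, localTrace p H P (D * G) = 0).card : ℕ) : ℝ) * (p : ℝ) ^ A.card =
        (Nat.card F : ℝ) ^ (n - D.natDegree) := by exact_mod_cast h1
    rw [h2, ← h3]
    have h4 : (Nat.card F : ℝ) ^ D.natDegree ≠ 0 := by positivity
    have h5 : (p : ℝ) ^ A.card ≠ 0 := by positivity
    rw [mul_assoc, mul_inv_cancel₀ h4, mul_one, mul_comm, mul_assoc, mul_inv_cancel₀ h5, mul_one,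
      sub_self, abs_zero]
    positivity
  · rw [abs_sub_le_iff]
    have h1 : ((((polysLT F (n - D.natDegree)).filter fun G =>
        ∀ P ∈ A, localTrace p H P (D * G) = 0).card : ℕ) : ℝ) ≤
        (Nat.card F : ℝ) ^ ∑ P ∈ A, P.1.natDegree := by
      calc _ ≤ ((polysLT F (n - D.natDegree)).card : ℝ) := by
            exact_mod_cast Finset.card_filter_le _ _
        _ = (Nat.card F : ℝ) ^ (n - D.natDegree) := by rw [card_polysLT]; push_cast; rfl
        _ ≤ _ := pow_le_pow_right₀ hq (by omega)
    have h2 : ((p : ℝ) ^ A.card)⁻¹ * ((Nat.card F : ℝ) ^ n * ((Nat.card F : ℝ) ^ D.natDegree)⁻¹) ≤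
        (Nat.card F : ℝ) ^ ∑ P ∈ A, P.1.natDegree := by
      calc _ ≤ 1 * ((Nat.card F : ℝ) ^ n * ((Nat.card F : ℝ) ^ D.natDegree)⁻¹) := by
            gcongr
            exact inv_le_one_of_one_le₀ hp1
        _ ≤ _ := by
            rw [one_mul, mul_inv_le_iff₀ (by positivity), ← pow_add]
            exact pow_le_pow_right₀ hq (by omega)
    constructor
    · have : 0 ≤ ((p : ℝ) ^ A.card)⁻¹ * ((Nat.card F : ℝ) ^ n * ((Nat.card F : ℝ) ^ D.natDegree)⁻¹) := by
        positivity
      linarith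
    · have : (0 : ℝ) ≤ (((polysLT F (n - D.natDegree)).filter fun G =>
        ∀ P ∈ A, localTrace p H P (D * G) = 0).card : ℕ) := Nat.cast_nonneg _
      linarith

open Classical in
/-- The number of polynomials of degree less than `n`, prime to `∏ R ∈ W, R`, with vanishing traces
at the closed points in `A`. -/
lemma abs_card_filter_not_dvd_sub_le (H : F[X]) (A W : Finset (MonicIrr F))
    (hH : ∀ P ∈ A, ¬ P.1 ∣ H) (hAW : Disjoint A W) (n : ℕ) :
    |((((polysLT F n).filter fun G => (∀ R ∈ W, ¬ R.1 ∣ G) ∧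
        ∀ P ∈ A, localTrace p H P G = 0).card : ℕ) : ℝ) -
      ((p : ℝ) ^ A.card)⁻¹ * ((Nat.card F : ℝ) ^ n *
        ∏ R ∈ W, (1 - ((Nat.card F : ℝ) ^ R.1.natDegree)⁻¹))| ≤
      2 ^ W.card * (Nat.card F : ℝ) ^ ∑ P ∈ A, P.1.natDegree := by
  -- Inclusion-exclusion over the subsets `B` of `W`; each of the `2 ^ W.card` terms brings the
  -- error of one congruence class.
  have e1 : ((((polysLT F n).filter fun G => (∀ R ∈ W, ¬ R.1 ∣ G) ∧
        ∀ P ∈ A, localTrace p H P G = 0).card : ℕ) : ℝ) =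
      ∑ B ∈ W.powerset, (-1) ^ B.card * ((((polysLT F n).filter fun G => ∏ R ∈ B, R.1 ∣ G ∧
        ∀ P ∈ A, localTrace p H P G = 0).card : ℕ) : ℝ) := by
    simp_rw [Finset.card_filter, Nat.cast_sum, Finset.mul_sum]
    rw [Finset.sum_comm]
    refine Finset.sum_congr rfl fun G _ => ?_
    have e2 : (∏ R ∈ W, (1 + (if R.1 ∣ G then (-1 : ℝ) else 0))) =
        if ∀ R ∈ W, ¬ R.1 ∣ G then 1 else 0 := by
      split_ifs with h
      · exact Finset.prod_eq_one fun R hR => by rw [if_neg (h R hR), add_zero]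
      · push Not at h
        obtain ⟨R, hR, h⟩ := h
        exact Finset.prod_eq_zero hR (by rw [if_pos h]; norm_num)
    have e3 : ∀ B : Finset (MonicIrr F), (∏ R ∈ B, (if R.1 ∣ G then (-1 : ℝ) else 0)) =
        if ∏ R ∈ B, R.1 ∣ G then (-1) ^ B.card else 0 := by
      intro B
      rw [prod_monicIrr_dvd_iff]
      split_ifs with h
      · rw [← Finset.prod_const]
        exact Finset.prod_congr rfl fun R hR => if_pos (h R hR)
      · push Not at h
        obtain ⟨R, hR, h⟩ := h
        exact Finset.prod_eq_zero hR (if_neg h)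
    rw [Finset.prod_one_add] at e2
    simp_rw [e3] at e2
    push_cast
    by_cases hA : ∀ P ∈ A, localTrace p H P G = 0
    · rw [if_congr (and_iff_left hA) rfl rfl, ← e2]
      refine Finset.sum_congr rfl fun B _ => ?_
      rw [if_congr (and_iff_left hA) rfl rfl]
      split_ifs <;> simp
    · rw [if_neg fun h => hA h.2]
      refine (Finset.sum_eq_zero fun B _ => ?_).symm
      rw [if_neg fun h => hA h.2, mul_zero]
  have e4 : (∏ R ∈ W, (1 - ((Nat.card F : ℝ) ^ R.1.natDegree)⁻¹)) =
      ∑ B ∈ W.powerset, (-1) ^ B.card * ∏ R ∈ B, ((Nat.card F : ℝ) ^ R.1.natDegree)⁻¹ := by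
    simp_rw [sub_eq_add_neg]
    rw [Finset.prod_one_add]
    refine Finset.sum_congr rfl fun B _ => ?_
    rw [Finset.prod_neg]
  rw [e1, e4, Finset.mul_sum, Finset.mul_sum, ← Finset.sum_sub_distrib]
  calc _ ≤ ∑ B ∈ W.powerset, (Nat.card F : ℝ) ^ ∑ P ∈ A, P.1.natDegree := by
        refine (Finset.abs_sum_le_sum_abs _ _).trans (Finset.sum_le_sum fun B hB => ?_)
        have hAB : Disjoint A B := hAW.mono_right (Finset.mem_powerset.1 hB)
        refine le_trans (le_of_eq ?_) (abs_card_filter_dvd_sub_le p H A B hH hAB n)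
        rw [mul_left_comm ((Nat.card F : ℝ) ^ n), mul_left_comm (((p : ℝ) ^ A.card)⁻¹), ← mul_sub,
          abs_mul, abs_neg_one_pow, one_mul]
    _ = _ := by rw [Finset.sum_const, Finset.card_powerset, nsmul_eq_mul]; push_cast; rfl

/-- Dehomogenized numerators: the polynomials `G` of degree at most `d` such that the forms of
degree `d` attached to `G` and `H` are coprime. -/
noncomputable def coprimePolys (d : ℕ) (H : F[X]) : Finset F[X] :=
  open Classical in (polysLT F (d + 1)).filter fun G =>
    (∀ R ∈ monicIrrDivisors H, ¬ R.1 ∣ G) ∧ (H.natDegree = d ∨ G.coeff d ≠ 0)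

lemma two_le_natCard : (2 : ℝ) ≤ Nat.card F := by
  exact_mod_cast Finite.one_lt_card (α := F)

open Classical in
-- The main term `κ` does not depend on `A`: taking `A` empty shows that it approximates the whole
-- count, so dividing leaves the probability `p ^ (-A.card)`. Its lower bound holds because each
-- irreducible factor of `H` keeps at least half of the polynomials.
lemma exists_abs_card_coprimePolys_filter_sub_le (d : ℕ) {H : F[X]} (hH : H ≠ 0) :
    ∃ κ : ℝ, (Nat.card F : ℝ) ^ d * (1 / 2) ^ (monicIrrDivisors H).card ≤ κ ∧
      ∀ A : Finset (MonicIrr F), (∀ P ∈ A, ¬ P.1 ∣ H) →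
        |((((coprimePolys d H).filter fun G => ∀ P ∈ A, localTrace p H P G = 0).card : ℕ) : ℝ) -
          ((p : ℝ) ^ A.card)⁻¹ * κ| ≤
          2 * (2 ^ (monicIrrDivisors H).card * (Nat.card F : ℝ) ^ ∑ P ∈ A, P.1.natDegree) := by
  have hq := two_le_natCard (F := F)
  set W := monicIrrDivisors H with hW
  set δ : ℝ := ∏ R ∈ W, (1 - ((Nat.card F : ℝ) ^ R.1.natDegree)⁻¹) with hδ
  have hδ1 : (1 / 2) ^ W.card ≤ δ := by
    rw [← Finset.prod_const]
    refine Finset.prod_le_prod (fun _ _ => by norm_num) fun R _ => ?_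
    have h1 : (2 : ℝ) ≤ (Nat.card F : ℝ) ^ R.1.natDegree :=
      hq.trans (le_self_pow₀ (by linarith) R.natDegree_pos.ne')
    have h2 : ((Nat.card F : ℝ) ^ R.1.natDegree)⁻¹ ≤ 2⁻¹ := inv_anti₀ (by norm_num) h1
    linarith
  have hdisj : ∀ A : Finset (MonicIrr F), (∀ P ∈ A, ¬ P.1 ∣ H) → Disjoint A W := fun A hA =>
    Finset.disjoint_left.2 fun P hP hPW => hA P hP ((mem_monicIrrDivisors hH).1 hPW)
  have key := fun (A : Finset (MonicIrr F)) (hA : ∀ P ∈ A, ¬ P.1 ∣ H) (n : ℕ) =>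
    abs_card_filter_not_dvd_sub_le p H A W hA (hdisj A hA) n
  have hqd : 0 < (Nat.card F : ℝ) ^ d := by positivity
  have hδ0 : 0 ≤ δ := le_trans (by positivity) hδ1
  by_cases hd : H.natDegree = d
  · refine ⟨(Nat.card F : ℝ) ^ (d + 1) * δ, ?_, fun A hA => ?_⟩
    · calc _ ≤ (Nat.card F : ℝ) ^ d * δ := by gcongr
        _ ≤ _ := by
          gcongr
          · linarith
          · omega
    · have h1 : ((coprimePolys d H).filter fun G => ∀ P ∈ A, localTrace p H P G = 0) =
          (polysLT F (d + 1)).filter fun G => (∀ R ∈ W, ¬ R.1 ∣ G) ∧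
            ∀ P ∈ A, localTrace p H P G = 0 := by
        ext G
        simp only [coprimePolys, Finset.mem_filter, hd, true_or, and_true, and_assoc, ← hW]
      rw [h1]
      refine (key A hA (d + 1)).trans ?_
      have : (0 : ℝ) ≤ 2 ^ W.card * (Nat.card F : ℝ) ^ ∑ P ∈ A, P.1.natDegree := by positivity
      linarith
  · refine ⟨(Nat.card F : ℝ) ^ (d + 1) * δ - (Nat.card F : ℝ) ^ d * δ, ?_, fun A hA => ?_⟩
    · rw [pow_succ]
      have : (Nat.card F : ℝ) ^ d * (1 / 2) ^ W.card ≤ (Nat.card F : ℝ) ^ d * δ := by gcongr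
      have h2 : 0 ≤ (Nat.card F : ℝ) ^ d * δ := by positivity
      nlinarith
    -- Here `H` has degree less than `d`, so infinity is a zero of the denominator and the numerator
    -- must not vanish there. The count is the difference of those for degrees below `d + 1` and
    -- below `d`, hence the doubled error.
    · set S := (polysLT F (d + 1)).filter fun G => (∀ R ∈ W, ¬ R.1 ∣ G) ∧
            ∀ P ∈ A, localTrace p H P G = 0 with hS
      have h1 : ((coprimePolys d H).filter fun G => ∀ P ∈ A, localTrace p H P G = 0) =
          S.filter fun G => ¬ G.coeff d = 0 := by
        ext G
        simp only [hS, coprimePolys, Finset.mem_filter, hd, false_or, ← hW]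
        tauto
      have h2 : ((polysLT F d).filter fun G => (∀ R ∈ W, ¬ R.1 ∣ G) ∧
            ∀ P ∈ A, localTrace p H P G = 0) = S.filter fun G => G.coeff d = 0 := by
        ext G
        simp only [hS, Finset.mem_filter, mem_polysLT]
        have : G.degree < (d : ℕ) ↔ G.degree < ((d + 1 : ℕ) : WithBot ℕ) ∧ G.coeff d = 0 := by
          rw [degree_lt_iff_coeff_zero, degree_lt_iff_coeff_zero]
          constructor
          · exact fun h => ⟨fun m hm => h m (by omega), h d le_rfl⟩
          · rintro ⟨h, h'⟩ m hm
            rcases hm.eq_or_lt with rfl | hm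
            · exact h'
            · exact h m hm
        rw [this]
        tauto
      have h3 := Finset.card_filter_add_card_filter_not (s := S) fun G => G.coeff d = 0
      have h4 : (((S.filter fun G => ¬ G.coeff d = 0).card : ℕ) : ℝ) =
          (S.card : ℝ) - ((S.filter fun G => G.coeff d = 0).card : ℕ) := by
        rw [← h3]; push_cast; ring
      have k1 := key A hA (d + 1)
      have k2 := key A hA d
      rw [h2] at k2
      rw [← hS] at k1
      rw [h1, h4, mul_sub]
      have e : ∀ a b c d : ℝ, a - b - (c - d) = (a - c) - (b - d) := fun a b c d => by ring
      rw [e]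
      refine (abs_sub _ _).trans ?_
      linarith

/-- The values at few closed points of a random fraction with denominator `H` are almost
independent. -/
lemma abs_jointProb_coprimePolys_sub_le (d : ℕ) {H : F[X]} (hH : H ≠ 0)
    (hd : 4 * (4 : ℝ) ^ (monicIrrDivisors H).card ≤ (Nat.card F : ℝ) ^ d) :
    (coprimePolys d H).Nonempty ∧
    ∀ (I : Finset (MonicIrr F)) (K r : ℕ), (∀ P ∈ I, ¬ P.1 ∣ H ∧ P.1.natDegree ≤ K) →
      ∀ A : Finset I, A.card ≤ r →
        |jointProb (coprimePolys d H) (fun P G => localTrace p H P.1 G = 0) A -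
          ((p : ℝ) ^ A.card)⁻¹| ≤
          8 * (4 : ℝ) ^ (monicIrrDivisors H).card * (Nat.card F : ℝ) ^ (r * K) /
            (Nat.card F : ℝ) ^ d := by
  classical
  obtain ⟨κ, hκ, key⟩ := exists_abs_card_coprimePolys_filter_sub_le p d hH
  set w := (monicIrrDivisors H).card with hw
  have hq := two_le_natCard (F := F)
  have hqd : 0 < (Nat.card F : ℝ) ^ d := by positivity
  have k0 := key ∅ (by simp)
  simp only [Finset.notMem_empty, false_imp_iff, implies_true, Finset.filter_true, Finset.card_empty,
    pow_zero, inv_one, one_mul, Finset.sum_empty, mul_one] at k0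
  have h2w : (0 : ℝ) < 2 ^ w := by positivity
  have h4w : (4 : ℝ) ^ w = 2 ^ w * 2 ^ w := by rw [← mul_pow]; norm_num
  have hκ2 : (Nat.card F : ℝ) ^ d ≤ κ * 2 ^ w := by
    rw [one_div, inv_pow, mul_inv_le_iff₀ h2w] at hκ
    exact hκ
  -- The hypothesis `hd` says that the error `2 * 2 ^ w` is at most half of the lower bound `q^d /
  -- 2^w` for `κ`.
  have htot : (Nat.card F : ℝ) ^ d / (2 * 2 ^ w) ≤ (coprimePolys d H).card := by
    have h1 := (abs_le.1 k0).1
    rw [div_le_iff₀ (by positivity)]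
    have h3 : (coprimePolys d H).card * 2 ^ w ≥ (κ - 2 * 2 ^ w) * (2 : ℝ) ^ w :=
      mul_le_mul_of_nonneg_right (by linarith) h2w.le
    nlinarith
  have htot0 : (0 : ℝ) < (coprimePolys d H).card := lt_of_lt_of_le (by positivity) htot
  have hne : (coprimePolys d H).Nonempty := by
    rw [← Finset.card_pos]; exact_mod_cast htot0
  refine ⟨hne, fun I K r hI A hA => ?_⟩
  set A' : Finset (MonicIrr F) := A.map (Function.Embedding.subtype _) with hA'
  have hcard : A'.card = A.card := Finset.card_map _
  have hAI : ∀ P ∈ A', P ∈ I := by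
    intro P hP
    obtain ⟨Q, _, rfl⟩ := Finset.mem_map.1 hP
    exact Q.2
  have kA := key A' fun P hP => (hI P (hAI P hP)).1
  have hdeg : ∑ P ∈ A', P.1.natDegree ≤ r * K := by
    calc _ ≤ ∑ P ∈ A', K := Finset.sum_le_sum fun P hP => (hI P (hAI P hP)).2
      _ = A.card * K := by rw [Finset.sum_const, hcard, smul_eq_mul]
      _ ≤ _ := Nat.mul_le_mul_right _ hA
  set N : ℝ := ((((coprimePolys d H).filter fun G => ∀ P ∈ A', localTrace p H P G = 0).card : ℕ) : ℝ)
    with hN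
  have hjoint : jointProb (coprimePolys d H) (fun (P : I) G => localTrace p H P.1 G = 0) A =
      N / (coprimePolys d H).card := by
    rw [jointProb, Finset.expect_eq_sum_div_card, hN, Finset.card_filter]
    push_cast
    congr 1
    refine Finset.sum_congr rfl fun G _ => ?_
    have hiff : (∀ P ∈ A, localTrace p H P.1 G = 0) ↔ ∀ P ∈ A', localTrace p H P G = 0 := by
      simp [hA']
    by_cases h : ∀ P ∈ A', localTrace p H P G = 0
    · rw [if_pos h, if_pos (hiff.2 h)]
    · rw [if_neg h, if_neg fun h' => h (hiff.1 h')]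
  have hp1 : (1 : ℝ) ≤ (p : ℝ) ^ A.card :=
    one_le_pow₀ (by exact_mod_cast (Fact.out : p.Prime).one_lt.le)
  have hpinv : ((p : ℝ) ^ A.card)⁻¹ ≤ 1 := inv_le_one_of_one_le₀ hp1
  have hpinv0 : 0 ≤ ((p : ℝ) ^ A.card)⁻¹ := by positivity
  have hqr : (Nat.card F : ℝ) ^ ∑ P ∈ A', P.1.natDegree ≤ (Nat.card F : ℝ) ^ (r * K) :=
    pow_le_pow_right₀ (by linarith) hdeg
  have hqr1 : 1 ≤ (Nat.card F : ℝ) ^ (r * K) := one_le_pow₀ (by linarith)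
  rw [hcard] at kA
  have hdiff : |N - ((p : ℝ) ^ A.card)⁻¹ * (coprimePolys d H).card| ≤
      4 * 2 ^ w * (Nat.card F : ℝ) ^ (r * K) := by
    have e : N - ((p : ℝ) ^ A.card)⁻¹ * (coprimePolys d H).card =
        (N - ((p : ℝ) ^ A.card)⁻¹ * κ) -
          ((p : ℝ) ^ A.card)⁻¹ * ((coprimePolys d H).card - κ) := by ring
    rw [e]
    refine (abs_sub _ _).trans ?_
    rw [abs_mul, abs_of_nonneg hpinv0]
    have h1 : ((p : ℝ) ^ A.card)⁻¹ * |((coprimePolys d H).card : ℝ) - κ| ≤ 1 * (2 * 2 ^ w) := by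
      gcongr
    have h2 : 2 ^ w * (Nat.card F : ℝ) ^ ∑ P ∈ A', P.1.natDegree ≤ 2 ^ w * (Nat.card F : ℝ) ^ (r * K) := by
      gcongr
    have h3 : (2 : ℝ) ^ w * 1 ≤ 2 ^ w * (Nat.card F : ℝ) ^ (r * K) := by gcongr
    linarith
  rw [hjoint, div_sub' htot0.ne', abs_div, abs_of_pos htot0, mul_comm ((coprimePolys d H).card : ℝ)]
  calc _ ≤ (4 * 2 ^ w * (Nat.card F : ℝ) ^ (r * K)) / ((Nat.card F : ℝ) ^ d / (2 * 2 ^ w)) := by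
        gcongr
    _ = _ := by rw [h4w]; field_simp; ring

end LocalTrace

/-! ### Summation over the nontrivial additive characters. -/

section Characters

variable (p : ℕ) [Fact p.Prime]

/-- The sum over all `p` powers is a geometric sum, equal to `p` or `0`; the trivial character
accounts for the `-1`. -/
lemma sum_stdAddChar_pow (a : ZMod p) :
    ∑ j ∈ Finset.Icc 1 (p - 1), (ZMod.stdAddChar ^ j : AddChar (ZMod p) ℂ) a =
      (centered p (a = 0) : ℝ) := by
  have hp := (Fact.out : p.Prime).pos
  have h1 : ∑ j ∈ Finset.range p, (ZMod.stdAddChar a : ℂ) ^ j =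
      1 + ∑ j ∈ Finset.Icc 1 (p - 1), (ZMod.stdAddChar ^ j : AddChar (ZMod p) ℂ) a := by
    rw [Finset.range_eq_Ico, Finset.sum_eq_sum_Ico_succ_bot hp, pow_zero]
    have : Finset.Ico (0 + 1) p = Finset.Icc 1 (p - 1) := by
      ext; simp only [Finset.mem_Ico, Finset.mem_Icc]; omega
    rw [this]
    rfl
  have h2 : ∑ j ∈ Finset.range p, (ZMod.stdAddChar a : ℂ) ^ j = if a = 0 then (p : ℂ) else 0 := by
    split_ifs with h
    · simp [h]
    · have hne : (ZMod.stdAddChar a : ℂ) ≠ 1 := by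
        rw [← (ZMod.stdAddChar (N := p)).map_zero_eq_one]
        exact fun h' => h (ZMod.injective_stdAddChar h')
      rw [geom_sum_eq hne, ← AddChar.map_nsmul_eq_pow]
      simp
  rw [h2] at h1
  rw [eq_sub_of_add_eq' h1.symm, centered]
  split_ifs <;> simp

lemma sum_stdAddChar_pow_inv (a : ZMod p) :
    ∑ j ∈ Finset.Icc 1 (p - 1), (ZMod.stdAddChar ^ j : AddChar (ZMod p) ℂ)⁻¹ a =
      (centered p (a = 0) : ℝ) := by
  simp_rw [AddChar.inv_apply]
  rw [sum_stdAddChar_pow, neg_eq_zero]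

end Characters

/-! ### Rational points of the projective line. -/

section Projective

variable {K : Type*} [Field K]

/-- The points of the projective line: the affine ones and the point at infinity. -/
noncomputable def pointOfOption (a : Option K) : ℙ K (Fin 2 → K) :=
  match a with
  | some a => Projectivization.mk K ![a, 1] (by intro h; simpa using congrFun h 1)
  | none => Projectivization.mk K ![1, 0] (by intro h; simpa using congrFun h 0)

lemma bijective_pointOfOption : Function.Bijective (pointOfOption (K := K)) := by
  constructor
  · rintro (_ | a) (_ | b) h
    · rfl
    · obtain ⟨c, hc⟩ := (Projectivization.mk_eq_mk_iff' K _ _ _ _).1 h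
      have h1 := congrFun hc 1
      have h0 := congrFun hc 0
      simp at h1
      simp [h1] at h0
    · obtain ⟨c, hc⟩ := (Projectivization.mk_eq_mk_iff' K _ _ _ _).1 h
      have h1 := congrFun hc 1
      simp at h1
    · obtain ⟨c, hc⟩ := (Projectivization.mk_eq_mk_iff' K _ _ _ _).1 h
      have h1 := congrFun hc 1
      have h0 := congrFun hc 0
      simp at h1
      simp [h1] at h0
      rw [h0]
  · intro x
    induction x using Projectivization.ind with
    | h v hv =>
      by_cases h1 : v 1 = 0
      · refine ⟨none, ?_⟩
        refine (Projectivization.mk_eq_mk_iff' K _ _ _ _).2 ⟨(v 0)⁻¹, ?_⟩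
        have h0 : v 0 ≠ 0 := by
          intro h0
          refine hv (funext fun i => ?_)
          fin_cases i
          · exact h0
          · exact h1
        ext i
        fin_cases i <;> simp [h0, h1]
      · refine ⟨some (v 0 / v 1), ?_⟩
        refine (Projectivization.mk_eq_mk_iff' K _ _ _ _).2 ⟨(v 1)⁻¹, ?_⟩
        ext i
        fin_cases i
        · simp [div_eq_inv_mul]
        · simp [h1]

end Projective

/-! ### Evaluation of forms in the affine chart. -/

section Dehomogenize

variable {F : Type*} [Field F]

/-- Dehomogenization of binary forms: `X ↦ X`, `Z ↦ 1`. -/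
noncomputable def dehomogenize : MvPolynomial (Fin 2) F →ₐ[F] F[X] := MvPolynomial.aeval ![X, 1]

lemma aeval_dehomogenize {E : Type*} [CommRing E] [Algebra F E] (a : E)
    (φ : MvPolynomial (Fin 2) F) :
    aeval a (dehomogenize φ) = MvPolynomial.aeval ![a, 1] φ := by
  have : (aeval a).comp (dehomogenize (F := F)) = MvPolynomial.aeval ![a, 1] := by
    refine MvPolynomial.algHom_ext fun i => ?_
    fin_cases i <;> simp [dehomogenize]
  rw [← this]
  rfl

lemma aeval_smul_of_isHomogeneous {E : Type*} [CommRing E] [Algebra F E] {d : ℕ}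
    {φ : MvPolynomial (Fin 2) F} (hφ : φ.IsHomogeneous d) (c : E) (v : Fin 2 → E) :
    MvPolynomial.aeval (c • v) φ = c ^ d * MvPolynomial.aeval v φ := by
  rw [MvPolynomial.aeval_def, MvPolynomial.aeval_def, MvPolynomial.eval₂_eq', MvPolynomial.eval₂_eq', Finset.mul_sum]
  refine Finset.sum_congr rfl fun m hm => ?_
  have h1 := hφ.degree_eq_sum_deg_support hm
  have h2 : m 0 + m 1 = d := by
    rw [h1, ← Finsupp.degree_apply, Finsupp.degree_eq_sum, Fin.sum_univ_two]
  simp only [Pi.smul_apply, smul_eq_mul, Fin.prod_univ_two, ← h2]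
  ring

end Dehomogenize

/-! ### From points over an extension to closed points. -/

section FieldExtension

variable (p : ℕ) [Fact p.Prime] {F : Type*} [Field F] [Algebra (ZMod p) F]
variable (E : Type*) [Field E] [Algebra F E] [Algebra (ZMod p) E]

lemma minpoly_eq_iff_of_monicIrr (P : MonicIrr F) (a : E) :
    minpoly F a = P.1 ↔ aeval a P.1 = 0 :=
  ⟨fun h => h ▸ minpoly.aeval F a,
    fun h => (minpoly.eq_of_irreducible_of_monic P.2.2 h P.2.1).symm⟩

lemma finrank_adjoinRoot_monicIrr (P : MonicIrr F) :
    Module.finrank F (AdjoinRoot P.1) = P.1.natDegree :=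
  finrank_quotient_span_eq_natDegree

/-- The minimal polynomial of an element of a finite extension. -/
noncomputable def minpolyIrr {E : Type*} [Field E] [Finite E] [Algebra F E] (a : E) : MonicIrr F :=
  haveI : Module.Finite F E := .of_finite
  ⟨minpoly F a, minpoly.monic (IsIntegral.of_finite F a),
    minpoly.irreducible (IsIntegral.of_finite F a)⟩

variable [Finite F] [Finite E]

omit [Finite F] in
-- Roots of `P` correspond to embeddings of its residue field into `E`, which exist exactly when the
-- degree divides and then number the degree.
lemma natCard_roots_monicIrr (P : MonicIrr F) :
    Nat.card {a : E // aeval a P.1 = 0} =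
      if P.1.natDegree ∣ Module.finrank F E then P.1.natDegree else 0 := by
  have e : (AdjoinRoot P.1 →ₐ[F] E) ≃ {a : E // aeval a P.1 = 0} :=
    (AdjoinRoot.equiv E F P.1 P.2.2.ne_zero).trans
      (Equiv.subtypeEquivRight fun a => by
        rw [mem_aroots, and_iff_right P.2.2.ne_zero])
  rw [← Nat.card_congr e]
  split_ifs with h
  · rw [FiniteField.natCard_algHom_of_finrank_dvd (by rwa [finrank_adjoinRoot_monicIrr]),
      finrank_adjoinRoot_monicIrr]
  · have : IsEmpty (AdjoinRoot P.1 →ₐ[F] E) := by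
      rw [← not_nonempty_iff, FiniteField.nonempty_algHom_iff_finrank_dvd,
        finrank_adjoinRoot_monicIrr]
      exact h
    simp

/-- The value lies in the image of the residue field of `P`, so by transitivity the trace is
multiplied by the degree of `E` over that field. A zero of `H` needs no exception, since division by
zero is compatible with field embeddings. -/
lemma trace_aeval_div_aeval (P : MonicIrr F) (G H : F[X]) {a : E} (ha : aeval a P.1 = 0) :
    Algebra.trace (ZMod p) E (aeval a G / aeval a H) =
      (Module.finrank F E / P.1.natDegree) • localTrace p H P G := by
  let φ : AdjoinRoot P.1 →ₐ[F] E := AdjoinRoot.liftAlgHom P.1 (Algebra.ofId F E) a ha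
  have hφ : ∀ G : F[X], φ (AdjoinRoot.mk P.1 G) = aeval a G := fun G => rfl
  let _ : Algebra (AdjoinRoot P.1) E := φ.toRingHom.toAlgebra
  have hmap : ∀ x, algebraMap (AdjoinRoot P.1) E x = φ x := fun x => rfl
  have : IsScalarTower F (AdjoinRoot P.1) E := IsScalarTower.of_algebraMap_eq fun x => by
    rw [hmap, AlgHom.commutes]
  have : IsScalarTower (ZMod p) (AdjoinRoot P.1) E :=
    .of_algebraMap_eq' (Subsingleton.elim _ _)
  have : Module.Finite (AdjoinRoot P.1) E := .of_finite
  have : Module.Finite (ZMod p) (AdjoinRoot P.1) := .of_finite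
  have h1 : aeval a G / aeval a H = algebraMap (AdjoinRoot P.1) E
      (AdjoinRoot.mk P.1 G / AdjoinRoot.mk P.1 H) := by
    rw [hmap, map_div₀, hφ, hφ]
  have h2 : Module.finrank (AdjoinRoot P.1) E = Module.finrank F E / P.1.natDegree := by
    rw [← Module.finrank_mul_finrank F (AdjoinRoot P.1) E, finrank_adjoinRoot_monicIrr,
      Nat.mul_div_cancel_left _ P.natDegree_pos]
  rw [h1, ← Algebra.trace_trace (S := AdjoinRoot P.1), Algebra.trace_algebraMap, h2, map_nsmul,
    localTrace_apply]

/-- Elements of `E` are grouped by minimal polynomial: a closed point of degree `m` dividing the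
degree of `E` carries `m` of them. -/
lemma sum_minpolyIrr {M : Type*} [CommSemiring M] [Fintype E] (φ : MonicIrr F → M) :
    ∑ a : E, φ (minpolyIrr a) = ∑ m ∈ (Module.finrank F E).divisors,
      ∑ P ∈ monicIrrOfDegree F m, (m : M) * φ P := by
  classical
  have hfin : 0 < Module.finrank F E := by
    have : Module.Finite F E := .of_finite
    exact Module.finrank_pos
  set S : Finset (MonicIrr F) := (Module.finrank F E).divisors.biUnion (monicIrrOfDegree F) with hS
  have hcount : ∀ P : MonicIrr F, ((Finset.univ : Finset E).filter fun a => minpolyIrr a = P).card =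
      if P.1.natDegree ∣ Module.finrank F E then P.1.natDegree else 0 := by
    intro P
    rw [← natCard_roots_monicIrr, ← Fintype.card_subtype, Fintype.card_eq_nat_card]
    refine Nat.card_congr (Equiv.subtypeEquivRight fun a => ?_)
    rw [← minpoly_eq_iff_of_monicIrr, minpolyIrr, Subtype.ext_iff]
  have hmaps : ∀ a ∈ (Finset.univ : Finset E), minpolyIrr a ∈ S := by
    intro a _
    rw [hS, Finset.mem_biUnion]
    refine ⟨(minpoly F a).natDegree, ?_, ?_⟩
    · rw [Nat.mem_divisors]
      have : Module.Finite F E := .of_finite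
      exact ⟨minpoly.degree_dvd (IsIntegral.of_finite F a), hfin.ne'⟩
    · rw [mem_monicIrrOfDegree]
      rfl
  rw [← Finset.sum_fiberwise_of_maps_to hmaps, hS, Finset.sum_biUnion]
  · refine Finset.sum_congr rfl fun m hm => Finset.sum_congr rfl fun P hP => ?_
    rw [mem_monicIrrOfDegree] at hP
    rw [Finset.sum_congr rfl fun a ha => by rw [(Finset.mem_filter.1 ha).2], Finset.sum_const,
      hcount, hP, if_pos (Nat.dvd_of_mem_divisors hm), nsmul_eq_mul]
  · intro m _ m' _ h
    refine Finset.disjoint_left.2 fun P hP hP' => h ?_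
    rw [mem_monicIrrOfDegree] at hP hP'
    rw [← hP, ← hP']

/-- The sum of `centered p (tr (G(a) / H(a)) = 0)` over the affine points `a` with `H(a) ≠ 0`. -/
noncomputable def affineSum (G H : F[X]) : ℝ :=
  open Classical in
  ∑ᶠ a : E, if aeval a H = 0 then 0
    else centered p (Algebra.trace (ZMod p) E (aeval a G / aeval a H) = 0)

open Classical in
/-- The sum of `centered p (localTrace p H P G = 0)` over the closed points of degree `m` at which
`H` does not vanish. -/
noncomputable def closedPointSum (G H : F[X]) (m : ℕ) : ℝ :=
  ∑ P ∈ (monicIrrOfDegree F m).filter fun P => ¬ P.1 ∣ H, centered p (localTrace p H P G = 0)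

open Classical in
lemma affineSum_eq_sum_divisors (G H : F[X]) :
    affineSum p E G H = ∑ m ∈ (Module.finrank F E).divisors,
      ∑ P ∈ monicIrrOfDegree F m, (m : ℝ) * if P.1 ∣ H then 0
        else centered p ((Module.finrank F E / m) • localTrace p H P G = 0) := by
  have := Fintype.ofFinite E
  have : Module.Finite F E := .of_finite
  have h1 := sum_minpolyIrr E (M := ℝ) fun P : MonicIrr F => if P.1 ∣ H then 0
        else centered p ((Module.finrank F E / P.1.natDegree) • localTrace p H P G = 0)
  rw [affineSum, finsum_eq_sum_of_fintype]
  refine Eq.trans ?_ (h1.trans ?_)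
  · refine Finset.sum_congr rfl fun a _ => ?_
    have h2 : aeval a H = 0 ↔ (minpolyIrr (F := F) a).1 ∣ H := (minpoly.dvd_iff).symm
    rw [trace_aeval_div_aeval p E (minpolyIrr a) G H (minpoly.aeval F a)]
    exact if_congr h2 rfl rfl
  · refine Finset.sum_congr rfl fun m _ => Finset.sum_congr rfl fun P hP => ?_
    rw [mem_monicIrrOfDegree] at hP
    rw [hP]

lemma sum_divisors_mul_card_monicIrrOfDegree {k : ℕ} (hk : k ≠ 0) :
    ∑ m ∈ k.divisors, m * (monicIrrOfDegree F m).card = Nat.card F ^ k := by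
  obtain ⟨p, hp⟩ := CharP.exists F
  have : Fact p.Prime := ⟨CharP.char_is_prime F p⟩
  have : NeZero k := ⟨hk⟩
  have := Fintype.ofFinite (FiniteField.Extension F p k)
  have h1 := sum_minpolyIrr (F := F) (FiniteField.Extension F p k) (M := ℕ) fun _ => 1
  rw [FiniteField.finrank_extension, Finset.sum_const, smul_eq_mul, mul_one, Finset.card_univ,
    Fintype.card_eq_nat_card, FiniteField.natCard_extension] at h1
  rw [h1]
  refine Finset.sum_congr rfl fun m _ => ?_
  simp [mul_comm]

lemma mul_card_monicIrrOfDegree_le (m : ℕ) :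
    m * (monicIrrOfDegree F m).card ≤ Nat.card F ^ m := by
  rcases eq_or_ne m 0 with rfl | hm
  · simp
  · rw [← sum_divisors_mul_card_monicIrrOfDegree hm]
    exact Finset.single_le_sum (f := fun m => m * (monicIrrOfDegree F m).card)
      (fun _ _ => Nat.zero_le _) (Nat.mem_divisors_self m hm)

lemma sum_pow_natCard_le (n : ℕ) :
    ∑ j ∈ Finset.range (n + 1), Nat.card F ^ j ≤ 2 * Nat.card F ^ n := by
  have hq : 2 ≤ Nat.card F := Finite.one_lt_card
  induction n with
  | zero => simp
  | succ n ih =>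
    rw [Finset.sum_range_succ]
    have : 2 * Nat.card F ^ n ≤ Nat.card F ^ (n + 1) := by rw [pow_succ']; gcongr
    omega

lemma sum_mul_card_monicIrrOfDegree_le (S : Finset ℕ) (n : ℕ) (hS : ∀ m ∈ S, m ≤ n) :
    ∑ m ∈ S, m * (monicIrrOfDegree F m).card ≤ 2 * Nat.card F ^ n := by
  refine le_trans ?_ (sum_pow_natCard_le n)
  refine (Finset.sum_le_sum fun m _ => mul_card_monicIrrOfDegree_le m).trans ?_
  exact Finset.sum_le_sum_of_subset fun m hm => by simpa [Nat.lt_succ_iff] using hS m hm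

/-- In the partition of the field with `q^m` elements by degree, proper divisors of `m` are at most
`m / 2`, and their contribution is bounded by a geometric sum. -/
lemma natCard_pow_le_mul_card_monicIrrOfDegree (m : ℕ) :
    Nat.card F ^ m ≤ m * (monicIrrOfDegree F m).card + 2 * Nat.card F ^ (m / 2) := by
  rcases eq_or_ne m 0 with rfl | hm
  · simp
  · rw [← sum_divisors_mul_card_monicIrrOfDegree hm,
      ← Nat.insert_self_properDivisors hm, Finset.sum_insert Nat.self_notMem_properDivisors]
    gcongr
    refine sum_mul_card_monicIrrOfDegree_le _ _ fun j hj => ?_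
    obtain ⟨⟨c, rfl⟩, hlt⟩ := Nat.mem_properDivisors.1 hj
    have hc : 2 ≤ c := by
      by_contra hc
      interval_cases c <;> simp at *
    rw [Nat.le_div_iff_mul_le two_pos]
    gcongr

variable (F) in
/-- The sum over `𝔽_{q^k}` is dominated by the elements of degree `k` and `k / 2`. -/
lemma abs_affineSum_extension_sub_le [CharP F p] (hp : p ≠ 2) (k : ℕ) [NeZero k] (G H : F[X]) :
    |affineSum p (FiniteField.Extension F p k) G H -
      (k * closedPointSum p G H k +
        if 2 ∣ k then ((k / 2 : ℕ) : ℝ) * closedPointSum p G H (k / 2) else 0)| ≤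
      2 * p * (Nat.card F : ℝ) ^ (k / 3) := by
  classical
  have hk : k ≠ 0 := NeZero.ne k
  rw [affineSum_eq_sum_divisors, FiniteField.finrank_extension]
  set φ : ℕ → ℝ := fun m => ∑ P ∈ monicIrrOfDegree F m, (m : ℝ) * if P.1 ∣ H then 0
        else centered p ((k / m) • localTrace p H P G = 0) with hφ
  have hcl : ∀ m : ℕ, (∀ P : MonicIrr F, (k / m) • localTrace p H P G = 0 ↔ localTrace p H P G = 0) →
      φ m = m * closedPointSum p G H m := by
    intro m hm
    rw [hφ, closedPointSum, Finset.sum_filter, Finset.mul_sum]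
    refine Finset.sum_congr rfl fun P _ => ?_
    rw [ite_not, hm P]
  have h1 : φ k = k * closedPointSum p G H k := hcl k fun P => by
    rw [Nat.div_self (Nat.pos_of_ne_zero hk), one_smul]
  -- Here the trace is doubled on passing from the residue field to the extension. Since `p` is odd,
  -- this does not affect its vanishing.
  have h2 : 2 ∣ k → φ (k / 2) = ((k / 2 : ℕ) : ℝ) * closedPointSum p G H (k / 2) := fun h => hcl _ fun P => by
    obtain ⟨c, rfl⟩ := h
    have hc : 0 < c := by omega
    rw [Nat.mul_div_cancel_left c two_pos, Nat.mul_div_cancel _ hc, nsmul_eq_mul, mul_eq_zero,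
      or_iff_right]
    intro h0
    have h3 := (ZMod.natCast_eq_zero_iff 2 p).1 (by exact_mod_cast h0)
    exact hp ((Nat.prime_dvd_prime_iff_eq (Fact.out : p.Prime) Nat.prime_two).1 h3)
  set T : Finset ℕ := (if 2 ∣ k then {k, k / 2} else {k}) with hT
  have hTk : T ⊆ k.divisors := by
    intro m hm
    rw [hT] at hm
    rw [Nat.mem_divisors]
    refine ⟨?_, hk⟩
    split_ifs at hm with h
    · rcases Finset.mem_insert.1 hm with rfl | hm
      · exact dvd_rfl
      · rw [Finset.mem_singleton.1 hm]
        exact Nat.div_dvd_of_dvd h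
    · rw [Finset.mem_singleton.1 hm]
  have hTsum : ∑ m ∈ T, φ m = k * closedPointSum p G H k +
        if 2 ∣ k then ((k / 2 : ℕ) : ℝ) * closedPointSum p G H (k / 2) else 0 := by
    rw [hT]
    split_ifs with h
    · rw [Finset.sum_pair (by omega), h1, h2 h]
    · rw [Finset.sum_singleton, h1, add_zero]
  rw [← hTsum, ← Finset.sum_sdiff hTk, add_sub_cancel_right]
  -- A divisor other than `k` and `k / 2` has cofactor at least three.
  have hsmall : ∀ m ∈ k.divisors \ T, m ≤ k / 3 := by
    intro m hm
    obtain ⟨hm, hmT⟩ := Finset.mem_sdiff.1 hm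
    obtain ⟨c, rfl⟩ := Nat.dvd_of_mem_divisors hm
    have hm0 : 0 < m := by
      by_contra h
      have : m = 0 := by omega
      simp [this] at hk
    have hc : 3 ≤ c := by
      by_contra hc
      interval_cases c
      · simp at hk
      · simp only [mul_one] at hT
        rw [hT] at hmT
        split_ifs at hmT <;> simp at hmT
      · rw [hT, if_pos (dvd_mul_left _ _), Nat.mul_div_cancel _ two_pos] at hmT
        simp at hmT
    rw [Nat.le_div_iff_mul_le (by norm_num)]
    gcongr
  have hφm : ∀ m, |φ m| ≤ p * ((m * (monicIrrOfDegree F m).card : ℕ) : ℝ) := by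
    intro m
    refine (Finset.abs_sum_le_sum_abs _ _).trans ?_
    calc _ ≤ ∑ P ∈ monicIrrOfDegree F m, (m : ℝ) * p := by
          refine Finset.sum_le_sum fun P _ => ?_
          rw [abs_mul, Nat.abs_cast]
          gcongr
          split_ifs
          · simp
          · exact abs_centered_le _
      _ = _ := by rw [Finset.sum_const, nsmul_eq_mul]; push_cast; ring
  calc _ ≤ ∑ m ∈ k.divisors \ T, |φ m| := Finset.abs_sum_le_sum_abs _ _
    _ ≤ ∑ m ∈ k.divisors \ T, p * ((m * (monicIrrOfDegree F m).card : ℕ) : ℝ) :=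
        Finset.sum_le_sum fun m _ => hφm m
    _ = p * ((∑ m ∈ k.divisors \ T, m * (monicIrrOfDegree F m).card : ℕ) : ℝ) := by
        rw [← Finset.mul_sum]; push_cast; rfl
    _ ≤ p * ((2 * Nat.card F ^ (k / 3) : ℕ) : ℝ) := by
        gcongr
        exact sum_mul_card_monicIrrOfDegree_le _ _ hsmall
    _ = _ := by push_cast; ring

end FieldExtension

/-! ### Character sums of covers as sums of centred variables. -/

section CurveSum

variable (p : ℕ) [Fact p.Prime] {F : Type*} [Field F] [Finite F] [CharP F p] [Algebra (ZMod p) F]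

lemma exists_rep_mk_eq_smul {K : Type*} [Field K] (v : Fin 2 → K) (hv : v ≠ 0) :
    ∃ c : K, c ≠ 0 ∧ (Projectivization.mk K v hv).rep = c • v := by
  obtain ⟨c, hc⟩ := Projectivization.exists_smul_eq_mk_rep K v hv
  exact ⟨c, c.ne_zero, hc.symm⟩

omit [Algebra (ZMod p) F] in
-- The number `θ` is the contribution of the point at infinity. It is quantified before `χ`, so that
-- the characters and their inverses receive the same value.
lemma sum_pointSum (k : ℕ) [NeZero k] (J : Finset ℕ) {d : ℕ} {g h : MvPolynomial (Fin 2) F}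
    (hg : g.IsHomogeneous d) (hh : h.IsHomogeneous d) :
    ∃ θ : ℝ, |θ| ≤ p ∧ ∀ χ : ℕ → AddChar (ZMod p) ℂ,
      (∀ a, ∑ j ∈ J, χ j a = (centered p (a = 0) : ℝ)) →
      ∑ j ∈ J, pointSum p k (χ j) (g, h) =
      ((affineSum p (FiniteField.Extension F p k) (dehomogenize g) (dehomogenize h) + θ : ℝ) : ℂ) := by
  classical
  have := Fintype.ofFinite (FiniteField.Extension F p k)
  have := Fintype.ofFinite (ℙ (FiniteField.Extension F p k) (Fin 2 → (FiniteField.Extension F p k)))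
  set φ : ℙ (FiniteField.Extension F p k) (Fin 2 → (FiniteField.Extension F p k)) → ℝ := fun x => if MvPolynomial.aeval x.rep h = 0 then 0 else
    centered p (Algebra.trace (ZMod p) (FiniteField.Extension F p k) (MvPolynomial.aeval x.rep g / MvPolynomial.aeval x.rep h) = 0)
    with hφ
  have hφb : ∀ x, |φ x| ≤ p := by
    intro x
    rw [hφ]
    dsimp only
    split_ifs
    · simp
    · exact abs_centered_le _
  refine ⟨φ (pointOfOption none), hφb _, fun χ hχ => ?_⟩
  have h1 : ∑ j ∈ J, pointSum p k (χ j) (g, h) = ((∑ x, φ x : ℝ) : ℂ) := by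
    unfold pointSum
    simp_rw [finsum_eq_sum_of_fintype (M := ℂ)]
    rw [Finset.sum_comm]
    push_cast
    refine Finset.sum_congr rfl fun x _ => ?_
    rw [hφ]
    by_cases hx : MvPolynomial.aeval x.rep h = 0
    · simp [hx]
    · simp [hx, hχ]
  rw [h1, ← (Equiv.ofBijective _ (bijective_pointOfOption (K := (FiniteField.Extension F p k)))).sum_comp, Fintype.sum_option,
    add_comm, affineSum, finsum_eq_sum_of_fintype]
  congr 2
  refine Finset.sum_congr rfl fun a _ => ?_
  obtain ⟨c, hc, hrep⟩ := exists_rep_mk_eq_smul (K := (FiniteField.Extension F p k)) ![a, 1] (by intro h; simpa using congrFun h 1)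
  have e : (Equiv.ofBijective _ (bijective_pointOfOption (K := (FiniteField.Extension F p k)))) (some a) =
    Projectivization.mk (FiniteField.Extension F p k) ![a, 1] (by intro h; simpa using congrFun h 1) := rfl
  rw [hφ, e]
  dsimp only
  rw [hrep, aeval_smul_of_isHomogeneous hg, aeval_smul_of_isHomogeneous hh, ← aeval_dehomogenize,
    ← aeval_dehomogenize, mul_div_mul_left _ _ (pow_ne_zero d hc)]
  simp [hc]

omit [Algebra (ZMod p) F] in
-- The Selberg coefficients are even in `k`, and the characters and their inverses sum to the same
-- centred variable; this accounts for the factor `2`.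
lemma curveSum_re_eq (s : ℤˣ) (β : ℝ) (K : ℕ) {d : ℕ} {g h : MvPolynomial (Fin 2) F}
    (hg : g.IsHomogeneous d) (hh : h.IsHomogeneous d) :
    ∃ θ : ℕ → ℝ, (∀ k, |θ k| ≤ p) ∧ (curveSum p s β K (g, h)).re =
      ∑ k ∈ Finset.range K, 2 * selbergCoeff s β K ((k + 1 : ℕ) : ℤ) *
        (affineSum p (FiniteField.Extension F p (k + 1)) (dehomogenize g) (dehomogenize h) + θ k) /
          (Nat.card F : ℝ) ^ (((k + 1 : ℕ) : ℝ) / 2) := by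
  choose θ hθ hsum using fun k : ℕ =>
    sum_pointSum p (k + 1) (Finset.Icc 1 (p - 1)) hg hh
  refine ⟨θ, hθ, ?_⟩
  have h1 : curveSum p s β K (g, h) = ((∑ k ∈ Finset.range K, 2 * selbergCoeff s β K ((k + 1 : ℕ) : ℤ) *
        (affineSum p (FiniteField.Extension F p (k + 1)) (dehomogenize g) (dehomogenize h) + θ k) /
          (Nat.card F : ℝ) ^ (((k + 1 : ℕ) : ℝ) / 2) : ℝ) : ℂ) := by
    unfold curveSum weightedSum
    rw [Finset.sum_comm]
    rw [Complex.ofReal_sum]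
    refine Finset.sum_congr rfl fun k hk => ?_
    have hk' : |((k : ℤ) + 1)| ≤ (K : ℤ) := by
      rw [Finset.mem_range] at hk
      rw [abs_of_nonneg (by positivity)]
      omega
    rw [← Finset.sum_div, Finset.sum_add_distrib, ← Finset.mul_sum, ← Finset.mul_sum,
      fourierHat_selbergPoly _ _ _ _ hk', fourierHat_selbergPoly _ _ _ _ (by rwa [abs_neg]),
      selbergCoeff_neg, hsum k _ (sum_stdAddChar_pow p), hsum k _ (sum_stdAddChar_pow_inv p)]
    push_cast
    ring
  rw [h1, Complex.ofReal_re]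

end CurveSum

/-! ### Homogeneity of the factors of a form. -/

section HomogeneousFactors

variable {σ R : Type*} [CommRing R]

/-- The substitution `X i ↦ X i * T`. -/
noncomputable def scaleHom : MvPolynomial σ R →ₐ[R] (MvPolynomial σ R)[X] :=
  MvPolynomial.aeval fun i => C (MvPolynomial.X i) * X

lemma scaleHom_of_isHomogeneous {φ : MvPolynomial σ R} {d : ℕ} (h : φ.IsHomogeneous d) :
    scaleHom φ = C φ * X ^ d := by
  have key : ∀ (m : σ →₀ ℕ) (r : R), scaleHom (MvPolynomial.monomial m r) =
      C (MvPolynomial.monomial m r) * X ^ m.degree := by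
    intro m r
    rw [scaleHom, MvPolynomial.aeval_monomial, MvPolynomial.monomial_eq]
    simp only [mul_pow, Finsupp.prod, Finset.prod_mul_distrib, map_mul, map_prod, map_pow,
      Finset.prod_pow_eq_pow_sum, Finsupp.degree]
    rw [mul_assoc]
    rfl
  conv_lhs => rw [φ.as_sum]
  conv_rhs => rw [φ.as_sum]
  rw [map_sum, map_sum, Finset.sum_mul]
  refine Finset.sum_congr rfl fun m hm => ?_
  rw [key]
  congr 2
  rw [h.degree_eq_sum_deg_support hm, Finsupp.degree_apply]

lemma coeff_scaleHom (φ : MvPolynomial σ R) (n : ℕ) :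
    (scaleHom φ).coeff n = MvPolynomial.homogeneousComponent n φ := by
  conv_lhs => rw [← MvPolynomial.sum_homogeneousComponent φ]
  rw [map_sum, finsetSum_coeff]
  simp_rw [scaleHom_of_isHomogeneous (MvPolynomial.homogeneousComponent_isHomogeneous _ φ),
    coeff_C_mul_X_pow]
  rw [Finset.sum_ite_eq]
  split_ifs with h
  · rfl
  · rw [MvPolynomial.homogeneousComponent_eq_zero]
    simpa [Nat.lt_succ_iff] using h

lemma eval_one_scaleHom (φ : MvPolynomial σ R) : (scaleHom φ).eval 1 = φ := by
  have h : ((aeval (R := MvPolynomial σ R) (1 : MvPolynomial σ R)).restrictScalars R).comp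
      (scaleHom (σ := σ) (R := R)) = AlgHom.id R _ :=
    MvPolynomial.algHom_ext fun i => by simp [scaleHom]
  have := congrArg (fun f => f φ) h
  simpa [aeval_def] using this

/-- Factors of a nonzero homogeneous polynomial are homogeneous. -/
lemma exists_isHomogeneous_of_mul [IsDomain R] {a b : MvPolynomial σ R} {d : ℕ}
    (h : (a * b).IsHomogeneous d) (hab : a * b ≠ 0) :
    ∃ e f, e + f = d ∧ a.IsHomogeneous e ∧ b.IsHomogeneous f := by
  have hs : ∀ c : MvPolynomial σ R, c ≠ 0 → scaleHom c ≠ 0 := fun c hc h0 => hc (by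
    rw [← eval_one_scaleHom c, h0, eval_zero])
  have ha := left_ne_zero_of_mul hab
  have hb := right_ne_zero_of_mul hab
  have h1 : scaleHom a * scaleHom b = C (a * b) * X ^ d := by
    rw [← map_mul, scaleHom_of_isHomogeneous h]
  have h2 := natDegree_mul (hs a ha) (hs b hb)
  have h3 := natTrailingDegree_mul (hs a ha) (hs b hb)
  rw [h1, natDegree_C_mul_X_pow _ _ hab] at h2
  rw [h1, C_mul_X_pow_eq_monomial, natTrailingDegree_monomial hab] at h3
  have h4 := natTrailingDegree_le_natDegree (scaleHom a)
  have h5 := natTrailingDegree_le_natDegree (scaleHom b)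
  -- Degree and trailing degree in the scaling variable are both additive and agree on the product,
  -- hence agree on each factor. A factor whose two degrees agree is a monomial in that variable.
  have key : ∀ c : MvPolynomial σ R, (scaleHom c).natTrailingDegree = (scaleHom c).natDegree →
      c.IsHomogeneous (scaleHom c).natDegree := by
    intro c hc
    set n := (scaleHom c).natDegree with hn
    have h6 : scaleHom c = monomial n ((scaleHom c).coeff n) := by
      ext1 m
      rw [coeff_monomial]
      split_ifs with hm
      · rw [hm]
      · rcases lt_or_gt_of_ne hm with hm | hm
        · exact coeff_eq_zero_of_natDegree_lt (hn ▸ hm)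
        · exact coeff_eq_zero_of_lt_natTrailingDegree (by omega)
    have h7 := eval_one_scaleHom c
    rw [h6, eval_monomial, one_pow, mul_one, coeff_scaleHom] at h7
    rw [← h7]
    exact MvPolynomial.homogeneousComponent_isHomogeneous _ _
  exact ⟨_, _, h2.symm, key a (by omega), key b (by omega)⟩

end HomogeneousFactors

/-! ### Coprime and square-free forms in the affine chart. -/

section Forms

variable {F : Type*} [Field F] {d : ℕ} {g h c : MvPolynomial (Fin 2) F}

lemma dehomogenize_homogenize {G : F[X]} (hG : G.natDegree ≤ d) :
    dehomogenize (G.homogenize d) = G := aeval_homogenize_X_one G hG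

lemma homogenize_dehomogenize (hg : g.IsHomogeneous d) : (dehomogenize g).homogenize d = g :=
  homogenize_eq_of_isHomogeneous hg rfl

lemma dehomogenize_eq_zero (hg : g.IsHomogeneous d) (h : dehomogenize g = 0) : g = 0 := by
  rw [← homogenize_dehomogenize hg, h, homogenize_zero]

lemma natDegree_dehomogenize_le (hg : g.IsHomogeneous d) : (dehomogenize g).natDegree ≤ d := by
  rw [dehomogenize, MvPolynomial.aeval_def, MvPolynomial.eval₂_eq']
  refine natDegree_sum_le_of_forall_le _ _ fun m hm => ?_
  have h2 : m 0 + m 1 = d := by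
    rw [hg.degree_eq_sum_deg_support hm, ← Finsupp.degree_apply, Finsupp.degree_eq_sum,
      Fin.sum_univ_two]
  simp only [Fin.prod_univ_two, Matrix.cons_val_zero, Matrix.cons_val_one, one_pow, mul_one]
  refine (natDegree_C_mul_X_pow_le _ _).trans (by omega)

lemma X_one_dvd_of_coeff_dehomogenize_eq_zero (hd : d ≠ 0) (hg : g.IsHomogeneous d)
    (h : (dehomogenize g).coeff d = 0) : MvPolynomial.X 1 ∣ g := by
  obtain ⟨n, rfl⟩ := Nat.exists_eq_succ_of_ne_zero hd
  have h1 : (dehomogenize g).natDegree ≤ n := by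
    have := natDegree_dehomogenize_le hg
    rcases this.eq_or_lt with h' | h'
    · rw [← h', coeff_natDegree, leadingCoeff_eq_zero] at h
      simp [h]
    · omega
  have h2 := homogenize_mul (dehomogenize g) 1 h1 (natDegree_one.le.trans zero_le_one)
  rw [mul_one, homogenize_one, pow_one] at h2
  rw [← homogenize_dehomogenize hg]
  exact ⟨_, h2.trans (mul_comm _ _)⟩

lemma coeff_dehomogenize_eq_zero_of_dvd (hg : g.IsHomogeneous d) (h : MvPolynomial.X 1 ∣ g) :
    (dehomogenize g).coeff d = 0 := by
  rcases eq_or_ne g 0 with rfl | hg0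
  · simp
  obtain ⟨b, rfl⟩ := h
  obtain ⟨e, f, hef, he, hf⟩ := exists_isHomogeneous_of_mul hg hg0
  have he1 : e = 1 := he.inj_right (MvPolynomial.isHomogeneous_X F 1) (MvPolynomial.X_ne_zero 1)
  have h1 : dehomogenize (MvPolynomial.X 1 * b) = dehomogenize b := by
    rw [map_mul]
    simp [dehomogenize]
  rw [h1]
  refine coeff_eq_zero_of_natDegree_lt ((natDegree_dehomogenize_le hf).trans_lt ?_)
  omega

lemma not_isUnit_X_one : ¬ IsUnit (MvPolynomial.X 1 : MvPolynomial (Fin 2) F) := fun h =>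
  MvPolynomial.X_prime.not_isUnit h

/-- A form with constant dehomogenization is a constant times a power of `Z`. -/
lemma isUnit_or_X_one_dvd (hc : c.IsHomogeneous d) (hu : IsUnit (dehomogenize c)) :
    IsUnit c ∨ MvPolynomial.X 1 ∣ c := by
  obtain ⟨u, hu, hcu⟩ := Polynomial.isUnit_iff.1 hu
  have h1 : c = MvPolynomial.C u * MvPolynomial.X 1 ^ d := by
    rw [← homogenize_dehomogenize hc, ← hcu, homogenize_C]
  rcases eq_or_ne d 0 with rfl | hd
  · left
    rw [h1, pow_zero, mul_one]
    exact hu.map MvPolynomial.C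
  · right
    rw [h1]
    exact (dvd_pow_self _ hd).mul_left _

variable [Finite F]

lemma mem_coprimePolys {H G : F[X]} : G ∈ coprimePolys d H ↔ G.degree < ((d + 1 : ℕ) : WithBot ℕ) ∧
    (∀ R ∈ monicIrrDivisors H, ¬ R.1 ∣ G) ∧ (H.natDegree = d ∨ G.coeff d ≠ 0) := by
  classical
  unfold coprimePolys
  rw [Finset.mem_filter, mem_polysLT]

/-- A common zero is either affine, seen by an irreducible common factor of the dehomogenizations,
or at infinity, seen by `Z` dividing both forms, that is, by the vanishing of both coefficients of
degree `d`. -/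
lemma isRelPrime_iff_mem_coprimePolys (hg : g.IsHomogeneous d) (hh : h.IsHomogeneous d)
    (h0 : h ≠ 0) : IsRelPrime g h ↔ dehomogenize g ∈ coprimePolys d (dehomogenize h) := by
  have hH0 : dehomogenize h ≠ 0 := fun h' => h0 (dehomogenize_eq_zero hh h')
  have hdeg : (dehomogenize g).degree < ((d + 1 : ℕ) : WithBot ℕ) := by
    refine degree_le_natDegree.trans_lt ?_
    exact_mod_cast Nat.lt_succ_of_le (natDegree_dehomogenize_le hg)
  have hcoeff : (dehomogenize h).natDegree = d ↔ (dehomogenize h).coeff d ≠ 0 := by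
    constructor
    · intro h'
      rw [← h', coeff_natDegree]
      exact leadingCoeff_ne_zero.2 hH0
    · exact fun h' => le_antisymm (natDegree_dehomogenize_le hh) (le_natDegree_of_ne_zero h')
  rw [mem_coprimePolys, and_iff_right hdeg, hcoeff]
  constructor
  · intro hrel
    constructor
    · intro R hR hRg
      rw [mem_monicIrrDivisors hH0] at hR
      have key : ∀ φ : MvPolynomial (Fin 2) F, φ.IsHomogeneous d → R.1 ∣ dehomogenize φ →
          R.1.homogenize R.1.natDegree ∣ φ := by
        rintro φ hφ ⟨S, hS⟩
        rcases eq_or_ne S 0 with rfl | hS0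
        · rw [mul_zero] at hS
          rw [dehomogenize_eq_zero hφ hS]
          exact dvd_zero _
        · have h1 := natDegree_dehomogenize_le hφ
          rw [hS, natDegree_mul R.2.2.ne_zero hS0] at h1
          have h2 := homogenize_mul R.1 S le_rfl (show S.natDegree ≤ d - R.1.natDegree by omega)
          rw [← hS, show R.1.natDegree + (d - R.1.natDegree) = d by omega,
            homogenize_dehomogenize hφ] at h2
          exact ⟨_, h2⟩
      have hu := hrel (key g hg hRg) (key h hh hR)
      have := hu.map dehomogenize
      rw [dehomogenize_homogenize le_rfl] at this
      exact R.2.2.not_isUnit this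
    · by_contra hcon
      push Not at hcon
      have hd : d ≠ 0 := by
        rintro rfl
        refine hH0 ?_
        have := natDegree_dehomogenize_le hh
        rw [eq_C_of_natDegree_le_zero this, hcon.1, C_0]
      exact not_isUnit_X_one (hrel (X_one_dvd_of_coeff_dehomogenize_eq_zero hd hg hcon.2)
        (X_one_dvd_of_coeff_dehomogenize_eq_zero hd hh hcon.1))
  · rintro ⟨h1, h2⟩ c hcg hch
    obtain ⟨e, he⟩ : ∃ e, c.IsHomogeneous e := by
      obtain ⟨b, rfl⟩ := hch
      obtain ⟨e, _, _, he, _⟩ := exists_isHomogeneous_of_mul hh h0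
      exact ⟨e, he⟩
    have hcH : dehomogenize c ∣ dehomogenize h := _root_.map_dvd dehomogenize hch
    have hcG : dehomogenize c ∣ dehomogenize g := _root_.map_dvd dehomogenize hcg
    have hu : IsUnit (dehomogenize c) := by
      by_contra hu
      obtain ⟨R, hRm, hRi, hRc⟩ := exists_monic_irreducible_factor _ hu
      let P : MonicIrr F := ⟨R, hRm, hRi⟩
      have hP : P ∈ monicIrrDivisors (dehomogenize h) :=
        (mem_monicIrrDivisors hH0).2 (hRc.trans hcH)
      exact h1 P hP (hRc.trans hcG)
    rcases isUnit_or_X_one_dvd he hu with h3 | h3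
    · exact h3
    · rcases h2 with h2 | h2
      · exact absurd (coeff_dehomogenize_eq_zero_of_dvd hh (h3.trans hch)) h2
      · exact absurd (coeff_dehomogenize_eq_zero_of_dvd hg (h3.trans hcg)) h2

/-- There are square-free forms of every positive degree. -/
lemma exists_squarefree_isHomogeneous (hq : 3 ≤ Nat.card F) (hd : d ≠ 0) :
    ∃ h : MvPolynomial (Fin 2) F, h.IsHomogeneous d ∧ Squarefree h := by
  have h1 := natCard_pow_le_mul_card_monicIrrOfDegree (F := F) d
  -- With `q ≥ 3` the crude count of closed points already gives an irreducible polynomial of degree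
  -- `d`; its homogenization is the required form.
  have h2 : 2 * Nat.card F ^ (d / 2) < Nat.card F ^ d := by
    calc 2 * Nat.card F ^ (d / 2) < Nat.card F * Nat.card F ^ (d / 2) := by
          gcongr; omega
      _ = Nat.card F ^ (d / 2 + 1) := by rw [pow_succ']
      _ ≤ Nat.card F ^ d := Nat.pow_le_pow_right (by omega) (by omega)
  have h3 : (monicIrrOfDegree F d).card ≠ 0 := by
    intro h3
    rw [h3] at h1
    omega
  obtain ⟨P, hP⟩ := Finset.card_ne_zero.1 h3
  rw [mem_monicIrrOfDegree] at hP
  have hh : (P.1.homogenize d).IsHomogeneous d := isHomogeneous_homogenize _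
  have hde : dehomogenize (P.1.homogenize d) = P.1 := dehomogenize_homogenize hP.le
  have hne : P.1.homogenize d ≠ 0 := by
    intro h0
    rw [h0, map_zero] at hde
    exact P.2.2.ne_zero hde.symm
  refine ⟨P.1.homogenize d, hh, fun c hc => ?_⟩
  obtain ⟨e, he⟩ : ∃ e, c.IsHomogeneous e := by
    obtain ⟨b, hb⟩ := hc
    rw [mul_assoc] at hb
    rw [hb] at hh hne
    obtain ⟨e, _, _, he, _⟩ := exists_isHomogeneous_of_mul hh hne
    exact ⟨e, he⟩
  have hu : IsUnit (dehomogenize c) := by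
    have := _root_.map_dvd dehomogenize hc
    rw [hde, map_mul] at this
    exact P.2.2.squarefree _ this
  rcases isUnit_or_X_one_dvd he hu with h4 | h4
  · exact h4
  · have := coeff_dehomogenize_eq_zero_of_dvd hh (h4.trans ((dvd_mul_right c c).trans hc))
    rw [hde, ← hP, coeff_natDegree, P.2.1.leadingCoeff] at this
    exact absurd this one_ne_zero

end Forms

/-! ### A bound for the number of poles. -/

section PoleCount

variable {F : Type*} [Field F]

/-- There are at most `d` affine zeros besides the point at infinity. Losing one against the sharp
bound is harmless, as only the order of magnitude of the genus is used. -/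
lemma poleCount_le {d : ℕ} {h : MvPolynomial (Fin 2) F} (hh : h.IsHomogeneous d) (h0 : h ≠ 0) :
    poleCount h ≤ d + 1 := by
  classical
  have hH0 : dehomogenize h ≠ 0 := fun h' => h0 (dehomogenize_eq_zero hh h')
  set S : Finset (ℙ (AlgebraicClosure F) (Fin 2 → AlgebraicClosure F)) :=
    (insert none (((dehomogenize h).aroots (AlgebraicClosure F)).toFinset.image some)).image
      pointOfOption with hS
  have hsub : {P : ℙ (AlgebraicClosure F) (Fin 2 → AlgebraicClosure F) |
    MvPolynomial.aeval P.rep h = 0} ⊆ S := by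
    intro P hP
    rw [Set.mem_ofPred_eq] at hP
    obtain ⟨o, rfl⟩ := bijective_pointOfOption.2 P
    rw [hS, Finset.mem_coe]
    refine Finset.mem_image_of_mem _ ?_
    rcases o with _ | a
    · simp
    · refine Finset.mem_insert_of_mem (Finset.mem_image_of_mem _ ?_)
      rw [Multiset.mem_toFinset, mem_aroots, and_iff_right hH0, aeval_dehomogenize]
      obtain ⟨c, hc, hrep⟩ := exists_rep_mk_eq_smul (K := AlgebraicClosure F) ![a, 1]
        (by intro h; simpa using congrFun h 1)
      rw [pointOfOption, hrep, aeval_smul_of_isHomogeneous hh] at hP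
      exact (mul_eq_zero.1 hP).resolve_left (pow_ne_zero _ hc)
  calc poleCount h ≤ (S : Set _).ncard := Set.ncard_le_ncard hsub S.finite_toSet
    _ = S.card := Set.ncard_coe_finset S
    _ ≤ _ := Finset.card_image_le
    _ ≤ _ := Finset.card_insert_le _ _
    _ ≤ d + 1 := by
      gcongr
      refine Finset.card_image_le.trans ((Multiset.toFinset_card_le _).trans ?_)
      refine (card_roots' _).trans ?_
      rw [natDegree_map]
      exact natDegree_dehomogenize_le hh

end PoleCount

/-! ### Size of the Beurling–Selberg coefficients. -/

section Selberg

/-- With `x = πu`, the difference is `-(1 - u)(1 - x cot x)`, and `cos x ≤ x cot x ≤ 1` up to `u =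
1/2`. Beyond that, boundedness suffices: `1 - u` compensates for the pole of the cotangent. -/
lemma abs_vaalerWeight_sub_one_le {u : ℝ} (h0 : 0 < u) (h1 : u < 1) :
    |vaalerWeight u - 1| ≤ 5 * u := by
  have hpi := Real.pi_pos
  have hpi3 := Real.pi_gt_three
  have hpi4 : Real.pi < 3.15 := Real.pi_lt_d2
  unfold vaalerWeight
  set x := Real.pi * u with hx
  have hx0 : 0 < x := by positivity
  have hxpi : x < Real.pi := by nlinarith
  have hs : 0 < Real.sin x := Real.sin_pos_of_pos_of_lt_pi hx0 hxpi
  rcases le_or_gt u (1 / 2) with h | h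
  · have hx2 : x ≤ Real.pi / 2 := by nlinarith
    have hc : 0 ≤ Real.cos x := Real.cos_nonneg_of_neg_pi_div_two_le_of_le (by linarith) hx2
    have h2 : x * Real.cos x ≤ Real.sin x := by
      rcases hx2.eq_or_lt with h3 | h3
      · rw [h3, Real.cos_pi_div_two, mul_zero, Real.sin_pi_div_two]
        exact zero_le_one
      · have hc' : 0 < Real.cos x := Real.cos_pos_of_mem_Ioo ⟨by linarith, h3⟩
        have := Real.le_tan hx0.le h3
        rwa [Real.tan_eq_sin_div_cos, le_div_iff₀ hc'] at this
    have h4 : x * (Real.cos x / Real.sin x) ≤ 1 := by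
      rw [← mul_div_assoc, div_le_one hs]
      exact h2
    have h5 : Real.cos x ≤ x * (Real.cos x / Real.sin x) := by
      rw [← mul_div_assoc, le_div_iff₀ hs, mul_comm]
      exact mul_le_mul_of_nonneg_right (Real.sin_le hx0.le) hc
    have h6 := Real.one_sub_sq_div_two_le_cos (x := x)
    have h7 : x ^ 2 / 2 ≤ 5 * u := by
      rw [hx, mul_pow]
      nlinarith
    have e : x * (1 - u) * (Real.cos x / Real.sin x) + u - 1 =
        -((1 - u) * (1 - x * (Real.cos x / Real.sin x))) := by ring
    rw [e, abs_neg, abs_of_nonneg (mul_nonneg (by linarith) (by linarith))]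
    nlinarith
  · have h2 : 2 * (1 - u) ≤ Real.sin x := by
      have := Real.mul_le_sin (x := Real.pi * (1 - u)) (by nlinarith) (by nlinarith)
      rw [show Real.pi * (1 - u) = Real.pi - x by rw [hx]; ring, Real.sin_pi_sub] at this
      calc 2 * (1 - u) = 2 / Real.pi * (Real.pi - x) := by rw [hx]; field_simp
        _ ≤ _ := this
    have h3 : |x * (1 - u) * (Real.cos x / Real.sin x)| ≤ x / 2 := by
      rw [abs_mul, abs_div, abs_of_pos hs, abs_of_pos (mul_pos hx0 (by linarith)), ← mul_div_assoc,
        div_le_iff₀ hs]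
      have := Real.abs_cos_le_one x
      calc x * (1 - u) * |Real.cos x| ≤ x * (1 - u) * 1 :=
            mul_le_mul_of_nonneg_left this (mul_nonneg hx0.le (by linarith))
        _ = x / 2 * (2 * (1 - u)) := by ring
        _ ≤ _ := by gcongr
    rw [abs_le] at h3 ⊢
    constructor <;> nlinarith

/-- The coefficient `k * Î_K^±(k)`. -/
noncomputable def selbergWeight (s : ℤˣ) (β : ℝ) (K k : ℕ) : ℝ :=
  k * selbergCoeff s β K (k : ℤ)

lemma abs_selbergWeight_sub_le (s : ℤˣ) (β : ℝ) {K k : ℕ} (hk : k ≠ 0) (hkK : k ≤ K) :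
    |selbergWeight s β K k - Real.sin (Real.pi * k * β) / Real.pi| ≤ 3 * (k / (K + 1)) := by
  have hk0 : (0 : ℝ) < k := by exact_mod_cast hk.bot_lt
  have hK : (0 : ℝ) < (K : ℝ) + 1 := by positivity
  have hkK' : (k : ℝ) ≤ K := by exact_mod_cast hkK
  have hpi3 := Real.pi_gt_three
  have hs : |(((s : ℤ) : ℝ))| = 1 := by
    rcases Int.units_eq_one_or s with h | h <;> simp [h]
  unfold selbergWeight selbergCoeff
  rw [if_neg (by exact_mod_cast hk)]
  push_cast
  rw [abs_of_pos hk0]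
  set u : ℝ := k / (K + 1) with hu
  have hu0 : 0 < u := by positivity
  have hu1 : u < 1 := by rw [hu, div_lt_one hK]; linarith
  have hw := abs_vaalerWeight_sub_one_le hu0 hu1
  have e : (k : ℝ) * (vaalerWeight u * (Real.sin (Real.pi * k * β) / (Real.pi * k)) +
      ((s : ℤ) : ℝ) / (K + 1) * (1 - u) * Real.cos (Real.pi * k * β)) -
      Real.sin (Real.pi * k * β) / Real.pi =
      (vaalerWeight u - 1) * (Real.sin (Real.pi * k * β) / Real.pi) +
      ((s : ℤ) : ℝ) * (u * (1 - u) * Real.cos (Real.pi * k * β)) := by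
    rw [hu]
    field_simp
    ring
  rw [e]
  have h1 : |Real.sin (Real.pi * k * β) / Real.pi| ≤ 1 / 3 := by
    rw [abs_div, abs_of_pos Real.pi_pos]
    exact div_le_div₀ zero_le_one (Real.abs_sin_le_one _) (by norm_num) hpi3.le
  have h2 := Real.abs_cos_le_one (Real.pi * k * β)
  calc _ ≤ |vaalerWeight u - 1| * |Real.sin (Real.pi * k * β) / Real.pi| +
        |((s : ℤ) : ℝ)| * (u * (1 - u) * |Real.cos (Real.pi * k * β)|) := by
        refine (abs_add_le _ _).trans_eq ?_
        rw [abs_mul, abs_mul, abs_mul, abs_of_pos (mul_pos hu0 (sub_pos.2 hu1))]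
    _ ≤ 5 * u * (1 / 3) + 1 * (u * (1 - u) * 1) := by
        rw [hs]
        gcongr
    _ ≤ 3 * u := by nlinarith

variable {s : ℤˣ} {β : ℝ} {K k : ℕ}

lemma abs_selbergWeight_le (hk : k ≠ 0) (hkK : k ≤ K) : |selbergWeight s β K k| ≤ 4 := by
  have h := abs_selbergWeight_sub_le s β hk hkK
  have h1 : |Real.sin (Real.pi * k * β) / Real.pi| ≤ 1 := by
    rw [abs_div, abs_of_pos Real.pi_pos, div_le_one Real.pi_pos]
    exact (Real.abs_sin_le_one _).trans (by linarith [Real.pi_gt_three])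
  have h2 : (k : ℝ) / (K + 1) ≤ 1 := by
    rw [div_le_one (by positivity)]
    have : (k : ℝ) ≤ K := by exact_mod_cast hkK
    linarith
  rw [abs_le] at *
  constructor <;> linarith

lemma abs_selbergWeight_le_mul (hβ : 0 < β) (hk : k ≠ 0) (hkK : k ≤ K) :
    |selbergWeight s β K k| ≤ (β + 3 / (K + 1)) * k := by
  have h := abs_selbergWeight_sub_le s β hk hkK
  have h1 : |Real.sin (Real.pi * k * β) / Real.pi| ≤ β * k := by
    rw [abs_div, abs_of_pos Real.pi_pos, div_le_iff₀ Real.pi_pos]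
    refine Real.abs_sin_le_abs.trans_eq ?_
    have := Real.pi_pos
    rw [abs_of_nonneg (by positivity)]
    ring
  have e : 3 * ((k : ℝ) / (K + 1)) = 3 / (K + 1) * k := by ring
  rw [e] at h
  rw [abs_le] at *
  constructor <;> nlinarith

/-- Interpolation between the bounds `4` and `(β + 3/(K+1)) k`. The square root matters: summed
against `1/k` up to `L` it gives the square root of `(β + 3/(K+1)) L`, which is negligible even when
this product is as large as the variance. -/
lemma selbergWeight_sq_le (hβ : 0 < β) (hk : k ≠ 0) (hkK : k ≤ K) :
    selbergWeight s β K k ^ 2 ≤ 8 * √((β + 3 / (K + 1)) * k) := by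
  have h1 := abs_selbergWeight_le (s := s) (β := β) hk hkK
  have h2 := abs_selbergWeight_le_mul (s := s) hβ hk hkK
  rw [← sq_abs]
  set x := |selbergWeight s β K k|
  have hx : 0 ≤ x := abs_nonneg _
  have h3 : √x ≤ √((β + 3 / (K + 1)) * k) := Real.sqrt_le_sqrt h2
  have h4 : √x ≤ 2 := by
    rw [Real.sqrt_le_left (by norm_num)]
    linarith
  have h5 : √x * √x = x := Real.mul_self_sqrt hx
  have h6 := Real.sqrt_nonneg x
  calc x ^ 2 = √x * √x * √x * √x := by rw [h5, mul_assoc, h5, sq]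
    _ ≤ 2 * 2 * 2 * √x := by gcongr
    _ ≤ _ := by linarith

/-- The error is designed to be summed: over all `k ≤ K` it amounts to a bounded quantity. -/
lemma abs_selbergWeight_sq_sub_le (hk : k ≠ 0) (hkK : k ≤ K) :
    |selbergWeight s β K k ^ 2 / k - Real.sin (Real.pi * k * β) ^ 2 / k / Real.pi ^ 2| ≤
      15 / (K + 1) := by
  have hk0 : (0 : ℝ) < k := by exact_mod_cast hk.bot_lt
  have h := abs_selbergWeight_sub_le s β hk hkK
  have h1 : |Real.sin (Real.pi * k * β) / Real.pi| ≤ 1 := by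
    rw [abs_div, abs_of_pos Real.pi_pos, div_le_one Real.pi_pos]
    exact (Real.abs_sin_le_one _).trans (by linarith [Real.pi_gt_three])
  have h2 := abs_selbergWeight_le (s := s) (β := β) hk hkK
  set b := selbergWeight s β K k
  set v := Real.sin (Real.pi * k * β) / Real.pi with hv
  have e : b ^ 2 / k - Real.sin (Real.pi * k * β) ^ 2 / k / Real.pi ^ 2 =
      (b - v) * (b + v) / k := by
    rw [hv]
    have := Real.pi_pos
    field_simp
    ring
  rw [e, abs_div, abs_mul, abs_of_pos hk0, div_le_iff₀ hk0]
  have h3 : |b + v| ≤ 5 := (abs_add_le _ _).trans (by linarith)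
  calc |b - v| * |b + v| ≤ 3 * (k / (K + 1)) * 5 := by gcongr
    _ = 15 / (K + 1) * k := by ring

end Selberg

/-! ### Asymptotics of the sum of `sin²(πmβ) / m`. -/

section SineSum

/-- Summation by parts. The term `- 1 / (K + 1)` in the bound makes the induction close, each step
adding `σ (K + 1) (1/(K+1) - 1/(K+2))`. -/
lemma abs_sum_sub_div_sub_le (σ : ℕ → ℝ) (hσ : ∀ m, |σ m| ≤ 1) {M K : ℕ} (hMK : M ≤ K) :
    |∑ m ∈ Finset.Ico M K, (σ (m + 1) - σ m) / ((m : ℝ) + 1) - σ K / (K + 1)| ≤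
      2 / ((M : ℝ) + 1) - 1 / (K + 1) := by
  induction K, hMK using Nat.le_induction with
  | base =>
    rw [Finset.Ico_self, Finset.sum_empty, zero_sub, abs_neg, abs_div,
      abs_of_pos (by positivity : (0 : ℝ) < (M : ℝ) + 1), ← sub_div]
    gcongr
    linarith [hσ M]
  | succ K hMK ih =>
    rw [Finset.sum_Ico_succ_top hMK]
    push_cast
    have e : ∑ m ∈ Finset.Ico M K, (σ (m + 1) - σ m) / ((m : ℝ) + 1) +
        (σ (K + 1) - σ K) / (K + 1) - σ (K + 1) / (K + 1 + 1) =
        (∑ m ∈ Finset.Ico M K, (σ (m + 1) - σ m) / ((m : ℝ) + 1) - σ K / (K + 1)) +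
          σ (K + 1) * (1 / (K + 1) - 1 / (K + 1 + 1)) := by ring
    have h1 : (0 : ℝ) ≤ 1 / (K + 1) - 1 / (K + 1 + 1) := by
      rw [sub_nonneg]
      gcongr
      linarith
    rw [e]
    calc _ ≤ _ := abs_add_le _ _
      _ ≤ (2 / ((M : ℝ) + 1) - 1 / (K + 1)) + 1 * (1 / (K + 1) - 1 / (K + 1 + 1)) := by
        rw [abs_mul, abs_of_nonneg h1]
        gcongr
        exact hσ _
      _ = _ := by ring

/-- Multiplied by `2 sin(πβ)`, the cosines become differences of consecutive values of `σ`. The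
resulting bound is of order `1 / M`, hence of order `β` since the sum starts beyond `1 / β`, and the
lower bound for `sin(πβ)` removes the multiplier. -/
lemma abs_sum_Ico_cos_div_le {β c : ℝ} (hβ : 0 < β) (hc : 0 < c)
    (hs : c * β ≤ Real.sin (Real.pi * β)) {M K : ℕ} (hMK : M ≤ K) (hM : 1 ≤ β * (M + 1)) :
    |∑ m ∈ Finset.Ico M K, Real.cos (2 * Real.pi * (m + 1) * β) / ((m : ℝ) + 1)| ≤ 1 / c := by
  set σ : ℕ → ℝ := fun m => Real.sin ((2 * m + 1) * (Real.pi * β)) with hσ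
  have hσ1 : ∀ m, |σ m| ≤ 1 := fun m => Real.abs_sin_le_one _
  have h1 := abs_sum_sub_div_sub_le σ hσ1 hMK
  have h2 : ∑ m ∈ Finset.Ico M K, (σ (m + 1) - σ m) / ((m : ℝ) + 1) =
      2 * Real.sin (Real.pi * β) *
        ∑ m ∈ Finset.Ico M K, Real.cos (2 * Real.pi * (m + 1) * β) / ((m : ℝ) + 1) := by
    rw [Finset.mul_sum]
    refine Finset.sum_congr rfl fun m _ => ?_
    rw [← mul_div_assoc]
    congr 1
    simp only [hσ]
    rw [Real.sin_sub_sin]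
    push_cast
    rw [show ((2 * ((m : ℝ) + 1) + 1) * (Real.pi * β) - (2 * m + 1) * (Real.pi * β)) / 2 =
        Real.pi * β by ring, show ((2 * ((m : ℝ) + 1) + 1) * (Real.pi * β) +
        (2 * m + 1) * (Real.pi * β)) / 2 = 2 * Real.pi * (m + 1) * β by ring]
  rw [h2] at h1
  set S := ∑ m ∈ Finset.Ico M K, Real.cos (2 * Real.pi * (m + 1) * β) / ((m : ℝ) + 1)
  have h3 : |σ K / ((K : ℝ) + 1)| ≤ 1 / (K + 1) := by
    rw [abs_div, abs_of_pos (by positivity : (0 : ℝ) < (K : ℝ) + 1)]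
    gcongr
    exact hσ1 K
  have h4 : 2 / ((M : ℝ) + 1) ≤ 2 * β := by
    rw [div_le_iff₀ (by positivity)]
    linarith
  have h5 : |2 * Real.sin (Real.pi * β) * S| ≤ 2 * β := by
    rw [abs_le] at *
    constructor <;> linarith
  have hsin : 0 < Real.sin (Real.pi * β) := lt_of_lt_of_le (by positivity) hs
  rw [abs_mul, abs_of_pos (by positivity)] at h5
  rw [le_div_iff₀ hc]
  have h6 : β * (|S| * c) ≤ β * 1 := by
    nlinarith [abs_nonneg S]
  exact le_of_mul_le_mul_left h6 hβ

/-- Below `1 / β` every term is at most `πβ`, which gives a bounded total. Above it, `sin²` is half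
of `1 - cos`: the constant part is a harmonic sum from `1 / β` to `K`, and the cosines cancel. -/
lemma abs_sum_sin_sq_div_sub_le {β c : ℝ} (hβ : 0 < β) (hβ1 : β < 1) (hc : 0 < c)
    (hs : c * β ≤ Real.sin (Real.pi * β)) {K : ℕ} (hK : 1 ≤ K * β) :
    |∑ m ∈ Finset.range K, Real.sin (Real.pi * (m + 1) * β) ^ 2 / ((m : ℝ) + 1) -
      Real.log (K * β) / 2| ≤ 5 + 1 / c := by
  set M := ⌊1 / β⌋₊ with hM
  have hMle : (M : ℝ) ≤ 1 / β := Nat.floor_le (by positivity)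
  have hMlt : 1 / β < M + 1 := Nat.lt_floor_add_one _
  have hM0 : 0 < M := Nat.floor_pos.2 (by rw [le_div_iff₀ hβ]; linarith)
  have hM0' : (0 : ℝ) < M := by exact_mod_cast hM0
  have hMK : M ≤ K := by
    have : (M : ℝ) ≤ K := hMle.trans (by rwa [div_le_iff₀ hβ])
    exact_mod_cast this
  have hK0 : (0 : ℝ) < K := by
    have : (M : ℝ) ≤ K := by exact_mod_cast hMK
    linarith
  rw [← Finset.sum_range_add_sum_Ico _ hMK]
  have h1 : |∑ m ∈ Finset.range M, Real.sin (Real.pi * (m + 1) * β) ^ 2 / ((m : ℝ) + 1)| ≤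
      Real.pi := by
    refine (Finset.abs_sum_le_sum_abs _ _).trans ?_
    calc _ ≤ ∑ _m ∈ Finset.range M, Real.pi * β := by
          refine Finset.sum_le_sum fun m _ => ?_
          have := Real.pi_pos
          rw [abs_div, abs_pow, abs_of_pos (by positivity : (0 : ℝ) < (m : ℝ) + 1),
            div_le_iff₀ (by positivity)]
          have h2 : |Real.sin (Real.pi * (m + 1) * β)| ≤ Real.pi * (m + 1) * β := by
            refine Real.abs_sin_le_abs.trans_eq (abs_of_nonneg (by positivity))
          have h3 := Real.abs_sin_le_one (Real.pi * (m + 1) * β)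
          nlinarith [abs_nonneg (Real.sin (Real.pi * (m + 1) * β))]
      _ = Real.pi * (M * β) := by
          rw [Finset.sum_const, Finset.card_range, nsmul_eq_mul]; ring
      _ ≤ Real.pi * 1 := by
          have : (M : ℝ) * β ≤ 1 := by rwa [le_div_iff₀ hβ] at hMle
          have := Real.pi_pos
          gcongr
      _ = _ := mul_one _
  have h2 : ∑ m ∈ Finset.Ico M K, Real.sin (Real.pi * (m + 1) * β) ^ 2 / ((m : ℝ) + 1) =
      (∑ m ∈ Finset.Ico M K, ((m : ℝ) + 1)⁻¹) / 2 -
      (∑ m ∈ Finset.Ico M K, Real.cos (2 * Real.pi * (m + 1) * β) / ((m : ℝ) + 1)) / 2 := by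
    rw [← sub_div, ← Finset.sum_sub_distrib, Finset.sum_div]
    refine Finset.sum_congr rfl fun m _ => ?_
    rw [Real.sin_sq_eq_half_sub, show 2 * (Real.pi * ((m : ℝ) + 1) * β) =
      2 * Real.pi * (m + 1) * β by ring]
    field_simp
  have h3 := abs_sum_Ico_cos_div_le hβ hc hs hMK (by
    rw [div_lt_iff₀ hβ] at hMlt
    linarith)
  have h4 : ∑ m ∈ Finset.Ico M K, ((m : ℝ) + 1)⁻¹ = harmonic K - harmonic M := by
    rw [Finset.sum_Ico_eq_sub _ hMK]
    simp [harmonic]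
  have h5 : |∑ m ∈ Finset.Ico M K, ((m : ℝ) + 1)⁻¹ - Real.log (K * β)| ≤ 1 := by
    rw [h4, Real.log_mul hK0.ne' hβ.ne']
    have a1 := harmonic_le_one_add_log K
    have a2 := harmonic_le_one_add_log M
    have a3 := log_add_one_le_harmonic K
    have a4 := log_add_one_le_harmonic M
    have a5 : Real.log K ≤ Real.log ((K + 1 : ℕ) : ℝ) := Real.log_le_log hK0 (by push_cast; linarith)
    have a6 : Real.log M ≤ - Real.log β := by
      rw [← Real.log_inv, ← one_div]
      exact Real.log_le_log hM0' hMle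
    have a7 : - Real.log β ≤ Real.log ((M + 1 : ℕ) : ℝ) := by
      rw [← Real.log_inv, ← one_div]
      exact Real.log_le_log (by positivity) (by push_cast; exact hMlt.le)
    rw [abs_le]
    constructor <;> linarith
  have hpi4 : Real.pi < 3.15 := Real.pi_lt_d2
  rw [h2]
  have hc' : 0 < 1 / c := by positivity
  rw [abs_le] at *
  constructor <;> linarith

end SineSum

lemma sum_range_add_one_eq_sum_Icc {M : Type*} [AddCommMonoid M] (f : ℕ → M) (K : ℕ) :
    ∑ k ∈ Finset.range K, f (k + 1) = ∑ k ∈ Finset.Icc 1 K, f k := by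
  rw [Finset.range_eq_Ico, Finset.sum_Ico_add' f 0 K 1]
  rfl

lemma sum_Icc_ite_even {M : Type*} [AddCommMonoid M] (f : ℕ → M) (K : ℕ) :
    ∑ k ∈ Finset.Icc 1 K, (if 2 ∣ k then f k else 0) =
      ∑ m ∈ Finset.Icc 1 K, if 2 * m ≤ K then f (2 * m) else 0 := by
  rw [← Finset.sum_filter, ← Finset.sum_filter]
  symm
  refine Finset.sum_nbij' (fun m => 2 * m) (fun k => k / 2) ?_ ?_ ?_ ?_ ?_
  · intro m hm
    simp only [Finset.mem_filter, Finset.mem_Icc] at hm ⊢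
    omega
  · intro m hm
    simp only [Finset.mem_filter, Finset.mem_Icc] at hm ⊢
    omega
  · intro m _
    omega
  · intro m hm
    simp only [Finset.mem_filter, Finset.mem_Icc] at hm
    omega
  · intros
    rfl

lemma sum_inv_pow_le {x : ℝ} (hx : 1 < x) (S : Finset ℕ) : ∑ k ∈ S, (x ^ k)⁻¹ ≤ (1 - x⁻¹)⁻¹ := by
  have h0 : 0 ≤ x⁻¹ := by positivity
  have h1 : x⁻¹ < 1 := inv_lt_one_of_one_lt₀ hx
  simp_rw [← inv_pow]
  rw [← tsum_geometric_of_lt_one h0 h1]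
  exact (summable_geometric_of_lt_one h0 h1).sum_le_tsum S fun _ _ => by positivity

lemma sq_sqrt_natCard (F : Type*) : √(Nat.card F : ℝ) ^ 2 = Nat.card F :=
  Real.sq_sqrt (Nat.cast_nonneg _)

/-! ### Weights of the closed points. -/

section Weights

variable (F : Type*) [Field F] [Finite F]

lemma one_lt_sqrt_natCard : 1 < √(Nat.card F : ℝ) := by
  rw [Real.lt_sqrt zero_le_one]
  linarith [two_le_natCard (F := F)]

/-- The coefficient of the closed points of degree `m` in the character sum of a cover. -/
noncomputable def curveWeight (s : ℤˣ) (β : ℝ) (K m : ℕ) : ℝ :=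
  2 * selbergWeight s β K m / √(Nat.card F : ℝ) ^ m +
    if 2 * m ≤ K then selbergWeight s β K (2 * m) / √(Nat.card F : ℝ) ^ (2 * m) else 0

variable {F}
variable {s : ℤˣ} {β : ℝ} {K m : ℕ}

lemma abs_selbergWeight_two_mul_le (hm : m ≠ 0) :
    |if 2 * m ≤ K then selbergWeight s β K (2 * m) / √(Nat.card F : ℝ) ^ (2 * m) else 0| ≤
      4 / √(Nat.card F : ℝ) ^ (2 * m) := by
  have ht := one_lt_sqrt_natCard F
  split_ifs with h
  · rw [abs_div, abs_of_pos (by positivity : 0 < √(Nat.card F : ℝ) ^ (2 * m))]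
    gcongr
    exact abs_selbergWeight_le (by omega) h
  · rw [abs_zero]
    positivity

/-- The weights are dominated by their first term. -/
lemma abs_curveWeight_sq_sub_le (hm : m ≠ 0) (hmK : m ≤ K) :
    |curveWeight F s β K m ^ 2 - 4 * selbergWeight s β K m ^ 2 / (Nat.card F : ℝ) ^ m| ≤
      80 / √(Nat.card F : ℝ) ^ (3 * m) := by
  have ht := one_lt_sqrt_natCard F
  have h1 := abs_selbergWeight_two_mul_le (F := F) (s := s) (β := β) (K := K) hm
  have h2 := abs_selbergWeight_le (s := s) (β := β) hm hmK
  rw [show (Nat.card F : ℝ) ^ m = √(Nat.card F : ℝ) ^ (2 * m) by rw [pow_mul, sq_sqrt_natCard]]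
  unfold curveWeight
  set t := √(Nat.card F : ℝ)
  set b := selbergWeight s β K m
  set v := if 2 * m ≤ K then selbergWeight s β K (2 * m) / t ^ (2 * m) else 0
  have e : (2 * b / t ^ m + v) ^ 2 - 4 * b ^ 2 / t ^ (2 * m) = v * (4 * b / t ^ m + v) := by
    rw [mul_comm 2 m, pow_mul]
    field_simp
    ring
  rw [e, abs_mul]
  have h3 : |4 * b / t ^ m + v| ≤ 20 / t ^ m := by
    refine (abs_add_le _ _).trans ?_
    rw [abs_div, abs_mul, abs_of_pos (by positivity : 0 < t ^ m), abs_of_pos (four_pos : (0 : ℝ) < 4)]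
    have h4 : 4 / t ^ (2 * m) ≤ 4 / t ^ m := by
      gcongr
      · exact ht.le
      · omega
    calc 4 * |b| / t ^ m + |v| ≤ 4 * 4 / t ^ m + 4 / t ^ m := by
          gcongr
          exact h1.trans h4
      _ = _ := by ring
  calc |v| * |4 * b / t ^ m + v| ≤ 4 / t ^ (2 * m) * (20 / t ^ m) := by gcongr
    _ = 80 / t ^ (3 * m) := by
      rw [div_mul_div_comm, ← pow_add, show 2 * m + m = 3 * m by ring]
      norm_num

lemma abs_curveWeight_le (hm : m ≠ 0) (hmK : m ≤ K) : |curveWeight F s β K m| ≤ 12 := by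
  have ht := one_lt_sqrt_natCard F
  have h1 := abs_selbergWeight_two_mul_le (F := F) (s := s) (β := β) (K := K) hm
  have h2 := abs_selbergWeight_le (s := s) (β := β) hm hmK
  refine (abs_add_le _ _).trans ?_
  rw [abs_div, abs_mul, abs_of_pos (by positivity : 0 < √(Nat.card F : ℝ) ^ m),
    abs_of_pos (two_pos : (0 : ℝ) < 2)]
  have h3 : 4 / √(Nat.card F : ℝ) ^ (2 * m) ≤ 4 :=
    div_le_self (by norm_num) (one_le_pow₀ ht.le)
  have h4 : 2 * |selbergWeight s β K m| / √(Nat.card F : ℝ) ^ m ≤ 2 * |selbergWeight s β K m| :=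
    div_le_self (by positivity) (one_le_pow₀ ht.le)
  linarith

/-- The weights are bounded by an expression that is small for small degrees. -/
lemma curveWeight_sq_le (hβ : 0 < β) (hm : m ≠ 0) (hmK : m ≤ K) :
    curveWeight F s β K m ^ 2 ≤
      64 * √((β + 3 / (K + 1)) * m) / (Nat.card F : ℝ) ^ m + 32 / (Nat.card F : ℝ) ^ (2 * m) ∧
    curveWeight F s β K m ^ 2 ≤ 160 / (Nat.card F : ℝ) ^ m := by
  have hq := two_le_natCard (F := F)
  have ht := one_lt_sqrt_natCard F
  have h1 := abs_selbergWeight_two_mul_le (F := F) (s := s) (β := β) (K := K) hm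
  have h2 := abs_selbergWeight_le (s := s) (β := β) hm hmK
  have h2' := selbergWeight_sq_le (s := s) hβ hm hmK
  have h3 : selbergWeight s β K m ^ 2 ≤ 16 := by
    rw [← sq_abs]
    nlinarith [abs_nonneg (selbergWeight s β K m)]
  unfold curveWeight
  rw [pow_mul √(Nat.card F : ℝ), sq_sqrt_natCard F] at h1 ⊢
  set b := selbergWeight s β K m
  set v := if 2 * m ≤ K then selbergWeight s β K (2 * m) / (Nat.card F : ℝ) ^ m else 0
  have hv : v ^ 2 ≤ 16 / (Nat.card F : ℝ) ^ (2 * m) := by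
    rw [← sq_abs, mul_comm 2 m, pow_mul, show (16 : ℝ) = 4 ^ 2 by norm_num, ← div_pow]
    gcongr
  have hb : (2 * b / √(Nat.card F : ℝ) ^ m) ^ 2 = 4 * b ^ 2 / (Nat.card F : ℝ) ^ m := by
    rw [div_pow, ← pow_mul, mul_comm m 2, pow_mul √(Nat.card F : ℝ), sq_sqrt_natCard F]
    ring
  have key : (2 * b / √(Nat.card F : ℝ) ^ m + v) ^ 2 ≤
      8 * b ^ 2 / (Nat.card F : ℝ) ^ m + 32 / (Nat.card F : ℝ) ^ (2 * m) := by
    calc _ ≤ 2 * ((2 * b / √(Nat.card F : ℝ) ^ m) ^ 2 + v ^ 2) := add_sq_le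
      _ ≤ 2 * (4 * b ^ 2 / (Nat.card F : ℝ) ^ m + 16 / (Nat.card F : ℝ) ^ (2 * m)) := by
        rw [hb]
        gcongr
      _ = _ := by ring
  constructor
  · refine key.trans ?_
    have h6 : 8 * b ^ 2 ≤ 64 * √((β + 3 / (K + 1)) * m) := by linarith
    gcongr
  · refine key.trans ?_
    have h5 : 32 / (Nat.card F : ℝ) ^ (2 * m) ≤ 32 / (Nat.card F : ℝ) ^ m := by
      gcongr
      · linarith
      · omega
    calc _ ≤ 8 * 16 / (Nat.card F : ℝ) ^ m + 32 / (Nat.card F : ℝ) ^ m := by gcongr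
      _ = _ := by ring

end Weights

/-! ### Reduction of the character sum to closed points. -/

section Main

variable (p : ℕ) [Fact p.Prime] {F : Type*} [Field F] [Finite F] [Algebra (ZMod p) F]

lemma pow_div_three_div_pow_le {τ : ℝ} (hτ : 1 < τ) (k : ℕ) :
    (τ ^ 6) ^ (k / 3) / (τ ^ 3) ^ k ≤ (τ ^ k)⁻¹ := by
  rw [← pow_mul, ← pow_mul, div_le_iff₀ (by positivity), inv_mul_eq_div, le_div_iff₀ (by positivity), ← pow_add]
  gcongr
  · exact hτ.le
  · omega

variable (F) in
/-- The character sum of a cover is, up to a bounded error, a weighted sum over closed points. -/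
lemma exists_abs_curveSum_sub_le [CharP F p] (hp : p ≠ 2) :
    ∃ B : ℝ, ∀ (s : ℤˣ) (β : ℝ) (K d : ℕ) (g h : MvPolynomial (Fin 2) F), g.IsHomogeneous d →
      h.IsHomogeneous d → |(curveSum p s β K (g, h)).re - ∑ m ∈ Finset.Icc 1 K,
        curveWeight F s β K m * closedPointSum p (dehomogenize g) (dehomogenize h) m| ≤ B := by
  set t := √(Nat.card F : ℝ) with ht
  have ht1 : 1 < t := one_lt_sqrt_natCard F
  -- So `τ` is the sixth root of `q`: the neglected terms are of order `q^{k/3}` against a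
  -- denominator `q^{k/2}`, leaving a geometric series in `τ⁻¹`.
  set τ := t ^ ((3 : ℝ)⁻¹) with hτ
  have hτ1 : 1 < τ := Real.one_lt_rpow ht1 (by norm_num)
  have hτ3 : τ ^ 3 = t := by
    rw [hτ, ← Real.rpow_natCast, ← Real.rpow_mul (by positivity)]
    norm_num
  have hq : τ ^ 6 = Nat.card F := by
    rw [show 6 = 3 * 2 from rfl, pow_mul, hτ3, ht, sq_sqrt_natCard]
  refine ⟨24 * p * (1 - τ⁻¹)⁻¹, fun s β K d g h hg hh => ?_⟩
  obtain ⟨θ, hθ, hsum⟩ := curveSum_re_eq p s β K hg hh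
  set T := closedPointSum p (dehomogenize g) (dehomogenize h) with hT
  set a : ℕ → ℝ := fun k => selbergCoeff s β K (k : ℤ) with ha
  set E : ℕ → ℝ := fun k =>
    affineSum p (FiniteField.Extension F p (k + 1)) (dehomogenize g) (dehomogenize h) + θ k -
      (((k + 1 : ℕ) : ℝ) * T (k + 1) +
        if 2 ∣ k + 1 then (((k + 1) / 2 : ℕ) : ℝ) * T ((k + 1) / 2) else 0) with hE
  have hE1 : ∀ k, |E k| ≤ 3 * p * (Nat.card F : ℝ) ^ ((k + 1) / 3) := by
    intro k
    have h1 := abs_affineSum_extension_sub_le p F hp (k + 1) (dehomogenize g) (dehomogenize h)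
    have h2 := hθ k
    have h3 : (p : ℝ) * 1 ≤ p * (Nat.card F : ℝ) ^ ((k + 1) / 3) := by
      gcongr
      exact one_le_pow₀ (by linarith [two_le_natCard (F := F)])
    simp only [hE]
    rw [abs_le] at *
    constructor <;> linarith
  have hpow : ∀ k : ℕ, (Nat.card F : ℝ) ^ ((k : ℝ) / 2) = t ^ k := by
    intro k
    rw [ht, Real.sqrt_eq_rpow, ← Real.rpow_natCast, ← Real.rpow_mul (Nat.cast_nonneg _)]
    ring_nf
  -- Even exponents `k = 2m` also see the points of degree `m`, with coefficient `2 Î(2m) m`, which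
  -- is `selbergWeight` at `2m`; this is the second term of `curveWeight`.
  have hmain : ∑ m ∈ Finset.Icc 1 K, curveWeight F s β K m * T m =
      ∑ k ∈ Finset.range K, 2 * a (k + 1) * (((k + 1 : ℕ) : ℝ) * T (k + 1) +
        if 2 ∣ k + 1 then (((k + 1) / 2 : ℕ) : ℝ) * T ((k + 1) / 2) else 0) / t ^ (k + 1) := by
    rw [sum_range_add_one_eq_sum_Icc (fun k => 2 * a k * ((k : ℝ) * T k +
      if 2 ∣ k then ((k / 2 : ℕ) : ℝ) * T (k / 2) else 0) / t ^ k)]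
    have e1 : ∀ k, 2 * a k * ((k : ℝ) * T k +
        if 2 ∣ k then ((k / 2 : ℕ) : ℝ) * T (k / 2) else 0) / t ^ k =
        2 * selbergWeight s β K k / t ^ k * T k +
          if 2 ∣ k then 2 * a k * ((k / 2 : ℕ) : ℝ) * T (k / 2) / t ^ k else 0 := by
      intro k
      unfold selbergWeight
      split_ifs <;> ring
    simp_rw [e1]
    rw [Finset.sum_add_distrib, sum_Icc_ite_even, ← Finset.sum_add_distrib]
    refine Finset.sum_congr rfl fun m _ => ?_
    unfold curveWeight
    rw [add_mul]
    congr 1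
    split_ifs
    · rw [Nat.mul_div_cancel_left _ two_pos]
      simp only [selbergWeight, ha]
      push_cast
      ring
    · rw [zero_mul]
  have hdiff : (curveSum p s β K (g, h)).re - ∑ m ∈ Finset.Icc 1 K, curveWeight F s β K m * T m =
      ∑ k ∈ Finset.range K, 2 * a (k + 1) * E k / t ^ (k + 1) := by
    rw [hsum, hmain, ← Finset.sum_sub_distrib]
    refine Finset.sum_congr rfl fun k _ => ?_
    rw [hpow (k + 1), ← sub_div, ← mul_sub]
  rw [hdiff]
  have hab : ∀ k ∈ Finset.range K, |a (k + 1)| ≤ 4 := by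
    intro k hk
    have h1 := abs_selbergWeight_le (s := s) (β := β) k.succ_ne_zero (Finset.mem_range.1 hk)
    unfold selbergWeight at h1
    rw [abs_mul, abs_of_nonneg (Nat.cast_nonneg _)] at h1
    refine le_trans ?_ h1
    refine le_mul_of_one_le_left (abs_nonneg _) ?_
    push_cast
    linarith [(Nat.cast_nonneg k : (0 : ℝ) ≤ k)]
  calc _ ≤ ∑ k ∈ Finset.range K, |2 * a (k + 1) * E k / t ^ (k + 1)| := Finset.abs_sum_le_sum_abs _ _
    _ ≤ ∑ k ∈ Finset.range K, 24 * p * (τ ^ (k + 1))⁻¹ := by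
      refine Finset.sum_le_sum fun k hk => ?_
      have h1 := hE1 k
      have h2 := hab k hk
      have h3 := pow_div_three_div_pow_le hτ1 (k + 1)
      rw [hτ3, hq] at h3
      rw [abs_div, abs_mul, abs_mul, abs_of_pos (two_pos : (0 : ℝ) < 2),
        abs_of_pos (by positivity : 0 < t ^ (k + 1))]
      calc 2 * |a (k + 1)| * |E k| / t ^ (k + 1)
          ≤ 2 * 4 * (3 * p * (Nat.card F : ℝ) ^ ((k + 1) / 3)) / t ^ (k + 1) := by gcongr
        _ = 24 * p * ((Nat.card F : ℝ) ^ ((k + 1) / 3) / t ^ (k + 1)) := by ring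
        _ ≤ _ := by gcongr
    _ = 24 * p * ∑ k ∈ Finset.Icc 1 K, (τ ^ k)⁻¹ := by
      rw [← Finset.mul_sum, sum_range_add_one_eq_sum_Icc (fun k => (τ ^ k)⁻¹)]
    _ ≤ _ := by
      gcongr
      exact sum_inv_pow_le hτ1 _

end Main

/-! ### Sums over the closed points where the denominator does not vanish. -/

section OpenPoints

variable {F : Type*} [Field F] [Finite F]

open Classical in
/-- The monic irreducible polynomials of degree at most `K` that do not divide `H`. -/
noncomputable def openPoints (H : F[X]) (K : ℕ) : Finset (MonicIrr F) :=
  (Finset.Icc 1 K).biUnion fun m => (monicIrrOfDegree F m).filter fun P => ¬ P.1 ∣ H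

lemma mem_openPoints {H : F[X]} {K : ℕ} {P : MonicIrr F} :
    P ∈ openPoints H K ↔ P.1.natDegree ≤ K ∧ ¬ P.1 ∣ H := by
  have := P.natDegree_pos
  simp only [openPoints, Finset.mem_biUnion, Finset.mem_Icc, Finset.mem_filter,
    mem_monicIrrOfDegree]
  constructor
  · rintro ⟨m, hm, rfl, h⟩
    exact ⟨hm.2, h⟩
  · rintro ⟨h1, h2⟩
    exact ⟨_, ⟨this, h1⟩, rfl, h2⟩

open Classical in
lemma sum_openPoints {M : Type*} [AddCommMonoid M] (H : F[X]) (K : ℕ) (φ : MonicIrr F → M) :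
    ∑ P ∈ openPoints H K, φ P =
      ∑ m ∈ Finset.Icc 1 K, ∑ P ∈ (monicIrrOfDegree F m).filter fun P => ¬ P.1 ∣ H, φ P := by
  refine Finset.sum_biUnion fun m _ m' _ h => Finset.disjoint_left.2 fun P hP hP' => h ?_
  rw [Finset.mem_filter, mem_monicIrrOfDegree] at hP hP'
  rw [← hP.1, ← hP'.1]

lemma card_openPoints_le (H : F[X]) (K : ℕ) : (openPoints H K).card ≤ 2 * Nat.card F ^ K := by
  classical
  rw [Finset.card_eq_sum_ones, sum_openPoints]
  refine le_trans ?_ (sum_mul_card_monicIrrOfDegree_le (Finset.Icc 1 K) K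
    fun m hm => (Finset.mem_Icc.1 hm).2)
  refine Finset.sum_le_sum fun m hm => ?_
  rw [← Finset.card_eq_sum_ones]
  exact (Finset.card_filter_le _ _).trans (Nat.le_mul_of_pos_left _ (Finset.mem_Icc.1 hm).1)

lemma sum_curveWeight_mul_closedPointSum (p : ℕ) [Fact p.Prime] [Algebra (ZMod p) F] (w : ℕ → ℝ)
    (G H : F[X]) (K : ℕ) : ∑ m ∈ Finset.Icc 1 K, w m * closedPointSum p G H m =
      ∑ P ∈ openPoints H K, w P.1.natDegree * centered p (localTrace p H P G = 0) := by
  classical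
  rw [sum_openPoints]
  refine Finset.sum_congr rfl fun m _ => ?_
  rw [closedPointSum, Finset.mul_sum]
  refine Finset.sum_congr (by congr) fun P hP => ?_
  rw [Finset.mem_filter, mem_monicIrrOfDegree] at hP
  rw [hP.1]

open Classical in
lemma sum_openPoints_natDegree {H : F[X]} (hH : H ≠ 0) (K : ℕ) (φ : ℕ → ℝ) :
    ∑ P ∈ openPoints H K, φ P.1.natDegree =
      ∑ m ∈ Finset.Icc 1 K, φ m * (monicIrrOfDegree F m).card -
      ∑ m ∈ Finset.Icc 1 K,
        φ m * ((monicIrrDivisors H).filter fun P => P.1.natDegree = m).card := by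
  rw [sum_openPoints, ← Finset.sum_sub_distrib]
  refine Finset.sum_congr rfl fun m _ => ?_
  have h1 : ∑ P ∈ (monicIrrOfDegree F m).filter (fun P => ¬ P.1 ∣ H), φ P.1.natDegree =
      φ m * ((monicIrrOfDegree F m).filter fun P => ¬ P.1 ∣ H).card := by
    rw [mul_comm, ← nsmul_eq_mul, ← Finset.sum_const]
    refine Finset.sum_congr rfl fun P hP => ?_
    rw [Finset.mem_filter, mem_monicIrrOfDegree] at hP
    rw [hP.1]
  have h2 : (monicIrrDivisors H).filter (fun P => P.1.natDegree = m) =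
      (monicIrrOfDegree F m).filter fun P => P.1 ∣ H := by
    ext P
    rw [Finset.mem_filter, Finset.mem_filter, mem_monicIrrDivisors hH, mem_monicIrrOfDegree, and_comm]
  have h3 := Finset.card_filter_add_card_filter_not (s := monicIrrOfDegree F m) (fun P => P.1 ∣ H)
  rw [h1, h2, ← mul_sub, ← h3]
  push_cast
  ring

end OpenPoints

/-! ### The sum of the squared weights. -/

section Variance

variable (F : Type*) [Field F] [Finite F]

variable {F} in
-- The number of closed points of degree `m` is `q^m / m` up to `2 q^{m/2} / m`, and the squared
-- weight is `4 b^2 / q^m` up to `O(q^{-3m/2})`, with `b` the Selberg weight; the product has an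
-- error `O(q^{-m/2})`.
lemma abs_curveWeight_sq_mul_card_sub_le {s : ℤˣ} {β : ℝ} {K m : ℕ} (hm : m ≠ 0) (hmK : m ≤ K) :
    |curveWeight F s β K m ^ 2 * (monicIrrOfDegree F m).card - 4 * (selbergWeight s β K m ^ 2 / m)| ≤
      208 * (√(Nat.card F : ℝ) ^ m)⁻¹ := by
  have ht := one_lt_sqrt_natCard F
  have h1 := abs_curveWeight_sq_sub_le (F := F) (s := s) (β := β) hm hmK
  have h2 := abs_selbergWeight_le (s := s) (β := β) hm hmK
  have h3 : (m : ℝ) * (monicIrrOfDegree F m).card ≤ (Nat.card F : ℝ) ^ m := by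
    exact_mod_cast mul_card_monicIrrOfDegree_le m
  have h4 : (Nat.card F : ℝ) ^ m ≤
      m * (monicIrrOfDegree F m).card + 2 * (Nat.card F : ℝ) ^ (m / 2) := by
    exact_mod_cast natCard_pow_le_mul_card_monicIrrOfDegree m
  have hm1 : (1 : ℝ) ≤ m := by exact_mod_cast Nat.one_le_iff_ne_zero.2 hm
  have h5 : (Nat.card F : ℝ) ^ (m / 2) ≤ √(Nat.card F : ℝ) ^ m := by
    nth_rewrite 1 [← sq_sqrt_natCard F]
    rw [← pow_mul]
    gcongr
    · exact ht.le
    · omega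
  rw [show (Nat.card F : ℝ) ^ m = √(Nat.card F : ℝ) ^ (2 * m) by
    rw [pow_mul, sq_sqrt_natCard]] at *
  set t := √(Nat.card F : ℝ)
  set b := selbergWeight s β K m
  set W := curveWeight F s β K m
  set n : ℝ := ((monicIrrOfDegree F m).card : ℝ)
  have hn : 0 ≤ n := Nat.cast_nonneg _
  have hn' : n ≤ t ^ (2 * m) := le_trans (le_mul_of_one_le_left hn hm1) h3
  have hb : b ^ 2 ≤ 16 := by
    rw [← sq_abs]
    nlinarith [abs_nonneg b]
  have e : W ^ 2 * n - 4 * (b ^ 2 / m) = (W ^ 2 - 4 * b ^ 2 / t ^ (2 * m)) * n +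
      4 * b ^ 2 * ((m * n - t ^ (2 * m)) / (m * t ^ (2 * m))) := by
    field_simp
    ring
  rw [e]
  have h6 : |(m * n - t ^ (2 * m)) / (m * t ^ (2 * m))| ≤ 2 / t ^ m := by
    rw [abs_div, abs_of_pos (by positivity : (0 : ℝ) < m * t ^ (2 * m)), div_le_div_iff₀ (by positivity)
      (by positivity)]
    have h7 : |m * n - t ^ (2 * m)| ≤ 2 * t ^ m := by
      rw [abs_le]
      constructor
      · linarith
      · have : 0 ≤ 2 * t ^ m := by positivity
        linarith
    calc |m * n - t ^ (2 * m)| * t ^ m ≤ 2 * t ^ m * t ^ m := by gcongr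
      _ = 2 * (1 * t ^ (2 * m)) := by ring
      _ ≤ _ := by gcongr
  calc _ ≤ _ := abs_add_le _ _
    _ = |W ^ 2 - 4 * b ^ 2 / t ^ (2 * m)| * n +
        4 * b ^ 2 * |(m * n - t ^ (2 * m)) / (m * t ^ (2 * m))| := by
      rw [abs_mul, abs_mul, abs_of_nonneg hn, abs_of_nonneg (by positivity : 0 ≤ 4 * b ^ 2)]
    _ ≤ 80 / t ^ (3 * m) * t ^ (2 * m) + 4 * 16 * (2 / t ^ m) := by gcongr
    _ = _ := by
      rw [show 3 * m = 2 * m + m by ring, pow_add]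
      field_simp
      norm_num

lemma sum_inv_sqrt_le (L : ℕ) : ∑ m ∈ Finset.Icc 1 L, (√(m : ℝ))⁻¹ ≤ 2 * √(L : ℝ) := by
  rw [← sum_range_add_one_eq_sum_Icc (fun m => (√(m : ℝ))⁻¹)]
  induction L with
  | zero => simp
  | succ L ih =>
    rw [Finset.sum_range_succ]
    refine (add_le_add_left ih _).trans ?_
    have h1 : 0 < √((L + 1 : ℕ) : ℝ) := Real.sqrt_pos.2 (by positivity)
    have h2 : √((L + 1 : ℕ) : ℝ) ^ 2 = L + 1 := by
      rw [Real.sq_sqrt (Nat.cast_nonneg _)]; push_cast; rfl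
    have h3 : √(L : ℝ) ^ 2 = L := Real.sq_sqrt (Nat.cast_nonneg _)
    have h4 : 0 ≤ √(L : ℝ) := Real.sqrt_nonneg _
    set x := √((L + 1 : ℕ) : ℝ)
    set y := √(L : ℝ)
    rw [inv_eq_one_div, ← sub_nonneg, show 2 * x - (2 * y + 1 / x) = (2 * x ^ 2 - 2 * y * x - 1) / x by
      field_simp
      ring]
    refine div_nonneg ?_ h1.le
    nlinarith [sq_nonneg (x - y)]

variable {F} in
open Classical in
-- This is the loss caused by the zeros of `H`. Up to degree `L` there may be as many as `q^m / m`
-- of them, and the smallness of the weights in low degrees is used. Beyond `L` the squared weights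
-- are at most `160 / q^L`, and there are at most `q^L` divisors altogether.
lemma sum_curveWeight_sq_mul_card_divisors_le (s : ℤˣ) {β : ℝ} (hβ : 0 < β) (K L : ℕ) {H : F[X]}
    (hH : H ≠ 0) (hL : H.natDegree ≤ Nat.card F ^ L) :
    ∑ m ∈ Finset.Icc 1 K, curveWeight F s β K m ^ 2 *
      ((monicIrrDivisors H).filter fun P => P.1.natDegree = m).card ≤
      128 * √((β + 3 / (K + 1)) * L) + 32 * (1 - (Nat.card F : ℝ)⁻¹)⁻¹ + 160 := by
  have hq := two_le_natCard (F := F)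
  set q : ℝ := (Nat.card F : ℝ) with hqdef
  have hq1 : 1 < q := by linarith
  set η := β + 3 / ((K : ℝ) + 1)
  have hη : 0 < η := by positivity
  set D : ℕ → ℝ := fun m => (((monicIrrDivisors H).filter fun P => P.1.natDegree = m).card : ℕ)
  have hD0 : ∀ m, 0 ≤ D m := fun m => Nat.cast_nonneg _
  have hD : ∀ m, m * D m ≤ q ^ m := by
    intro m
    refine le_trans ?_ (show ((m * (monicIrrOfDegree F m).card : ℕ) : ℝ) ≤ q ^ m by
      rw [hqdef]
      exact_mod_cast mul_card_monicIrrOfDegree_le (F := F) m)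
    push_cast
    refine mul_le_mul_of_nonneg_left (Nat.cast_le.2 (Finset.card_le_card fun P hP => ?_))
      (Nat.cast_nonneg _)
    rw [Finset.mem_filter] at hP
    exact mem_monicIrrOfDegree.2 hP.2
  have hDsum : ∑ m ∈ Finset.Icc 1 K, D m ≤ q ^ L := by
    refine le_trans ?_ (show ((H.natDegree : ℕ) : ℝ) ≤ q ^ L by
      rw [hqdef]
      exact_mod_cast hL)
    simp only [D]
    rw [← Nat.cast_sum]
    refine Nat.cast_le.2 (le_trans ?_ (card_monicIrrDivisors_le_natDegree hH))
    rw [← Finset.card_biUnion]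
    · exact Finset.card_le_card (Finset.biUnion_subset.2 fun m _ => Finset.filter_subset _ _)
    · intro m _ m' _ h
      refine Finset.disjoint_left.2 fun P hP hP' => h ?_
      rw [Finset.mem_filter] at hP hP'
      rw [← hP.2, ← hP'.2]
  have key : ∀ m ∈ Finset.Icc 1 K, curveWeight F s β K m ^ 2 * D m ≤
      (if m ≤ L then 64 * √η * (√(m : ℝ))⁻¹ else 0) + 32 * (q ^ m)⁻¹ + 160 / q ^ L * D m := by
    intro m hm
    rw [Finset.mem_Icc] at hm
    obtain ⟨h1, h2⟩ := curveWeight_sq_le (F := F) (s := s) hβ (by omega : m ≠ 0) hm.2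
    have hm1 : (1 : ℝ) ≤ m := by exact_mod_cast hm.1
    have hDm : D m ≤ q ^ m / m := by
      rw [le_div_iff₀ (by positivity), mul_comm]
      exact hD m
    split_ifs with hmL
    · have hsq : √(m : ℝ) * √(m : ℝ) = m := Real.mul_self_sqrt (by positivity)
      have hsp : 0 < √(m : ℝ) := Real.sqrt_pos.2 (by positivity)
      have h3 : 0 ≤ 160 / q ^ L * D m := mul_nonneg (by positivity) (hD0 m)
      have h4 : (q ^ m)⁻¹ / m ≤ (q ^ m)⁻¹ := div_le_self (by positivity) hm1
      calc _ ≤ (64 * √(η * m) / q ^ m + 32 / q ^ (2 * m)) * (q ^ m / m) := by gcongr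
        _ = 64 * √η * (√(m : ℝ) / m) + 32 * ((q ^ m)⁻¹ / m) := by
          rw [Real.sqrt_mul hη.le, two_mul, pow_add]
          field_simp
        _ = 64 * √η * (√(m : ℝ))⁻¹ + 32 * ((q ^ m)⁻¹ / m) := by
          congr 2
          nth_rewrite 2 [← hsq]
          field_simp
        _ ≤ _ := by linarith
    · have h3 : (0 : ℝ) ≤ 32 * (q ^ m)⁻¹ := by positivity
      have h4 : curveWeight F s β K m ^ 2 ≤ 160 / q ^ L := by
        refine h2.trans ?_
        gcongr
        · exact hq1.le
        · omega
      have h5 := mul_le_mul_of_nonneg_right h4 (hD0 m)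
      linarith
  refine (Finset.sum_le_sum key).trans ?_
  rw [Finset.sum_add_distrib, Finset.sum_add_distrib, ← Finset.mul_sum, ← Finset.mul_sum]
  gcongr
  · rw [← Finset.sum_filter, ← Finset.mul_sum, Real.sqrt_mul hη.le]
    have h1 : ∑ m ∈ (Finset.Icc 1 K).filter (· ≤ L), (√(m : ℝ))⁻¹ ≤ 2 * √(L : ℝ) := by
      refine le_trans (Finset.sum_le_sum_of_subset_of_nonneg ?_ fun _ _ _ => by positivity)
        (sum_inv_sqrt_le L)
      intro m hm
      simp only [Finset.mem_filter, Finset.mem_Icc] at hm ⊢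
      omega
    calc 64 * √η * ∑ m ∈ (Finset.Icc 1 K).filter (· ≤ L), (√(m : ℝ))⁻¹
        ≤ 64 * √η * (2 * √(L : ℝ)) := by gcongr
      _ = _ := by ring
  · exact sum_inv_pow_le hq1 _
  · calc 160 / q ^ L * ∑ m ∈ Finset.Icc 1 K, D m ≤ 160 / q ^ L * q ^ L := by gcongr
      _ = 160 := by field_simp

/-- The sum of the squared weights over the closed points outside the zeros of `H`. -/
lemma exists_abs_sum_curveWeight_sq_sub_le {c : ℝ} (hc : 0 < c) :
    ∃ B : ℝ, ∀ (s : ℤˣ) (β : ℝ) (K L : ℕ) (H : F[X]), 0 < β → β < 1 →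
      c * β ≤ Real.sin (Real.pi * β) → 1 ≤ K * β → H ≠ 0 → H.natDegree ≤ Nat.card F ^ L →
      |∑ P ∈ openPoints H K, curveWeight F s β K P.1.natDegree ^ 2 -
        2 / Real.pi ^ 2 * Real.log (K * β)| ≤ B + 128 * √((β + 3 / (K + 1)) * L) := by
  classical
  have hpi := Real.pi_pos
  refine ⟨208 * (1 - (√(Nat.card F : ℝ))⁻¹)⁻¹ + 60 + 4 / Real.pi ^ 2 * (5 + 1 / c) +
    32 * (1 - (Nat.card F : ℝ)⁻¹)⁻¹ + 160, fun s β K L H hβ hβ1 hs hK hH hL => ?_⟩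
  have h1 := sum_openPoints_natDegree hH K (fun m => curveWeight F s β K m ^ 2)
  have h2 := sum_curveWeight_sq_mul_card_divisors_le s hβ K L hH hL
  have h2' : 0 ≤ ∑ m ∈ Finset.Icc 1 K, curveWeight F s β K m ^ 2 *
      ((monicIrrDivisors H).filter fun P => P.1.natDegree = m).card :=
    Finset.sum_nonneg fun _ _ => by positivity
  have h3 : |∑ m ∈ Finset.Icc 1 K, curveWeight F s β K m ^ 2 * (monicIrrOfDegree F m).card -
      ∑ m ∈ Finset.Icc 1 K, 4 * (selbergWeight s β K m ^ 2 / m)| ≤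
      208 * (1 - (√(Nat.card F : ℝ))⁻¹)⁻¹ := by
    rw [← Finset.sum_sub_distrib]
    refine (Finset.abs_sum_le_sum_abs _ _).trans ((Finset.sum_le_sum fun m hm => ?_).trans
      ((Finset.mul_sum _ _ _).symm.trans_le
        (mul_le_mul_of_nonneg_left (sum_inv_pow_le (one_lt_sqrt_natCard F) (Finset.Icc 1 K))
          (by norm_num))))
    rw [Finset.mem_Icc] at hm
    exact abs_curveWeight_sq_mul_card_sub_le (by omega) hm.2
  have h4 : |∑ m ∈ Finset.Icc 1 K, 4 * (selbergWeight s β K m ^ 2 / m) - 4 / Real.pi ^ 2 *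
      ∑ m ∈ Finset.Icc 1 K, Real.sin (Real.pi * m * β) ^ 2 / (m : ℝ)| ≤ 60 := by
    rw [Finset.mul_sum, ← Finset.sum_sub_distrib]
    refine (Finset.abs_sum_le_sum_abs _ _).trans ?_
    calc _ ≤ ∑ _m ∈ Finset.Icc 1 K, 60 / ((K : ℝ) + 1) := by
          refine Finset.sum_le_sum fun m hm => ?_
          rw [Finset.mem_Icc] at hm
          have := abs_selbergWeight_sq_sub_le (s := s) (β := β) (by omega : m ≠ 0) hm.2
          rw [show 4 * (selbergWeight s β K m ^ 2 / m) - 4 / Real.pi ^ 2 *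
            (Real.sin (Real.pi * m * β) ^ 2 / m) = 4 * (selbergWeight s β K m ^ 2 / m -
            Real.sin (Real.pi * m * β) ^ 2 / m / Real.pi ^ 2) by ring, abs_mul,
            abs_of_pos (four_pos : (0 : ℝ) < 4)]
          calc _ ≤ 4 * (15 / ((K : ℝ) + 1)) := by gcongr
            _ = _ := by ring
      _ = K * (60 / ((K : ℝ) + 1)) := by simp
      _ ≤ 60 := by
        rw [← mul_div_assoc, div_le_iff₀ (by positivity)]
        linarith
  have h5 := abs_sum_sin_sq_div_sub_le hβ hβ1 hc hs hK
  have e : ∑ m ∈ Finset.range K, Real.sin (Real.pi * (m + 1) * β) ^ 2 / ((m : ℝ) + 1) =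
      ∑ m ∈ Finset.Icc 1 K, Real.sin (Real.pi * m * β) ^ 2 / (m : ℝ) := by
    rw [← sum_range_add_one_eq_sum_Icc (fun m : ℕ => Real.sin (Real.pi * m * β) ^ 2 / (m : ℝ))]
    push_cast
    rfl
  rw [e] at h5
  have h6 : |4 / Real.pi ^ 2 * ∑ m ∈ Finset.Icc 1 K, Real.sin (Real.pi * m * β) ^ 2 / (m : ℝ) -
      2 / Real.pi ^ 2 * Real.log (K * β)| ≤ 4 / Real.pi ^ 2 * (5 + 1 / c) := by
    rw [show ∀ x y : ℝ, 4 / Real.pi ^ 2 * x - 2 / Real.pi ^ 2 * y = 4 / Real.pi ^ 2 * (x - y / 2) by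
      intros; ring, abs_mul, abs_of_pos (by positivity : 0 < 4 / Real.pi ^ 2)]
    gcongr
  rw [h1]
  rw [abs_le] at *
  constructor <;> linarith

end Variance

/-! ### Growth of the truncation and asymptotics of the variance. -/

section Asymptotics

/-- The degree `⌊γ / log log (γ β)⌋` of the Beurling–Selberg polynomials. -/
noncomputable def truncation (γ β : ℝ) : ℕ := ⌊γ / Real.log (Real.log (γ * β))⌋₊

/-- With `y = γβ`, the product of the truncation and `β` lies between `y / (2 log y)` and `y`; the
factor `2` absorbs the rounding down, which costs at most `β < 1`. -/
lemma truncation_mul_bounds {γ β : ℝ} (hβ : 0 < β) (hβ1 : β < 1)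
    (h1 : 1 ≤ Real.log (Real.log (γ * β))) (h2 : 2 * Real.log (γ * β) ≤ γ * β)
    (h3 : 2 ≤ Real.log (γ * β)) :
    1 ≤ truncation γ β * β ∧
      |Real.log (truncation γ β * β) - Real.log (γ * β)| ≤ Real.log (Real.log (γ * β)) + 1 := by
  set y := γ * β with hy
  set l := Real.log y with hl
  have hlpos : 0 < l := by linarith
  have hy0 : 0 < y := by linarith
  have hγ : 0 < γ := pos_of_mul_pos_left (hy ▸ hy0) hβ.le
  have hll : Real.log l ≤ l := (Real.log_le_sub_one_of_pos hlpos).trans (by linarith)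
  have hk1 : (truncation γ β : ℝ) ≤ γ / Real.log l := Nat.floor_le (by positivity)
  have hk2 : γ / Real.log l < truncation γ β + 1 := Nat.lt_floor_add_one _
  set K : ℝ := (truncation γ β : ℝ)
  have h3' : 1 ≤ y / (2 * l) := by rwa [le_div_iff₀ (by positivity), one_mul]
  have h4 : K * β ≤ y := by
    rw [hy]
    gcongr
    exact hk1.trans (div_le_self hγ.le h1)
  have h5 : y / (2 * l) ≤ K * β := by
    have h6 : γ / l ≤ γ / Real.log l := by gcongr
    have h7 : (γ / l - 1) * β ≤ K * β := by
      gcongr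
      linarith
    have h8 : (γ / l - 1) * β = 2 * (y / (2 * l)) - β := by
      rw [hy]
      field_simp
    linarith
  have h6 : 0 < K * β := by linarith
  refine ⟨h3'.trans h5, ?_⟩
  have h7 : Real.log (K * β) ≤ l := Real.log_le_log h6 h4
  have h8 : l - (Real.log 2 + Real.log l) ≤ Real.log (K * β) := by
    have := Real.log_le_log (by positivity) h5
    rwa [Real.log_div hy0.ne' (by positivity), Real.log_mul two_ne_zero hlpos.ne'] at this
  have h9 : Real.log 2 ≤ 1 := by
    have := Real.log_le_sub_one_of_pos (two_pos : (0 : ℝ) < 2)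
    linarith
  rw [abs_le]
  constructor <;> linarith

lemma log_le_two_mul_sqrt {x : ℝ} (hx : 0 < x) : Real.log x ≤ 2 * √x := by
  have h := Real.log_le_sub_one_of_pos (Real.sqrt_pos.2 hx)
  rw [Real.log_sqrt hx.le] at h
  linarith

/-- This bounds what governs the loss at the zeros of the denominator. Up to constants `log d` is at
most `log(γβ) - log β`, and `-β log β ≤ 1`, so `β log d` is `O(log(γβ) + 1)`. For the other term,
`log d` is `O(√γ)` and `√γ` is at most twice the truncation plus one. -/
lemma mul_natLog_le {γ β c : ℝ} {d : ℕ} (hc : 0 < c) (hd : 1 ≤ d) (hγ : c * d ≤ γ) (hγ1 : 1 ≤ γ)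
    (hβ : 0 < β) (hβ1 : β < 1) (hy : 1 ≤ Real.log (Real.log (γ * β)))
    (hy1 : 2 ≤ Real.log (γ * β)) :
    (β + 3 / (truncation γ β + 1)) * ((Nat.log 2 d + 1 : ℕ) : ℝ) ≤
      (100 + 20 * |Real.log c|) * Real.log (γ * β) := by
  have hγ0 : 0 < γ := by linarith
  have hy0 : 0 < γ * β := by positivity
  have hd0 : (0 : ℝ) < d := by exact_mod_cast hd
  set l := Real.log (γ * β) with hl
  have hll : Real.log l ≤ l := (Real.log_le_sub_one_of_pos (by linarith)).trans (by linarith)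
  have hlog : l = Real.log γ + Real.log β := Real.log_mul hγ0.ne' hβ.ne'
  have hlogβ : Real.log β ≤ 0 := Real.log_nonpos hβ.le hβ1.le
  have hlogβ' : -Real.log β * β ≤ 1 := by
    have := Real.log_le_sub_one_of_pos (inv_pos.2 hβ)
    rw [Real.log_inv] at this
    calc -Real.log β * β ≤ β⁻¹ * β := by
          gcongr
          linarith
      _ = 1 := inv_mul_cancel₀ hβ.ne'
  have hlogd : Real.log d ≤ Real.log γ + |Real.log c| := by
    have := Real.log_le_log (by positivity) hγ
    rw [Real.log_mul hc.ne' hd0.ne'] at this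
    have := neg_abs_le (Real.log c)
    linarith
  have hL : ((Nat.log 2 d + 1 : ℕ) : ℝ) ≤ 2 * Real.log d + 1 := by
    have h1 : (2 : ℝ) ^ Nat.log 2 d ≤ d := by exact_mod_cast Nat.pow_log_le_self 2 (by omega)
    have h2 := Real.log_le_log (by positivity) h1
    rw [Real.log_pow] at h2
    have h3 := Real.log_two_gt_d9
    have h4 : (0 : ℝ) ≤ Nat.log 2 d := Nat.cast_nonneg _
    push_cast
    nlinarith
  have hK : γ / Real.log l < truncation γ β + 1 := Nat.lt_floor_add_one _
  set κ : ℝ := (truncation γ β : ℝ) + 1 with hκdef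
  set L : ℝ := ((Nat.log 2 d + 1 : ℕ) : ℝ)
  set A := |Real.log c|
  have hA : 0 ≤ A := abs_nonneg _
  have hκ : γ / l ≤ κ := (div_le_div_of_nonneg_left hγ0.le (by linarith) hll).trans hK.le
  have hκ0 : 0 < κ := lt_of_lt_of_le (by positivity) hκ
  have h1 : β * L ≤ 2 * l + 2 * A + 3 := by
    calc β * L ≤ β * (2 * (l - Real.log β + A) + 1) := by
          gcongr
          linarith
      _ = 2 * (β * l) + 2 * (-Real.log β * β) + 2 * (β * A) + β := by ring
      _ ≤ 2 * (1 * l) + 2 * 1 + 2 * (1 * A) + 1 := by gcongr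
      _ = _ := by ring
  have h2 : L ≤ (8 + 4 * A + 2) * κ := by
    have hsγ : 1 ≤ √γ := Real.one_le_sqrt.2 hγ1
    have hsq : √γ * √γ = γ := Real.mul_self_sqrt hγ0.le
    have h3 := log_le_two_mul_sqrt hγ0
    have h4 : L ≤ (4 + 2 * A + 1) * √γ := by nlinarith
    have h5 : l ≤ 2 * √γ := by linarith
    have h6 : γ ≤ κ * l := by rwa [div_le_iff₀ (by linarith)] at hκ
    have h7 : √γ ≤ 2 * κ := by
      have h8 : √γ * √γ ≤ 2 * κ * √γ := by
        rw [hsq]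
        nlinarith
      exact le_of_mul_le_mul_right h8 (by linarith)
    nlinarith
  have h3 : 3 / κ * L ≤ 3 * (8 + 4 * A + 2) := by
    rw [div_mul_eq_mul_div, div_le_iff₀ hκ0]
    linarith
  rw [add_mul]
  nlinarith

variable {d : ℕ → ℕ} {γ β : ℕ → ℝ} {c C : ℝ}

/-- The growth of `log log(γβ)` is used precisely here: it makes `r K` negligible against `d` for
every fixed number `r` of points. -/
lemma tendsto_truncation_div (hd : Tendsto d atTop atTop)
    (hγ : ∀ᶠ n in atTop, γ n ≤ C * d n) (hC : 0 ≤ C)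
    (hy : Tendsto (fun n => γ n * β n) atTop atTop) :
    Tendsto (fun n => (truncation (γ n) (β n) : ℝ) / d n) atTop (𝓝 0) := by
  have hll : Tendsto (fun n => Real.log (Real.log (γ n * β n))) atTop atTop :=
    Real.tendsto_log_atTop.comp (Real.tendsto_log_atTop.comp hy)
  refine squeeze_zero' (.of_forall fun n => by positivity) ?_ (hll.const_div_atTop C)
  filter_upwards [hγ, hll.eventually_ge_atTop 1, hd.eventually_ge_atTop 1] with n h1 h2 h3
  have hd0 : (0 : ℝ) < d n := by exact_mod_cast h3
  rw [div_le_iff₀ hd0]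
  set l := Real.log (Real.log (γ n * β n))
  have h4 : (truncation (γ n) (β n) : ℝ) ≤ C * d n / l := by
    refine (Nat.cast_le.2 (Nat.floor_le_floor (by gcongr : γ n / l ≤ C * d n / l))).trans
      (Nat.floor_le (by positivity))
  exact h4.trans_eq (by ring)

lemma eventually_le_logs (hy : Tendsto (fun n => γ n * β n) atTop atTop) :
    ∀ᶠ n in atTop, 1 ≤ Real.log (Real.log (γ n * β n)) ∧
      2 * Real.log (γ n * β n) ≤ γ n * β n ∧ 2 ≤ Real.log (γ n * β n) := by
  have hl : Tendsto (fun n => Real.log (γ n * β n)) atTop atTop := Real.tendsto_log_atTop.comp hy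
  have hlo : ∀ᶠ y : ℝ in atTop, 2 * Real.log y ≤ y := by
    filter_upwards [Real.isLittleO_log_id_atTop.bound (by norm_num : (0 : ℝ) < 1 / 2),
      eventually_ge_atTop 1] with y h1 h2
    rw [id, Real.norm_of_nonneg (Real.log_nonneg h2), Real.norm_of_nonneg (by linarith)] at h1
    linarith
  filter_upwards [(Real.tendsto_log_atTop.comp hl).eventually_ge_atTop 1, hy.eventually hlo,
    hl.eventually_ge_atTop 2] with n h1 h2 h3
  exact ⟨h1, h2, h3⟩

/-- The variance of the weighted sum over closed points. -/
lemma tendsto_sum_curveWeight_sq_div (F : Type*) [Field F] [Finite F] (s : ℤˣ) {H : ℕ → F[X]}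
    (hd : Tendsto d atTop atTop) (hH : ∀ᶠ n in atTop, H n ≠ 0 ∧ (H n).natDegree ≤ d n)
    (hc : 0 < c) (hγ : ∀ᶠ n in atTop, c * d n ≤ γ n) (hβ : ∀ n, 0 < β n ∧ β n < 1) {c' : ℝ}
    (hc' : 0 < c') (hs : ∀ᶠ n in atTop, c' * β n ≤ Real.sin (Real.pi * β n))
    (hy : Tendsto (fun n => γ n * β n) atTop atTop) :
    Tendsto (fun n => (∑ P ∈ openPoints (H n) (truncation (γ n) (β n)),
      curveWeight F s (β n) (truncation (γ n) (β n)) P.1.natDegree ^ 2) /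
      (2 / Real.pi ^ 2 * Real.log (γ n * β n))) atTop (𝓝 1) := by
  obtain ⟨B, hB⟩ := exists_abs_sum_curveWeight_sq_sub_le F hc'
  set l : ℕ → ℝ := fun n => Real.log (γ n * β n) with hl
  have hltop : Tendsto l atTop atTop := Real.tendsto_log_atTop.comp hy
  set A : ℝ := 100 + 20 * |Real.log c| with hA
  have hA0 : 0 ≤ A := by positivity
  have hpi := Real.pi_pos
  -- The relative error as a function of `x = log(γβ)`: a bounded term, the loss at zeros of the
  -- denominator, of order `√x`, and the discrepancy between the logarithms of `Kβ` and `γβ`, of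
  -- order `log x`.
  set E : ℝ → ℝ := fun x => (B / x + 128 * √A * (√x / x)) / (2 / Real.pi ^ 2) +
    (Real.log x / x + 1 / x) with hE
  have hElim : Tendsto E atTop (𝓝 0) := by
    have h1 : Tendsto (fun x : ℝ => B / x) atTop (𝓝 0) := tendsto_id.const_div_atTop B
    have h2 : Tendsto (fun x : ℝ => √x / x) atTop (𝓝 0) := by
      simp_rw [Real.sqrt_div_self]
      exact Real.tendsto_sqrt_atTop.inv_tendsto_atTop
    have h3 : Tendsto (fun x : ℝ => Real.log x / x) atTop (𝓝 0) := by
      simpa using Real.isLittleO_log_id_atTop.tendsto_div_nhds_zero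
    have h4 : Tendsto (fun x : ℝ => 1 / x) atTop (𝓝 0) := tendsto_id.const_div_atTop 1
    have := ((h1.add (h2.const_mul (128 * √A))).div_const (2 / Real.pi ^ 2)).add (h3.add h4)
    simpa [hE] using this
  have hlim := hElim.comp hltop
  rw [tendsto_iff_norm_sub_tendsto_zero]
  refine squeeze_zero' (.of_forall fun n => norm_nonneg _) ?_ hlim
  have hdtop : Tendsto (fun n => c * (d n : ℝ)) atTop atTop :=
    (tendsto_natCast_atTop_atTop.comp hd).const_mul_atTop hc
  filter_upwards [eventually_le_logs hy, hγ, hH, hd.eventually_ge_atTop 1,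
    hdtop.eventually_ge_atTop 1, hs] with n h1 h2 h3 h4 h5 h6
  obtain ⟨b1, b2⟩ := truncation_mul_bounds (hβ n).1 (hβ n).2 h1.1 h1.2.1 h1.2.2
  have b3 := mul_natLog_le hc h4 h2 (h5.trans h2) (hβ n).1 (hβ n).2 h1.1 h1.2.2
  have b4 : (H n).natDegree ≤ Nat.card F ^ (Nat.log 2 (d n) + 1) := by
    refine h3.2.trans ((Nat.lt_pow_succ_log_self one_lt_two (d n)).le.trans ?_)
    exact Nat.pow_le_pow_left Finite.one_lt_card _
  have b5 := hB s (β n) (truncation (γ n) (β n)) (Nat.log 2 (d n) + 1) (H n) (hβ n).1 (hβ n).2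
    h6 b1 h3.1 b4
  set K := truncation (γ n) (β n)
  set V := ∑ P ∈ openPoints (H n) K, curveWeight F s (β n) K P.1.natDegree ^ 2
  have b6 : √((β n + 3 / (K + 1)) * ((Nat.log 2 (d n) + 1 : ℕ) : ℝ)) ≤ √A * √(l n) := by
    rw [← Real.sqrt_mul hA0]
    exact Real.sqrt_le_sqrt b3
  have hl0 : 0 < l n := by linarith [h1.2.2]
  set w := 2 / Real.pi ^ 2 with hw
  have hw0 : 0 < w := by positivity
  rw [Real.norm_eq_abs, Function.comp, show V / (w * l n) - 1 =
    ((V - w * Real.log (K * β n)) / w + (Real.log (K * β n) - l n)) / l n by field_simp; ring,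
    abs_div, abs_of_pos hl0, div_le_iff₀ hl0]
  calc _ ≤ |(V - w * Real.log (K * β n)) / w| + |Real.log (K * β n) - l n| := abs_add_le _ _
    _ ≤ (B + 128 * (√A * √(l n))) / w + (Real.log (l n) + 1) := by
      rw [abs_div, abs_of_pos hw0]
      gcongr
      exact b5.trans (by gcongr)
    _ = _ := by
      simp only [hE]
      field_simp

end Asymptotics

/-! ### The central limit theorem with a fixed denominator for each `n`. -/

section Core

/-- In powers of `√q`, the factors `4^w` and the two powers `q^{rK}` cost at most `4w + 4rK`,
eventually bounded by `4A + d`, against the `2d` of the denominator; a decay by `d` remains. -/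
lemma tendsto_independence_error (F : Type*) [Field F] [Finite F] {d K w N : ℕ → ℕ} (r A : ℕ)
    (hd : Tendsto d atTop atTop) (hK : Tendsto (fun n => (K n : ℝ) / d n) atTop (𝓝 0))
    (hw : ∀ᶠ n in atTop, 8 * w n ≤ 8 * A + d n) (hN : ∀ n, N n ≤ 2 * Nat.card F ^ K n) :
    Tendsto (fun n => 8 * (4 : ℝ) ^ w n * (Nat.card F : ℝ) ^ (r * K n) / (Nat.card F : ℝ) ^ d n *
      (max 1 (N n : ℝ)) ^ r) atTop (𝓝 0) := by
  have hq := two_le_natCard (F := F)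
  have ht := one_lt_sqrt_natCard F
  have hsq := sq_sqrt_natCard F
  set q : ℝ := (Nat.card F : ℝ) with hqdef
  set t := √q
  have hlim : Tendsto (fun n => 8 * 2 ^ r * t ^ (4 * A) * (t ^ d n)⁻¹) atTop (𝓝 0) := by
    have h1 : Tendsto (fun n => t ^ d n) atTop atTop := (tendsto_pow_atTop_atTop_of_one_lt ht).comp hd
    simpa using h1.inv_tendsto_atTop.const_mul (8 * 2 ^ r * t ^ (4 * A))
  refine squeeze_zero' (.of_forall fun n => by positivity) ?_ hlim
  have hKd : ∀ᶠ n in atTop, 8 * r * K n ≤ d n := by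
    have h1 := hK.eventually (gt_mem_nhds (by positivity : (0 : ℝ) < 1 / (8 * r + 1)))
    filter_upwards [h1, hd.eventually_ge_atTop 1] with n h2 h3
    have hd0 : (0 : ℝ) < d n := by exact_mod_cast h3
    rw [div_lt_div_iff₀ hd0 (by positivity)] at h2
    have h4 : (8 * r * K n : ℝ) ≤ d n := by nlinarith [(Nat.cast_nonneg (K n) : (0 : ℝ) ≤ K n)]
    exact_mod_cast h4
  filter_upwards [hw, hKd] with n h1 h2
  have h3 : max 1 (N n : ℝ) ≤ 2 * q ^ K n := by
    refine max_le ?_ (by rw [hqdef]; exact_mod_cast hN n)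
    have : 1 ≤ q ^ K n := one_le_pow₀ (by linarith)
    linarith
  have h4 : (4 : ℝ) ≤ t ^ 4 := by
    rw [show 4 = 2 * 2 from rfl, pow_mul, hsq]
    nlinarith
  calc _ ≤ 8 * (t ^ 4) ^ w n * q ^ (r * K n) / q ^ d n * (2 * q ^ K n) ^ r := by gcongr
    _ = 8 * 2 ^ r * (t ^ (4 * w n + 4 * r * K n) / t ^ (2 * d n)) := by
      rw [← hsq, mul_pow]
      simp only [← pow_mul, pow_add]
      rw [show 4 * r * K n = 2 * (r * K n) + 2 * (K n * r) by ring, pow_add,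
        show 2 * K n * r = 2 * (K n * r) by ring]
      ring
    _ ≤ 8 * 2 ^ r * (t ^ (4 * A + d n) / t ^ (2 * d n)) := by
      have : 8 * r * K n = 2 * (4 * r * K n) := by ring
      exact mul_le_mul_of_nonneg_left (div_le_div_of_nonneg_right
        (pow_le_pow_right₀ ht.le (by omega)) (by positivity)) (by positivity)
    _ = _ := by
      rw [pow_add, two_mul, pow_add]
      field_simp

lemma four_mul_pow_card_monicIrrDivisors_le {F : Type*} [Field F] [Finite F] {H : F[X]} {d : ℕ}
    (hH : H ≠ 0) (hHd : H.natDegree ≤ d) (hd : 4 * Nat.card F ^ 8 + 4 ≤ d) :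
    4 * (4 : ℝ) ^ (monicIrrDivisors H).card ≤ (Nat.card F : ℝ) ^ d := by
  have hq := two_le_natCard (F := F)
  have h1 := mul_card_monicIrrDivisors_le hH 8
  have h4 : (4 : ℝ) ≤ (Nat.card F : ℝ) ^ 2 := by nlinarith
  calc 4 * (4 : ℝ) ^ (monicIrrDivisors H).card = 4 ^ ((monicIrrDivisors H).card + 1) := by ring
    _ ≤ ((Nat.card F : ℝ) ^ 2) ^ ((monicIrrDivisors H).card + 1) := by gcongr
    _ = (Nat.card F : ℝ) ^ (2 * ((monicIrrDivisors H).card + 1)) := by rw [pow_mul]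
    _ ≤ _ := by
      gcongr
      · linarith
      · omega

variable (p : ℕ) [Fact p.Prime] {F : Type*} [Field F] [Finite F] [CharP F p] [Algebra (ZMod p) F]

/-- The central limit theorem for the numerators of fractions with given denominators. -/
theorem tendsto_card_coprimePolys_filter (hp : p ≠ 2) (s : ℤˣ) {d : ℕ → ℕ} {γ β : ℕ → ℝ}
    {c C c' : ℝ} {h : ℕ → MvPolynomial (Fin 2) F} (hd : Tendsto d atTop atTop)
    (hh : ∀ᶠ n in atTop, (h n).IsHomogeneous (d n) ∧ h n ≠ 0)
    (hc : 0 < c) (hC : 0 ≤ C) (hγ : ∀ᶠ n in atTop, c * d n ≤ γ n ∧ γ n ≤ C * d n)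
    (hβ : ∀ n, 0 < β n ∧ β n < 1)
    (hc' : 0 < c') (hs : ∀ᶠ n in atTop, c' * β n ≤ Real.sin (Real.pi * β n))
    (hy : Tendsto (fun n => γ n * β n) atTop atTop) (t : ℝ) :
    Tendsto (fun n => (((coprimePolys (d n) (dehomogenize (h n))).filter fun G =>
      normalizedSum p s (β n) (γ n) (G.homogenize (d n), h n) ≤ t).card : ℝ) /
      (coprimePolys (d n) (dehomogenize (h n))).card) atTop
      (𝓝 ((gaussianReal 0 1).real (Set.Iic t))) := by
  have hp2 : 2 ≤ p := (Fact.out : p.Prime).two_le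
  have hp1 : (0 : ℝ) < p - 1 := by
    have : (2 : ℝ) ≤ p := by exact_mod_cast hp2
    linarith
  have : NeZero p := ⟨by omega⟩
  have hpi := Real.pi_pos
  set H : ℕ → F[X] := fun n => dehomogenize (h n) with hHdef
  set K : ℕ → ℕ := fun n => truncation (γ n) (β n) with hKdef
  have hH : ∀ᶠ n in atTop, H n ≠ 0 ∧ (H n).natDegree ≤ d n := by
    filter_upwards [hh] with n hn
    exact ⟨fun h' => hn.2 (dehomogenize_eq_zero hn.1 h'), natDegree_dehomogenize_le hn.1⟩
  have hV := tendsto_sum_curveWeight_sq_div F s hd hH hc (hγ.mono fun _ h => h.1) hβ hc' hs hy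
  have hKd := tendsto_truncation_div hd (hγ.mono fun _ h => h.2) hC hy
  obtain ⟨B, hB⟩ := exists_abs_curveSum_sub_le p F hp
  set l : ℕ → ℝ := fun n => Real.log (γ n * β n) with hl
  have hltop : Tendsto l atTop atTop := Real.tendsto_log_atTop.comp hy
  set σ : ℕ → ℝ := fun n => √(2 * ((p : ℝ) - 1) / Real.pi ^ 2 * l n) with hσ
  have hσtop : Tendsto σ atTop atTop :=
    Real.tendsto_sqrt_atTop.comp (hltop.const_mul_atTop (by positivity))
  have hw : ∀ᶠ n in atTop, 8 * (monicIrrDivisors (H n)).card ≤ 8 * Nat.card F ^ 8 + d n := by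
    filter_upwards [hH] with n hn
    exact (mul_card_monicIrrDivisors_le hn.1 8).trans (by gcongr; exact hn.2)
  have hind : ∀ᶠ n in atTop, H n ≠ 0 ∧
      4 * (4 : ℝ) ^ (monicIrrDivisors (H n)).card ≤ (Nat.card F : ℝ) ^ d n := by
    filter_upwards [hH, hd.eventually_ge_atTop (4 * Nat.card F ^ 8 + 4)] with n h1 h2
    exact ⟨h1.1, four_mul_pow_card_monicIrrDivisors_le h1.1 h1.2 h2⟩
  refine tendsto_card_filter_of_almost_indep p hp2 (fun n => coprimePolys (d n) (H n))
    (ι := fun n => openPoints (H n) (K n)) (fun n P G => localTrace p (H n) P.1 G = 0)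
    (fun n P => curveWeight F s (β n) (K n) P.1.1.natDegree / σ n)
    (fun n G => normalizedSum p s (β n) (γ n) (G.homogenize (d n), h n))
    (fun n => B / σ n) (fun n => 12 / σ n) ?_ ?_ (hσtop.const_div_atTop _) ?_
    (hσtop.const_div_atTop _) ?_ ?_ t
  · filter_upwards [hind] with n hn
    exact (abs_jointProb_coprimePolys_sub_le p (d n) hn.1 hn.2).1
  · refine hV.congr' ?_
    filter_upwards [hltop.eventually_ge_atTop 1] with n hn
    change (∑ P ∈ openPoints (H n) (K n), curveWeight F s (β n) (K n) P.1.natDegree ^ 2) /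
      (2 / Real.pi ^ 2 * l n) = _
    have hσ2 : σ n ^ 2 = 2 * ((p : ℝ) - 1) / Real.pi ^ 2 * l n :=
      Real.sq_sqrt (mul_nonneg (by positivity) (by linarith))
    simp_rw [div_pow]
    rw [← Finset.sum_div, Finset.sum_coe_sort (openPoints (H n) (K n))
      (fun P => curveWeight F s (β n) (K n) P.1.natDegree ^ 2), hσ2]
    have : l n ≠ 0 := by linarith
    field_simp
  · filter_upwards [hσtop.eventually_gt_atTop 0] with n hn P
    rw [abs_div, abs_of_pos hn]
    gcongr
    exact abs_curveWeight_le P.1.natDegree_pos.ne' (mem_openPoints.1 P.2).1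
  · filter_upwards [hσtop.eventually_gt_atTop 0, hh] with n hn hhn G hG
    have hGd : G.natDegree ≤ d n := by
      rw [mem_coprimePolys] at hG
      exact natDegree_le_iff_coeff_eq_zero.2 fun N hN => (degree_lt_iff_coeff_zero _ _).1 hG.1 N hN
    have h1 := hB s (β n) (K n) (d n) (G.homogenize (d n)) (h n) (isHomogeneous_homogenize _) hhn.1
    rw [sum_curveWeight_mul_closedPointSum, dehomogenize_homogenize hGd] at h1
    have e : ∑ P : openPoints (H n) (K n), curveWeight F s (β n) (K n) P.1.1.natDegree / σ n *
        centered p (localTrace p (H n) P.1 G = 0) =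
        (∑ P ∈ openPoints (H n) (K n), curveWeight F s (β n) (K n) P.1.natDegree *
        centered p (localTrace p (H n) P G = 0)) / σ n := by
      rw [Finset.sum_div]
      refine (Finset.sum_congr rfl fun P _ => ?_).trans (Finset.sum_coe_sort (openPoints (H n) (K n))
        fun P => curveWeight F s (β n) (K n) P.1.natDegree *
          centered p (localTrace p (H n) P G = 0) / σ n)
      ring
    rw [e, normalizedSum, ← sub_div, abs_div, abs_of_pos (show 0 < √(2 * ((p : ℝ) - 1) /
      Real.pi ^ 2 * Real.log (γ n * β n)) from hn)]
    exact div_le_div_of_nonneg_right h1 hn.le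
  · intro r
    refine ⟨fun n => 8 * (4 : ℝ) ^ (monicIrrDivisors (H n)).card *
      (Nat.card F : ℝ) ^ (r * K n) / (Nat.card F : ℝ) ^ d n, ?_, ?_⟩
    · filter_upwards [hind] with n hn A hA
      exact (abs_jointProb_coprimePolys_sub_le p (d n) hn.1 hn.2).2 (openPoints (H n) (K n)) (K n) r
        (fun P hP => (mem_openPoints.1 hP).symm) A hA
    · refine tendsto_independence_error F r (Nat.card F ^ 8) hd hKd hw
        (N := fun n => Fintype.card (openPoints (H n) (K n))) fun n => ?_
      rw [Fintype.card_coe]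
      exact card_openPoints_le _ _

end Core

/-! ### From single denominators to families. -/

section Families

variable {F : Type*} [Field F] [Finite F]

lemma finite_setOf_isHomogeneous (F : Type*) [Field F] [Finite F] (d : ℕ) :
    {h : MvPolynomial (Fin 2) F | h.IsHomogeneous d}.Finite := by
  refine Set.Finite.of_injOn (f := dehomogenize) (t := (polysLT F (d + 1) : Set F[X])) ?_ ?_
    (Finset.finite_toSet _)
  · intro h hh
    rw [Finset.mem_coe, mem_polysLT]
    refine degree_le_natDegree.trans_lt ?_
    exact_mod_cast Nat.lt_succ_of_le (natDegree_dehomogenize_le hh)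
  · intro g hg h hh hgh
    rw [← homogenize_dehomogenize hg, ← homogenize_dehomogenize hh, hgh]

open Classical in
/-- The nonzero forms of degree `d` with the property `Q`. -/
noncomputable def denominators (d : ℕ) (Q : MvPolynomial (Fin 2) F → Prop) :
    Finset (MvPolynomial (Fin 2) F) :=
  (finite_setOf_isHomogeneous F d).toFinset.filter fun h => h ≠ 0 ∧ Q h

lemma mem_denominators {d : ℕ} {Q : MvPolynomial (Fin 2) F → Prop} {h : MvPolynomial (Fin 2) F} :
    h ∈ denominators d Q ↔ h.IsHomogeneous d ∧ h ≠ 0 ∧ Q h := by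
  simp [denominators]

omit [Finite F] in
-- A numerator coprime to zero is a unit, and a unit cannot be homogeneous of positive degree.
lemma ne_zero_of_mem_fullFamily {d : ℕ} (hd : d ≠ 0) {f : Pairs F} (hf : f ∈ fullFamily F d) :
    f.2 ≠ 0 := by
  intro h0
  have h1 : IsRelPrime f.1 f.2 := hf.2.2
  rw [h0, isRelPrime_zero_right] at h1
  have h2 := (MvPolynomial.isUnit_iff_totalDegree_of_isReduced.1 h1).2
  rw [hf.1.totalDegree h1.ne_zero] at h2
  exact hd h2

open Classical in
/-- Counting pairs denominator by denominator. -/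
lemma ncard_fullFamily_filter {d : ℕ} (hd : d ≠ 0) (Q : MvPolynomial (Fin 2) F → Prop)
    (R : Pairs F → Prop) :
    {f ∈ {f | f ∈ fullFamily F d ∧ Q f.2} | R f}.ncard =
      ∑ h ∈ denominators d Q,
        ((coprimePolys d (dehomogenize h)).filter fun G => R (G.homogenize d, h)).card := by
  have hdeg : ∀ {H G : F[X]}, G ∈ coprimePolys d H → G.natDegree ≤ d := fun hG =>
    natDegree_le_iff_coeff_eq_zero.2 fun N hN =>
      (degree_lt_iff_coeff_zero _ _).1 (mem_coprimePolys.1 hG).1 N hN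
  rw [← Finset.card_sigma]
  set S := (denominators d Q).sigma fun h =>
    (coprimePolys d (dehomogenize h)).filter fun G => R (G.homogenize d, h) with hS
  have himage : {f ∈ {f | f ∈ fullFamily F d ∧ Q f.2} | R f} =
      ((S.image fun x => ((x.2.homogenize d, x.1) : Pairs F) : Finset (Pairs F)) : Set (Pairs F)) := by
    ext ⟨g, h⟩
    simp only [Set.mem_ofPred_eq, Finset.coe_image, Set.mem_image, Finset.mem_coe, hS,
      Finset.mem_sigma, Finset.mem_filter, mem_denominators, Prod.mk.injEq, Sigma.exists]
    constructor
    · rintro ⟨⟨hf, hQ⟩, hR⟩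
      have h0 : h ≠ 0 := ne_zero_of_mem_fullFamily hd hf
      refine ⟨h, dehomogenize g, ⟨⟨hf.2.1, h0, hQ⟩,
        (isRelPrime_iff_mem_coprimePolys hf.1 hf.2.1 h0).1 hf.2.2, ?_⟩, ?_, rfl⟩
      · rwa [homogenize_dehomogenize hf.1]
      · exact homogenize_dehomogenize hf.1
    · rintro ⟨h', G, ⟨⟨hh, h0, hQ⟩, hG, hR⟩, rfl, rfl⟩
      refine ⟨⟨⟨isHomogeneous_homogenize _, hh, ?_⟩, hQ⟩, hR⟩
      rw [isRelPrime_iff_mem_coprimePolys (isHomogeneous_homogenize _) hh h0,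
        dehomogenize_homogenize (hdeg hG)]
      exact hG
  rw [himage, Set.ncard_coe_finset, Finset.card_image_of_injOn]
  rintro ⟨h, G⟩ hx ⟨h', G'⟩ hx' heq
  simp only [Prod.mk.injEq] at heq
  obtain ⟨h1, rfl⟩ := heq
  rw [hS, Finset.mem_coe, Finset.mem_sigma, Finset.mem_filter] at hx hx'
  have h2 := congrArg dehomogenize h1
  rw [dehomogenize_homogenize (hdeg hx.2.1), dehomogenize_homogenize (hdeg hx'.2.1)] at h2
  rw [show G = G' from h2]

/-- A quotient of sums is a weighted mean of the quotients, so a bound valid on every fibre survives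
averaging, whatever the fibre sizes. -/
lemma abs_div_sub_le_of_forall {ι : Type*} (S : Finset ι) (a b : ι → ℝ) {x ε : ℝ}
    (hb : ∀ i ∈ S, 0 < b i) (hS : S.Nonempty) (h : ∀ i ∈ S, |a i / b i - x| ≤ ε) :
    |(∑ i ∈ S, a i) / ∑ i ∈ S, b i - x| ≤ ε := by
  have hpos : 0 < ∑ i ∈ S, b i := Finset.sum_pos hb hS
  rw [div_sub' hpos.ne', abs_div, abs_of_pos hpos, div_le_iff₀ hpos, mul_comm _ x, Finset.mul_sum,
    ← Finset.sum_sub_distrib, Finset.mul_sum]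
  refine (Finset.abs_sum_le_sum_abs _ _).trans (Finset.sum_le_sum fun i hi => ?_)
  have h1 := h i hi
  rw [div_sub' (hb i hi).ne', abs_div, abs_of_pos (hb i hi), div_le_iff₀ (hb i hi),
    mul_comm _ x] at h1
  exact h1

variable (p : ℕ) [Fact p.Prime] [CharP F p] [Algebra (ZMod p) F]

/-- The central limit theorem for families of pairs defined by a condition on the denominator. -/
theorem hasStandardGaussianLimit_of_denominators (hp : p ≠ 2) (s : ℤˣ) {d : ℕ → ℕ} {β : ℕ → ℝ}
    {c C c' : ℝ} (Q : ℕ → MvPolynomial (Fin 2) F → Prop)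
    (Γ : ℕ → MvPolynomial (Fin 2) F → ℝ) (hd : Tendsto d atTop atTop)
    (hne : ∀ᶠ n in atTop, (denominators (d n) (Q n)).Nonempty)
    (hc : 0 < c) (hC : 0 ≤ C)
    (hΓ : ∀ᶠ n in atTop, ∀ h : MvPolynomial (Fin 2) F, h.IsHomogeneous (d n) → h ≠ 0 →
      c * d n ≤ Γ n h ∧ Γ n h ≤ C * d n)
    (hβ : ∀ n, 0 < β n ∧ β n < 1)
    (hc' : 0 < c') (hs : ∀ᶠ n in atTop, c' * β n ≤ Real.sin (Real.pi * β n))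
    (hdβ : Tendsto (fun n => d n * β n) atTop atTop) :
    HasStandardGaussianLimit (fun n => {f | f ∈ fullFamily F (d n) ∧ Q n f.2})
      (fun n f => normalizedSum p s (β n) (Γ n f.2) f) := by
  classical
  intro t
  set Φ := (gaussianReal 0 1).real (Set.Iic t)
  set R : ℕ → MvPolynomial (Fin 2) F → ℝ := fun n h =>
    (((coprimePolys (d n) (dehomogenize h)).filter fun G =>
      normalizedSum p s (β n) (Γ n h) (G.homogenize (d n), h) ≤ t).card : ℝ) /
      (coprimePolys (d n) (dehomogenize h)).card with hR
  have key : ∀ ε > 0, ∀ᶠ n in atTop, ∀ h : MvPolynomial (Fin 2) F, h.IsHomogeneous (d n) → h ≠ 0 →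
      |R n h - Φ| ≤ ε := by
    intro ε hε
    -- Uniformity over denominators: for each `n` a violating denominator is chosen whenever there
    -- is one. The limit along this worst sequence shows that eventually there is none.
    have hchoose : ∀ n, ∃ h : MvPolynomial (Fin 2) F, (h.IsHomogeneous (d n) ∧ h ≠ 0) ∧
        (|R n h - Φ| ≤ ε → ∀ h : MvPolynomial (Fin 2) F, h.IsHomogeneous (d n) → h ≠ 0 →
          |R n h - Φ| ≤ ε) := by
      intro n
      by_cases hall : ∀ h : MvPolynomial (Fin 2) F, h.IsHomogeneous (d n) → h ≠ 0 →
          |R n h - Φ| ≤ ε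
      · refine ⟨MvPolynomial.X 0 ^ d n, ⟨?_, pow_ne_zero _ (MvPolynomial.X_ne_zero 0)⟩,
          fun _ => hall⟩
        simpa using (MvPolynomial.isHomogeneous_X F (0 : Fin 2)).pow (d n)
      · push Not at hall
        obtain ⟨h, hh, h0, hbad⟩ := hall
        exact ⟨h, ⟨hh, h0⟩, fun h' => absurd h' hbad.not_ge⟩
    choose h hh hbad using hchoose
    have hγ : ∀ᶠ n in atTop, c * d n ≤ Γ n (h n) ∧ Γ n (h n) ≤ C * d n :=
      hΓ.mono fun n hn => hn (h n) (hh n).1 (hh n).2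
    have hy : Tendsto (fun n => Γ n (h n) * β n) atTop atTop := by
      refine tendsto_atTop_mono' _ ?_ (hdβ.const_mul_atTop hc)
      filter_upwards [hγ] with n hn
      rw [← mul_assoc]
      exact mul_le_mul_of_nonneg_right hn.1 (hβ n).1.le
    have hlim := tendsto_card_coprimePolys_filter p hp s hd (.of_forall hh) hc hC hγ hβ hc' hs hy t
    have h1 := (tendsto_iff_norm_sub_tendsto_zero.1 hlim).eventually (ge_mem_nhds hε)
    filter_upwards [h1] with n hn
    exact hbad n hn
  rw [Metric.tendsto_nhds]
  intro ε hε
  filter_upwards [key (ε / 2) (half_pos hε), hne, hd.eventually_ge_atTop (4 * Nat.card F ^ 8 + 4)]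
    with n h1 h2 h3
  have hd0 : d n ≠ 0 := by omega
  have e1 : {f | f ∈ fullFamily F (d n) ∧ Q n f.2}.ncard =
      ∑ h ∈ denominators (d n) (Q n), (coprimePolys (d n) (dehomogenize h)).card := by
    have := ncard_fullFamily_filter hd0 (Q n) (fun _ => True)
    simpa only [Set.mem_ofPred_eq, and_true, Finset.filter_true] using this
  have e2 := ncard_fullFamily_filter hd0 (Q n)
    (fun f => normalizedSum p s (β n) (Γ n f.2) f ≤ t)
  rw [Real.dist_eq]
  refine lt_of_le_of_lt ?_ (half_lt_self hε)
  change |(({f ∈ {f | f ∈ fullFamily F (d n) ∧ Q n f.2} |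
    normalizedSum p s (β n) (Γ n f.2) f ≤ t}.ncard : ℕ) : ℝ) /
    (({f | f ∈ fullFamily F (d n) ∧ Q n f.2}.ncard : ℕ) : ℝ) - Φ| ≤ ε / 2
  rw [e1, e2, Nat.cast_sum, Nat.cast_sum]
  refine abs_div_sub_le_of_forall _ _ _ (fun h hh => ?_) h2 fun h hh => ?_
  · rw [mem_denominators] at hh
    have hH0 : dehomogenize h ≠ 0 := fun h' => hh.2.1 (dehomogenize_eq_zero hh.1 h')
    exact Nat.cast_pos.2 (Finset.card_pos.2 (abs_jointProb_coprimePolys_sub_le p (d n) hH0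
      (four_mul_pow_card_monicIrrDivisors_le hH0 (natDegree_dehomogenize_le hh.1) h3)).1)
  · rw [mem_denominators] at hh
    convert h1 h hh.1 hh.2.1 using 5

end Families

/-! ### Interval lengths, degrees and genera. -/

section Lengths

/-- A constant length is its own case, with `c = sin(πb) / b`; lengths tending to zero are
eventually at most `1/2`, where Jordan's inequality gives `c = 2`. -/
lemma AdmissibleLengths.exists_mul_le_sin {γ β : ℕ → ℝ} (h : AdmissibleLengths γ β) :
    ∃ c > 0, ∀ᶠ n in atTop, c * β n ≤ Real.sin (Real.pi * β n) := by
  obtain ⟨-, hβ, ⟨b, hb⟩ | ⟨h0, -⟩⟩ := h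
  · have hb' := hβ 0
    rw [hb] at hb'
    have hs : 0 < Real.sin (Real.pi * b) :=
      Real.sin_pos_of_pos_of_lt_pi (mul_pos Real.pi_pos hb'.1) (by nlinarith [Real.pi_pos])
    refine ⟨Real.sin (Real.pi * b) / b, div_pos hs hb'.1, .of_forall fun n => ?_⟩
    rw [hb, div_mul_cancel₀ _ hb'.1.ne']
  · refine ⟨2, two_pos, ?_⟩
    filter_upwards [h0.eventually (ge_mem_nhds (by norm_num : (0 : ℝ) < 1 / 2))] with n hn
    have hpi := Real.pi_pos
    have := Real.mul_le_sin (x := Real.pi * β n) (mul_nonneg hpi.le (hβ n).1.le) (by nlinarith)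
    calc 2 * β n = 2 / Real.pi * (Real.pi * β n) := by field_simp
      _ ≤ _ := this

lemma AdmissibleLengths.tendsto_mul {γ β : ℕ → ℝ} (h : AdmissibleLengths γ β) :
    Tendsto (fun n => γ n * β n) atTop atTop := by
  obtain ⟨hγ, hβ, ⟨b, hb⟩ | ⟨-, h1⟩⟩ := h
  · have hb' := hβ 0
    rw [hb] at hb'
    simp_rw [hb]
    exact hγ.atTop_mul_const hb'.1
  · exact h1

lemma AdmissibleLengths.tendsto_degree {γ β : ℕ → ℝ} {d : ℕ → ℕ} {C : ℝ}
    (h : AdmissibleLengths γ β) (hC : 0 < C) (hγ : ∀ n, γ n ≤ C * d n) :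
    Tendsto d atTop atTop ∧ Tendsto (fun n => d n * β n) atTop atTop := by
  constructor
  · rw [← tendsto_natCast_atTop_iff (R := ℝ)]
    refine tendsto_atTop_mono (fun n => ?_) (h.1.const_mul_atTop (inv_pos.2 hC))
    rw [inv_mul_le_iff₀ hC]
    exact hγ n
  · refine tendsto_atTop_mono (fun n => ?_) (h.tendsto_mul.const_mul_atTop (inv_pos.2 hC))
    rw [inv_mul_le_iff₀ hC, ← mul_assoc]
    exact mul_le_mul_of_nonneg_right (hγ n) (h.2.1 n).1.le

lemma genus_le {p : ℕ} (hp : 1 ≤ p) {d ρ : ℕ} (h : ρ ≤ d + 1) :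
    genus p d ρ ≤ ((p : ℝ) - 1) * d := by
  have h1 : (0 : ℝ) ≤ p - 1 := sub_nonneg.2 (by exact_mod_cast hp)
  have h2 : (ρ : ℝ) ≤ d + 1 := by exact_mod_cast h
  unfold genus
  nlinarith

/-- From `d = 4` on, `d - 2` is at least `d / 2`, so no information about the number of poles is
needed. -/
lemma le_genus {p : ℕ} (hp : 1 ≤ p) {d : ℕ} (ρ : ℕ) (hd : 4 ≤ d) :
    ((p : ℝ) - 1) / 4 * d ≤ genus p d ρ := by
  have h1 : (0 : ℝ) ≤ p - 1 := sub_nonneg.2 (by exact_mod_cast hp)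
  have h2 : (4 : ℝ) ≤ d := by exact_mod_cast hd
  have h3 : (0 : ℝ) ≤ ρ := Nat.cast_nonneg ρ
  unfold genus
  nlinarith

end Lengths

end ArtinSchreier

theorem mainTheorem4 (p : ℕ) [Fact p.Prime] (hp : p ≠ 2)
    (F : Type*) [Field F] [Finite F] [CharP F p] (s : ℤˣ) :
    -- ordinary covers, of genus `(p - 1)(d - 1)`
    (∀ (d : ℕ → ℕ) (β : ℕ → ℝ),
      ArtinSchreier.AdmissibleLengths (fun n => ArtinSchreier.genus p (d n) (d n)) β →
      ArtinSchreier.HasStandardGaussianLimit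
        (fun n => ArtinSchreier.ordFamily F (d n))
        (fun n => ArtinSchreier.normalizedSum p s (β n)
          (ArtinSchreier.genus p (d n) (d n)))) ∧
    -- the full family, the genus being that of the individual cover
    (∀ (d : ℕ → ℕ) (β : ℕ → ℝ),
      ArtinSchreier.AdmissibleLengths (fun n => (d n : ℝ)) β →
      ArtinSchreier.HasStandardGaussianLimit
        (fun n => ArtinSchreier.fullFamily F (d n))
        (fun n f => ArtinSchreier.normalizedSum p s (β n)
          (ArtinSchreier.genus p (d n) (ArtinSchreier.poleCount f.2)) f)) ∧
    -- the full family, with one common value `γ n` in the range of the genera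
    (∀ (d : ℕ → ℕ) (γ β : ℕ → ℝ),
      (∀ n, ArtinSchreier.genus p (d n) 1 ≤ γ n ∧ γ n ≤ ArtinSchreier.genus p (d n) (d n)) →
      ArtinSchreier.AdmissibleLengths γ β →
      ArtinSchreier.HasStandardGaussianLimit
        (fun n => ArtinSchreier.fullFamily F (d n))
        (fun n => ArtinSchreier.normalizedSum p s (β n) (γ n))) ∧
    -- prescribed factorization type, with fixed degrees `r` and varying exponents `e n`
    (∀ (m : ℕ) (r : Fin m → ℕ) (e : ℕ → Fin m → ℕ) (β : ℕ → ℝ),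
      (∀ n i, 1 ≤ e n i) →
      (∀ n, (ArtinSchreier.typeFamily F r (e n)).Nonempty) →
      ArtinSchreier.AdmissibleLengths
        (fun n => ArtinSchreier.genus p (∑ i, r i * e n i) (∑ i, r i)) β →
      ArtinSchreier.HasStandardGaussianLimit
        (fun n => ArtinSchreier.typeFamily F r (e n))
        (fun n => ArtinSchreier.normalizedSum p s (β n)
          (ArtinSchreier.genus p (∑ i, r i * e n i) (∑ i, r i)))) := by
  classical
  have hp2 : 2 ≤ p := (Fact.out : p.Prime).two_le
  have hp1 : 1 ≤ p := by omega
  have hp0 : (0 : ℝ) < (p : ℝ) - 1 := by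
    have : (2 : ℝ) ≤ p := by exact_mod_cast hp2
    linarith
  let := ZMod.algebra F p
  have hq : 3 ≤ Nat.card F := by
    have h1 := Nat.card_le_card_of_injective _ (algebraMap (ZMod p) F).injective
    rw [Nat.card_zmod] at h1
    omega
  -- The parameter `γ` governing admissibility is kept apart from the normalizing genus `Γ`, which
  -- may depend on the denominator. The bound by `p * d` covers both the genera and `γ = d`, the
  -- choice for individual genera.
  have key : ∀ (d : ℕ → ℕ) (γ β : ℕ → ℝ) (Q : ℕ → MvPolynomial (Fin 2) F → Prop)
      (Γ : ℕ → MvPolynomial (Fin 2) F → ℝ), ArtinSchreier.AdmissibleLengths γ β →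
      (∀ n, γ n ≤ (p : ℝ) * d n) →
      (∀ n, d n ≠ 0 → (ArtinSchreier.denominators (d n) (Q n)).Nonempty) →
      (∀ n, 4 ≤ d n → ∀ h : MvPolynomial (Fin 2) F, h.IsHomogeneous (d n) → h ≠ 0 →
        ((p : ℝ) - 1) / 4 * d n ≤ Γ n h ∧ Γ n h ≤ ((p : ℝ) - 1) * d n) →
      ArtinSchreier.HasStandardGaussianLimit
        (fun n => {f | f ∈ ArtinSchreier.fullFamily F (d n) ∧ Q n f.2})
        (fun n f => ArtinSchreier.normalizedSum p s (β n) (Γ n f.2) f) := by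
    intro d γ β Q Γ hadm hγ hne hΓ
    obtain ⟨c, hc, hs⟩ := hadm.exists_mul_le_sin
    obtain ⟨hd, hdβ⟩ := hadm.tendsto_degree (by linarith) hγ
    exact ArtinSchreier.hasStandardGaussianLimit_of_denominators p hp s Q Γ hd
      ((hd.eventually_ge_atTop 1).mono fun n hn => hne n (by omega)) (by positivity) hp0.le
      ((hd.eventually_ge_atTop 4).mono hΓ) hadm.2.1 hc hs hdβ
  have hbound : ∀ {x : ℝ} {d : ℕ}, x ≤ ((p : ℝ) - 1) * d → x ≤ p * d := fun h =>
    h.trans (mul_le_mul_of_nonneg_right (by linarith) (Nat.cast_nonneg _))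
  have hfull : ∀ d : ℕ → ℕ, (fun n => ArtinSchreier.fullFamily F (d n)) =
      fun n => {f | f ∈ ArtinSchreier.fullFamily F (d n) ∧ True} := fun d => by
    simp only [and_true]
    rfl
  have hX : ∀ d, (ArtinSchreier.denominators d fun _ : MvPolynomial (Fin 2) F => True).Nonempty :=
    fun d => ⟨MvPolynomial.X 0 ^ d, ArtinSchreier.mem_denominators.2
      ⟨by simpa using (MvPolynomial.isHomogeneous_X F (0 : Fin 2)).pow d,
        pow_ne_zero _ (MvPolynomial.X_ne_zero 0), trivial⟩⟩
  refine ⟨fun d β hadm => ?_, fun d β hadm => ?_, fun d γ β hγ hadm => ?_,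
    fun m r e β he hne hadm => ?_⟩
  · refine key d _ β (fun _ => Squarefree) (fun n _ => ArtinSchreier.genus p (d n) (d n)) hadm
      (fun n => hbound (ArtinSchreier.genus_le hp1 (by omega))) (fun n hn => ?_)
      fun n hn h _ _ => ⟨ArtinSchreier.le_genus hp1 _ hn, ArtinSchreier.genus_le hp1 (by omega)⟩
    obtain ⟨h, hh, hsq⟩ := ArtinSchreier.exists_squarefree_isHomogeneous hq hn
    exact ⟨h, ArtinSchreier.mem_denominators.2 ⟨hh, hsq.ne_zero, hsq⟩⟩
  · rw [hfull]
    refine key d _ β (fun _ _ => True)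
      (fun n h => ArtinSchreier.genus p (d n) (ArtinSchreier.poleCount h)) hadm
      (fun n => le_mul_of_one_le_left (Nat.cast_nonneg _) (by linarith)) (fun n _ => hX _)
      fun n hn h hh h0 => ⟨ArtinSchreier.le_genus hp1 _ hn,
        ArtinSchreier.genus_le hp1 (ArtinSchreier.poleCount_le hh h0)⟩
  · rw [hfull]
    have h1 : ∀ n, γ n ≤ ((p : ℝ) - 1) * d n := fun n =>
      (hγ n).2.trans (ArtinSchreier.genus_le hp1 (by omega))
    exact key d γ β (fun _ _ => True) (fun n _ => γ n) hadm (fun n => hbound (h1 n))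
      (fun n _ => hX _) fun n hn h _ _ => ⟨(ArtinSchreier.le_genus hp1 1 hn).trans (hγ n).1, h1 n⟩
  · have hρ : ∀ n, ∑ i, r i ≤ (∑ i, r i * e n i) + 1 := fun n =>
      (Finset.sum_le_sum fun i _ => Nat.le_mul_of_pos_right _ (he n i)).trans (Nat.le_succ _)
    refine key (fun n => ∑ i, r i * e n i) _ β
      (fun n => ArtinSchreier.HasFactorizationType r (e n))
      (fun n _ => ArtinSchreier.genus p (∑ i, r i * e n i) (∑ i, r i)) hadm
      (fun n => hbound (ArtinSchreier.genus_le hp1 (hρ n))) (fun n hn => ?_)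
      fun n hn h _ _ => ⟨ArtinSchreier.le_genus hp1 _ hn, ArtinSchreier.genus_le hp1 (hρ n)⟩
    obtain ⟨f, hf, hQ⟩ := hne n
    exact ⟨f.2, ArtinSchreier.mem_denominators.2
      ⟨hf.2.1, ArtinSchreier.ne_zero_of_mem_fullFamily hn hf, hQ⟩⟩
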